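/- **Setting.** A post-processing is a function $\kappa:[0,1]\to[0,1]$. Write $[t]_0^1$ for the projection of $t\in\mathbb R$ onto $[0,1]$. A class $\mathcal K$ of (Borel measurable) post-processings is *valid* if it contains the identity and if, for all $\kappa\in\mathcal K$ and $s,t\in\mathbb R$, the function $p\mapsto[\kappa([p+s]_0^1)+t]_0^1$ is again in $\mathcal K$. With $\mathrm{sign}_+(t)=1$ for $t\ge 0$ and $-1$ for $t<0$, put $\mathsf{thr}(\mathcal K)=\{p\mapsto \mathrm{sign}_+(\kappa(p)-\tfrac12) : \kappa\in\mathcal K\}$. A loss $\ell:[0,1]\times\{0,1\}\to\mathbb R$ is *proper* if $\mathbb E_{y\sim\mathrm{Ber}(q)}[\ell(p,y)-\ell(q,y)]\ge 0$ for all $p,q\in[0,1]$; $\mathcal L^*$ is the class of proper losses with $|\ell(p,1)-\ell(p,0)|\le 1$ for all $p$. For a distribution $J$ of pairs $(p,y)\in[0,1]\times\{0,1\}$, a measurable $\hat\kappa:[0,1]\to[0,1]$ is an *$(\varepsilon,\mathcal K)$-omnipredictor* if $\mathbb E_J[\ell(\hat\kappa(p),y)]\le\mathbb E_J[\ell(\kappa(p),y)]+\varepsilon$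 for all $\ell\in\mathcal L^*$, $\kappa\in\mathcal K$. An *$\varepsilon'$-agnostic learner* for $\mathcal C\subseteq\{[0,1]\to\{\pm1\}\}$ is a randomized procedure that, for some sample size $m$ and for every distribution $D$ on $[0,1]\times\{\pm1\}$, when given $m$ i.i.d. examples from $D$ outputs a hypothesis $h:[0,1]\to\{\pm1\}$ (depending jointly measurably on the examples, the internal random seed and the point) such that, with probability at least $0.9$ over the examples and the seed, $\Pr_D[h(p)\ne z]\le\inf_{f\in\mathcal C}\Pr_D[f(p)\ne z]+\varepsilon'$. **Machine model.** Algorithms are programs for a real RAM (unit-cost rational constants, arithmetic and comparison of reals; addition, truncated subtraction and comparison of integer indices; indirect addressing; no rounding), which at unit cost can also draw a labelled example from $J$, draw a uniform number in $[0,1]$, evaluate a hypothesis returned earlier by the learner at a point, and call the learner. In a call the learner receives $m$ fresh examples from $J$, each relabelled in $\{\pm1\}$ by a subroutine of the algorithm that may use the current memory and one uniform random number per example. The output $\hat\kappa$ is given by a subroutine that evaluates it at any point from the final memory. **Theorem (Omniprediction from Agnostic Learning).** There are a single such algorithm and absolute constants $C,k$ with the following property. Let $\varepsilon,\delta\in(0,1)$,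 let $\mathcal K$ be a valid post-processing class, let $\mathsf{AL}$ be an $(\varepsilon/3)$-agnostic learner for $\mathsf{thr}(\mathcal K)$, and let $J$ be a distribution on $[0,1]\times\{0,1\}$. On input $\varepsilon,\delta$, with i.i.d. examples from $J$ and access to $\mathsf{AL}$, the algorithm always halts, calls $\mathsf{AL}$ at most $C\log(2/\delta)/\varepsilon^2$ times, performs at most $C(1/\varepsilon)^k\log(2/\delta)$ operations (not counting those inside $\mathsf{AL}$ and those of preparing the examples for $\mathsf{AL}$), and outputs some $\hat\kappa:[0,1]\to[0,1]$ that, with probability at least $1-\delta$, is an $(\varepsilon,\mathcal K)$-omnipredictor for $J$. Moreover, preparing one example for $\mathsf{AL}$, and evaluating $\hat\kappa$ at one point, each take at most $C(1/\varepsilon)^k\log(2/\delta)$ operations. -/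

import Mathlib

open MeasureTheory
open scoped unitInterval

universe u

noncomputable section

namespace Omniprediction

/-! ### Losses, post-processings, thresholds, omnipredictors

Outcomes in {0,1} are modelled by `Bool` (`true` is the outcome 1), labels in {-1,+1} by `ℤˣ`. -/

/-- The outcome as a real number. -/
def outcome (y : Bool) : ℝ := if y then 1 else 0

/-- The expectation of `f y` for `y ~ Ber(q)`. -/
def bernoulliMean (q : I) (f : Bool → ℝ) : ℝ := (q : ℝ) * f true + (1 - (q : ℝ)) * f false

/-- Proper losses: predicting the true mean is optimal. -/
def IsProper (l : I → Bool → ℝ) : Prop :=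
  ∀ p q : I, 0 ≤ bernoulliMean q (fun y => l p y - l q y)

/-- The class of proper losses with `|l(p,1) - l(p,0)| ≤ 1` for all `p`. -/
def properLosses : Set (I → Bool → ℝ) :=
  {l | IsProper l ∧ ∀ p, |l p true - l p false| ≤ 1}

/-- The projection of a real number onto `[0,1]`. -/
def clip (t : ℝ) : I := Set.projIcc 0 1 zero_le_one t

/-- A valid post-processing class: it contains the identity and is translation invariant. -/
def IsValid (K : Set (I → I)) : Prop :=
  (fun p => p) ∈ K ∧
  ∀ κ ∈ K, ∀ s t : ℝ, (fun p : I => clip ((κ (clip ((p : ℝ) + s)) : ℝ) + t)) ∈ K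

/-- The sign function with value `+1` at zero. -/
def signPlus (t : ℝ) : ℤˣ := if 0 ≤ t then 1 else -1

/-- The upper thresholds of a class of post-processings. -/
def thr (K : Set (I → I)) : Set (I → ℤˣ) :=
  {f | ∃ κ ∈ K, f = fun p => signPlus ((κ p : ℝ) - 1 / 2)}

/-- `κ'` is an `(ε, K)`-omnipredictor for the distribution `J`. -/
def IsOmnipredictor (J : Measure (I × Bool)) (ε : ℝ) (K : Set (I → I)) (κ' : I → I) : Prop :=
  Measurable κ' ∧
  ∀ l ∈ properLosses, ∀ κ ∈ K,
    ∫ x, l (κ' x.1) x.2 ∂J ≤ ∫ x, l (κ x.1) x.2 ∂J + ε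

/-! ### Agnostic learners -/

/-- A randomized learning procedure: from `sampleSize` labelled examples and an internal random
seed it produces a hypothesis. It is a black box, whose own running time is not counted. -/
structure Learner (S : Type u) [MeasurableSpace S] where
  sampleSize : ℕ
  run : (Fin sampleSize → I × ℤˣ) → S → I → ℤˣ
  measurable_run :
    Measurable (fun x : (Fin sampleSize → I × ℤˣ) × S × I => run x.1 x.2.1 x.2.2)

/-- For every distribution `D`, with probability at least `0.9` over i.i.d. examples from `D` and
a seed drawn from `ν`, the hypothesis has error at most `ε` above the best error in `C`. -/
def IsAgnosticLearner {S : Type u} [MeasurableSpace S] (ν : Measure S) (AL : Learner S)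
    (ε : ℝ) (C : Set (I → ℤˣ)) : Prop :=
  ∀ (D : Measure (I × ℤˣ)) [IsProbabilityMeasure D],
    (9 / 10 : ℝ) ≤ ((Measure.pi (fun _ : Fin AL.sampleSize => D)).prod ν).real
      {ω | ∀ f ∈ C, D.real {x | AL.run ω.1 ω.2 x.1 ≠ x.2} ≤ D.real {x | f x.1 ≠ x.2} + ε}

/-! ### The machine model: a real RAM with example, coin and learner oracles

A program uses index variables (natural numbers), scalar variables (real numbers) and arrays of
real numbers addressed through index variables. Every elementary operation and every test costs
one time unit. There is no multiplication on indices, and no rounding of reals to integers. -/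

/-- The state: index variables, real variables, real arrays, the list of hypotheses that the
learner has returned so far, and the numbers of examples and of random numbers drawn so far. -/
structure State where
  nat : ℕ → ℕ
  real : ℕ → ℝ
  arr : ℕ → ℕ → ℝ
  hyps : List (I → ℤˣ)
  examples : ℕ
  coins : ℕ

def State.setNat (s : State) (i n : ℕ) : State := { s with nat := Function.update s.nat i n }

def State.setReal (s : State) (i : ℕ) (x : ℝ) : State :=
  { s with real := Function.update s.real i x }

/-- Deterministic elementary operations. -/
inductive Instr where
  | natConst (i n : ℕ)
  | natAdd (i j k : ℕ)
  | natSub (i j k : ℕ)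
  | realConst (i : ℕ) (q : ℚ)
  | realAdd (i j k : ℕ)
  | realSub (i j k : ℕ)
  | realMul (i j k : ℕ)
  | realDiv (i j k : ℕ)
  | load (i a j : ℕ)
  | store (a j i : ℕ)
  | query (i j k : ℕ)

/-- The effect of an elementary operation. The first argument is the target; `load i a j` reads
and `store a j i` writes the cell of array `a` whose address is in index variable `j`;
`query i j k` evaluates the hypothesis whose number is in index variable `j` at the point in real
variable `k` (the result is `1` if there is no such hypothesis). -/
def Instr.apply : Instr → State → State
  | .natConst i n, s => s.setNat i n
  | .natAdd i j k, s => s.setNat i (s.nat j + s.nat k)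
  | .natSub i j k, s => s.setNat i (s.nat j - s.nat k)
  | .realConst i q, s => s.setReal i (q : ℝ)
  | .realAdd i j k, s => s.setReal i (s.real j + s.real k)
  | .realSub i j k, s => s.setReal i (s.real j - s.real k)
  | .realMul i j k, s => s.setReal i (s.real j * s.real k)
  | .realDiv i j k, s => s.setReal i (s.real j / s.real k)
  | .load i a j, s => s.setReal i (s.arr a (s.nat j))
  | .store a j i, s =>
      { s with arr := Function.update s.arr a (Function.update (s.arr a) (s.nat j) (s.real i)) }
  | .query i j k, s =>
      s.setReal i (((s.hyps.getD (s.nat j) (fun _ => 1) (clip (s.real k)) : ℤˣ) : ℤ) : ℝ)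

/-- Tests: strict comparison of two index variables or of two real variables. -/
inductive Test where
  | natLt (i j : ℕ)
  | realLt (i j : ℕ)

def Test.holds : Test → State → Prop
  | .natLt i j, s => s.nat i < s.nat j
  | .realLt i j, s => s.real i < s.real j

/-- Structured programs over elementary operations of type `α`; `loop b c` is a while loop. -/
inductive Cmd (α : Type) where
  | skip
  | op (a : α)
  | seq (c d : Cmd α)
  | ite (b : Test) (c d : Cmd α)
  | loop (b : Test) (c : Cmd α)

/-- `Exec step c s t s'`: started in `s`, the program `c` halts after `t` time units in `s'`. -/
inductive Exec {α : Type} (step : α → State → State → Prop) :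
    Cmd α → State → ℕ → State → Prop where
  | skip (s : State) : Exec step .skip s 1 s
  | op {a : α} {s s' : State} (h : step a s s') : Exec step (.op a) s 1 s'
  | seq {c d : Cmd α} {s s' s'' : State} {t t' : ℕ} (h : Exec step c s t s')
      (h' : Exec step d s' t' s'') : Exec step (.seq c d) s (t + t') s''
  | iteTrue {b : Test} {c d : Cmd α} {s s' : State} {t : ℕ} (hb : b.holds s)
      (h : Exec step c s t s') : Exec step (.ite b c d) s (1 + t) s'
  | iteFalse {b : Test} {c d : Cmd α} {s s' : State} {t : ℕ} (hb : ¬ b.holds s)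
      (h : Exec step d s t s') : Exec step (.ite b c d) s (1 + t) s'
  | loopExit {b : Test} {c : Cmd α} {s : State} (hb : ¬ b.holds s) :
      Exec step (.loop b c) s 1 s
  | loopStep {b : Test} {c : Cmd α} {s s' s'' : State} {t t' : ℕ} (hb : b.holds s)
      (h : Exec step c s t s') (h' : Exec step (.loop b c) s' t' s'') :
      Exec step (.loop b c) s (1 + t + t') s''

/-- Execution of a deterministic subroutine. -/
def ExecSub (c : Cmd Instr) (s : State) (t : ℕ) (s' : State) : Prop :=
  Exec (fun (a : Instr) s s' => s' = a.apply s) c s t s'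

/-- Elementary operations of the main program: the deterministic ones, drawing a fresh labelled
example `(p, y)` into two real variables, drawing a uniform random number in `[0,1]`, and calling
the learner. -/
inductive Op where
  | basic (a : Instr)
  | sample (i j : ℕ)
  | uniform (i : ℕ)
  | call

/-- An algorithm with access to a learner consists of a main program, a subroutine that prepares
the examples handed to the learner by relabelling fresh examples, and a subroutine that evaluates
the final post-processing function from the final state of the main program. -/
structure Algorithm where
  main : Cmd Op
  relabel : Cmd Instr
  predict : Cmd Instr

/-- All the randomness of a run: the labelled examples drawn by the main program, the random
numbers drawn by the main program, and, for each call of the learner, its `m` fresh labelled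
examples, each with a random number for the relabelling, and the internal seed of the learner. -/
abbrev Tape (m : ℕ) (S : Type u) : Type u :=
  (ℕ → I × Bool) × (ℕ → I) × (ℕ → (Fin m → (I × Bool) × I) × S)

/-- The law of the tape: everything is independent, labelled examples come from `J`, random
numbers are uniform on `[0,1]`, and seeds come from `ν`. -/
def tapeLaw (J : Measure (I × Bool)) [IsProbabilityMeasure J] {S : Type u} [MeasurableSpace S]
    (ν : Measure S) [IsProbabilityMeasure ν] (m : ℕ) : Measure (Tape m S) :=
  (Measure.infinitePi (fun _ : ℕ => J)).prod
    ((Measure.infinitePi (fun _ : ℕ => (volume : Measure I))).prod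
      (Measure.infinitePi (fun _ : ℕ =>
        (Measure.pi (fun _ : Fin m => J.prod (volume : Measure I))).prod ν)))

/-- In state `s` the subroutine `c` turns every labelled example `(p, y)` and random number `u`
(passed in the real variables 0, 1, 2) into the label `z p y u`, which is the sign of real
variable 0 at the end, in at most `W` time units. -/
def Relabels (c : Cmd Instr) (W : ℝ) (s : State) (z : I → Bool → I → ℤˣ) : Prop :=
  ∀ (p : I) (y : Bool) (u : I), ∃ (t : ℕ) (s' : State), (t : ℝ) ≤ W ∧
    ExecSub c (((s.setReal 0 p).setReal 1 (outcome y)).setReal 2 u) t s' ∧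
    z p y u = signPlus (s'.real 0)

/-- One elementary operation of the main program on the tape `ω`. A call of the learner costs one
time unit, uses the fresh examples and the seed that belong to this call, prepares each example in
at most `W` time units, and appends the new hypothesis to the list. -/
def Op.step (A : Algorithm) {S : Type u} [MeasurableSpace S] (AL : Learner S) (W : ℝ)
    (ω : Tape AL.sampleSize S) : Op → State → State → Prop
  | .basic a, s, s' => s' = a.apply s
  | .sample i j, s, s' =>
      s' = { (s.setReal i (ω.1 s.examples).1).setReal j (outcome (ω.1 s.examples).2) with
        examples := s.examples + 1 }
  | .uniform i, s, s' => s' = { s.setReal i (ω.2.1 s.coins) with coins := s.coins + 1 }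
  | .call, s, s' => ∃ z : I → Bool → I → ℤˣ, Relabels A.relabel W s z ∧
      s' = { s with
        hyps := s.hyps ++ [AL.run
          (fun n =>
            let x := (ω.2.2 s.hyps.length).1 n
            (x.1.1, z x.1.1 x.1.2 x.2))
          (ω.2.2 s.hyps.length).2] }

/-- Initially the first two real variables hold `ε` and `δ`, and everything else is blank. -/
def initState (ε δ : ℝ) : State where
  nat := fun _ => 0
  real := Function.update (Function.update (fun _ => 0) 0 ε) 1 δ
  arr := fun _ _ => 0
  hyps := []
  examples := 0
  coins := 0

/-- In state `s` the subroutine `c` evaluates the function `κ'` at every point `p` (passed in real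
variable 0, where it also leaves the value) in at most `W` time units. -/
def Evaluates (c : Cmd Instr) (W : ℝ) (s : State) (κ' : I → I) : Prop :=
  ∀ p : I, ∃ (t : ℕ) (s' : State), (t : ℝ) ≤ W ∧ ExecSub c (s.setReal 0 p) t s' ∧
    s'.real 0 = κ' p

/-- On input `ε, δ` and tape `ω`, the algorithm halts within `W` time units, calls the learner at
most `N` times, and outputs `κ'`. The relabelling of an example for the learner and the evaluation
of the output at a point take at most `W` time units each. -/
def Algorithm.Outputs (A : Algorithm) {S : Type u} [MeasurableSpace S] (AL : Learner S)
    (N W ε δ : ℝ) (ω : Tape AL.sampleSize S) (κ' : I → I) : Prop :=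
  ∃ (t : ℕ) (s : State), Exec (Op.step A AL W ω) A.main (initState ε δ) t s ∧
    (t : ℝ) ≤ W ∧ (s.hyps.length : ℝ) ≤ N ∧ Evaluates A.predict W s κ'

end Omniprediction

end

/-! The predictor is built by boosting on the grid `{0, …, M}/M` with `M = ⌈42/ε⌉`. For a proper
loss `l` with `|l(p,1) - l(p,0)| ≤ 1`, the slope `l(·,1) - l(·,0)` is antitone, hence an average of
signs of upper sets. Properness gives the pointwise bound `l(k₁,y) - l(k₂,y) ≤ (y - k₁)(slope(k₁) -
slope(k₂))`. So `k₁` is nearly as good as `k₂` for every loss at once if its residual `y - k₁` has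
small correlation with the upper level sets of `k₁` (calibration), and at most small positive
correlation with those of `k₂` (`integral_loss_le`). For `k₂` in the class, such level sets are
limits of elements of the threshold class (`integral_upSign_le`). Relabelling an example by a random
sign whose mean is the residual turns agnostic learning into maximization of this correlation
(`labelErr_residualLabel`).

Each round tests, on fresh examples, a growing list of features: the level sets of all predictors so
far, all earlier hypotheses and a new one. If some test statistic is large, the predictor is moved
by one feature with weight ±1, and its squared error, in units where predictions range over `[0,
M]`, drops by at least 1 (`sqErr_update`). Hence at most `M²` of the `50 M²` rounds change the
predictor (`updateCount_le`). The other rounds are called quiet.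

The learner succeeds only with probability 0.9, and a budget of order `log(2/δ)/ε²` calls does not
pay for a union bound over rounds. Each round therefore runs a short random walk among candidate
hypotheses, and only the total number of wrong steps over all rounds is controlled, by an
exponential moment (`measure_wrong_le`). Some quiet round then has a majority of right steps; its
search would have found a correlated hypothesis if there were one (`testBit_of_few_wrong`), so its
predictor is nearly uncorrelated with the threshold class (`exists_good_round`). The algorithm does
not know which round this is. It outputs the last quiet predictor: that one has been tested against
the level sets of all earlier predictors, so it is at most `O(1/M)` worse than the unknown good one
(`isOmnipredictor_output`).

The running time must be linear in `log(2/δ)`. A test needs of order `log(2/δ)` examples and a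
search takes of order `log(2/δ)` steps, so testing every candidate in the main program would cost
the square. The test is therefore evaluated while examples are prepared for the learner, which is
not counted: all of them receive the outcome of the test as label, and the main program reads this
bit off the returned hypothesis at one fresh point. The reading is wrong with constant probability,
which the walk tolerates. Only the final candidate of a round is tested openly.

On every tape the program follows a mathematical process (`omnipredict_outputs`), so probability
enters only afterwards. Independence is used through resampling: redrawing part of the tape
preserves its law (`measure_le_of_resample`, `le_lintegral_indicator_of_resample`). All tests are
accurate by Hoeffding's inequality and a union bound over all possible candidates
(`measure_not_accurate_le`). -/

noncomputable section

namespace Omniprediction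

/-! ### Reasoning about programs -/

/-- `c`, started in `s`, halts within `T` time units in a state with property `Q`. -/
def Runs {α : Type} (step : α → State → State → Prop) (c : Cmd α) (s : State) (T : ℕ)
    (Q : State → Prop) : Prop :=
  ∃ (t : ℕ) (s' : State), t ≤ T ∧ Exec step c s t s' ∧ Q s'

/-- The step relation of deterministic subroutines. -/
def detStep (a : Instr) (s s' : State) : Prop := s' = a.apply s

section Rules

variable {α : Type} {step : α → State → State → Prop} {c d : Cmd α} {s : State} {T T' : ℕ}
  {P Q : State → Prop}

theorem Runs.mono (h : Runs step c s T P) (hT : T ≤ T') (hQ : ∀ s', P s' → Q s') :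
    Runs step c s T' Q := by
  obtain ⟨t, s', h1, h2, h3⟩ := h
  exact ⟨t, s', h1.trans hT, h2, hQ _ h3⟩

theorem Runs.seq (h : Runs step c s T P) (h' : ∀ s', P s' → Runs step d s' T' Q) :
    Runs step (.seq c d) s (T + T') Q := by
  obtain ⟨t, s', h1, h2, h3⟩ := h
  obtain ⟨t', s'', h4, h5, h6⟩ := h' s' h3
  exact ⟨t + t', s'', by omega, .seq h2 h5, h6⟩

theorem Runs.op {a : α} {s' : State} (h : step a s s') (hQ : Q s') : Runs step (.op a) s 1 Q :=
  ⟨1, s', le_rfl, .op h, hQ⟩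

theorem Runs.ite {b : Test} (h : b.holds s → Runs step c s T Q)
    (h' : ¬ b.holds s → Runs step d s T Q) : Runs step (.ite b c d) s (T + 1) Q := by
  by_cases hb : b.holds s
  · obtain ⟨t, s', h1, h2, h3⟩ := h hb
    exact ⟨1 + t, s', by omega, .iteTrue hb h2, h3⟩
  · obtain ⟨t, s', h1, h2, h3⟩ := h' hb
    exact ⟨1 + t, s', by omega, .iteFalse hb h2, h3⟩

/-- Induction on the number `m` of remaining iterations. Each iteration pays one unit for its test,
and the last summand 1 is the failing test. -/
theorem Runs.loop_aux {b : Test} (n : ℕ) (Inv : ℕ → State → Prop)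
    (hstep : ∀ k < n, ∀ s, Inv k s → b.holds s ∧ Runs step c s T (Inv (k + 1)))
    (hend : ∀ s, Inv n s → ¬ b.holds s) :
    ∀ m k, k + m = n → ∀ s, Inv k s → Runs step (.loop b c) s (m * (T + 1) + 1) (Inv n) := by
  intro m
  induction m with
  | zero =>
    intro k hk s hs
    obtain rfl : k = n := by omega
    exact ⟨1, s, by omega, .loopExit (hend s hs), hs⟩
  | succ m ih =>
    intro k hk s hs
    obtain ⟨hb, t, s', h1, h2, h3⟩ := hstep k (by omega) s hs
    obtain ⟨t', s'', h4, h5, h6⟩ := ih (k + 1) (by omega) s' h3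
    refine ⟨1 + t + t', s'', ?_, .loopStep hb h2 h5, h6⟩
    rw [Nat.succ_mul]; omega

theorem Runs.loop {b : Test} (n : ℕ) (Inv : ℕ → State → Prop) (h0 : Inv 0 s)
    (hstep : ∀ k < n, ∀ s, Inv k s → b.holds s ∧ Runs step c s T (Inv (k + 1)))
    (hend : ∀ s, Inv n s → ¬ b.holds s) : Runs step (.loop b c) s (n * (T + 1) + 1) (Inv n) :=
  Runs.loop_aux n Inv hstep hend n 0 (by omega) s h0

end Rules

/-! ### Registers that a program may change -/

/-- Boolean-valued, so that for a concrete program and a concrete register the claim "never written"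
holds by `rfl`. -/
def Instr.writesNat : Instr → ℕ → Bool
  | .natConst i _, x => i == x
  | .natAdd i _ _, x => i == x
  | .natSub i _ _, x => i == x
  | _, _ => false

def Instr.writesReal : Instr → ℕ → Bool
  | .realConst i _, x => i == x
  | .realAdd i _ _, x => i == x
  | .realSub i _ _, x => i == x
  | .realMul i _ _, x => i == x
  | .realDiv i _ _, x => i == x
  | .load i _ _, x => i == x
  | .query i _ _, x => i == x
  | _, _ => false

def Instr.writesArr : Instr → ℕ → Bool
  | .store a _ _, x => a == x
  | _, _ => false

def Cmd.anyOp {α : Type} (f : α → Bool) : Cmd α → Bool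
  | .skip => false
  | .op a => f a
  | .seq c d => c.anyOp f || d.anyOp f
  | .ite _ c d => c.anyOp f || d.anyOp f
  | .loop _ c => c.anyOp f

/-- A property of pairs of states that is preserved by all operations of a program is preserved
by the program. -/
theorem Exec.preserve {α : Type} {step : α → State → State → Prop} {f : α → Bool}
    (Rel : State → State → Prop) (hrefl : ∀ s, Rel s s)
    (htrans : ∀ s s' s'', Rel s s' → Rel s' s'' → Rel s s'')
    (hop : ∀ a s s', f a = false → step a s s' → Rel s s') {c : Cmd α} {s s' : State} {t : ℕ}
    (h : Exec step c s t s') (hc : c.anyOp f = false) : Rel s s' := by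
  induction h with
  | skip s => exact hrefl s
  | op h => exact hop _ _ _ hc h
  | seq _ _ ih ih' =>
    simp only [Cmd.anyOp, Bool.or_eq_false_iff] at hc
    exact htrans _ _ _ (ih hc.1) (ih' hc.2)
  | iteTrue _ _ ih =>
    simp only [Cmd.anyOp, Bool.or_eq_false_iff] at hc
    exact ih hc.1
  | iteFalse _ _ ih =>
    simp only [Cmd.anyOp, Bool.or_eq_false_iff] at hc
    exact ih hc.2
  | loopExit _ => exact hrefl _
  | loopStep _ _ _ ih ih' => exact htrans _ _ _ (ih hc) (ih' hc)

theorem Instr.apply_nat {a : Instr} {x : ℕ} (h : a.writesNat x = false) (s : State) :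
    (a.apply s).nat x = s.nat x := by
  cases a <;> simp only [Instr.writesNat, beq_eq_false_iff_ne] at h <;>
    first
    | rfl
    | exact Function.update_of_ne (Ne.symm h) _ _

theorem Instr.apply_real {a : Instr} {x : ℕ} (h : a.writesReal x = false) (s : State) :
    (a.apply s).real x = s.real x := by
  cases a <;> simp only [Instr.writesReal, beq_eq_false_iff_ne] at h <;>
    first
    | rfl
    | exact Function.update_of_ne (Ne.symm h) _ _

theorem Instr.apply_arr {a : Instr} {x : ℕ} (h : a.writesArr x = false) (s : State) :
    (a.apply s).arr x = s.arr x := by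
  cases a <;> simp only [Instr.writesArr, beq_eq_false_iff_ne] at h <;>
    first
    | rfl
    | exact Function.update_of_ne (Ne.symm h) _ _

theorem Instr.apply_rest (a : Instr) (s : State) :
    (a.apply s).hyps = s.hyps ∧ (a.apply s).examples = s.examples ∧
      (a.apply s).coins = s.coins := by
  cases a <;> simp [Instr.apply, State.setNat, State.setReal]

/-- `s'` agrees with `s` outside the registers that `c` may change. -/
structure Frame (c : Cmd Instr) (s s' : State) : Prop where
  nat : ∀ x, c.anyOp (fun a => a.writesNat x) = false → s'.nat x = s.nat x
  real : ∀ x, c.anyOp (fun a => a.writesReal x) = false → s'.real x = s.real x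
  arr : ∀ x, c.anyOp (fun a => a.writesArr x) = false → s'.arr x = s.arr x
  hyps : s'.hyps = s.hyps
  examples : s'.examples = s.examples
  coins : s'.coins = s.coins

theorem Frame.refl (c : Cmd Instr) (s : State) : Frame c s s :=
  ⟨fun _ _ => rfl, fun _ _ => rfl, fun _ _ => rfl, rfl, rfl, rfl⟩

theorem Frame.trans {c : Cmd Instr} {s s' s'' : State} (h : Frame c s s') (h' : Frame c s' s'') :
    Frame c s s'' :=
  ⟨fun x hx => (h'.nat x hx).trans (h.nat x hx), fun x hx => (h'.real x hx).trans (h.real x hx),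
    fun x hx => (h'.arr x hx).trans (h.arr x hx), h'.hyps.trans h.hyps,
    h'.examples.trans h.examples, h'.coins.trans h.coins⟩

/-- Replaces explicit bookkeeping of unchanged registers: invariants of loops mention only what
changes, and everything else is recovered from the syntax of the program. -/
theorem Exec.frame {c : Cmd Instr} {s s' : State} {t : ℕ} (h : Exec detStep c s t s') :
    Frame c s s' := by
  have hr : s'.hyps = s.hyps ∧ s'.examples = s.examples ∧ s'.coins = s.coins := by
    refine Exec.preserve (f := fun _ => false)
      (fun s s' => s'.hyps = s.hyps ∧ s'.examples = s.examples ∧ s'.coins = s.coins)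
      (by simp) ?_ ?_ h ?_
    · rintro s s' s'' ⟨h1, h2, h3⟩ ⟨h4, h5, h6⟩
      exact ⟨h4.trans h1, h5.trans h2, h6.trans h3⟩
    · rintro a s s' - rfl
      exact a.apply_rest s
    · clear h
      induction c <;> simp_all [Cmd.anyOp]
  refine ⟨fun x hx => ?_, fun x hx => ?_, fun x hx => ?_, hr.1, hr.2.1, hr.2.2⟩
  · exact Exec.preserve (fun s s' => s'.nat x = s.nat x) (by simp)
      (fun _ _ _ h h' => h'.trans h)
      (fun a s s' ha h => by rw [h]; exact Instr.apply_nat ha s) h hx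
  · exact Exec.preserve (fun s s' => s'.real x = s.real x) (by simp)
      (fun _ _ _ h h' => h'.trans h)
      (fun a s s' ha h => by rw [h]; exact Instr.apply_real ha s) h hx
  · exact Exec.preserve (fun s s' => s'.arr x = s.arr x) (by simp)
      (fun _ _ _ h h' => h'.trans h)
      (fun a s s' ha h => by rw [h]; exact Instr.apply_arr ha s) h hx

theorem Runs.frame {c : Cmd Instr} {s : State} {T : ℕ} {Q : State → Prop}
    (h : Runs detStep c s T Q) : Runs detStep c s T (fun s' => Q s' ∧ Frame c s s') := by
  obtain ⟨t, s', h1, h2, h3⟩ := h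
  exact ⟨t, s', h1, h2, h3, h2.frame⟩

/-- The loop rule, with the unchanged registers added to the invariant. -/
theorem Runs.loopFrame {b : Test} {c : Cmd Instr} {s₀ : State} {T : ℕ} (n : ℕ)
    (Inv : ℕ → State → Prop) (h0 : Inv 0 s₀)
    (hstep : ∀ k < n, ∀ s, Frame c s₀ s → Inv k s → b.holds s ∧ Runs detStep c s T (Inv (k + 1)))
    (hend : ∀ s, Frame c s₀ s → Inv n s → ¬ b.holds s) :
    Runs detStep (.loop b c) s₀ (n * (T + 1) + 1) (fun s => Inv n s ∧ Frame c s₀ s) := by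
  refine Runs.loop n (fun k s => Inv k s ∧ Frame c s₀ s) ⟨h0, Frame.refl _ _⟩ ?_ ?_
  · rintro k hk s ⟨hI, hF⟩
    obtain ⟨hb, hr⟩ := hstep k hk s hF hI
    exact ⟨hb, hr.frame.mono le_rfl fun s' h => ⟨h.1, hF.trans h.2⟩⟩
  · rintro s ⟨hI, hF⟩
    exact hend s hF hI

/-- A list of elementary operations. -/
def ops : List Instr → Cmd Instr
  | [] => .skip
  | a :: l => .seq (.op a) (ops l)

/-- The extra time unit is the closing `skip`; it explains the constants in all later time bounds.
-/
theorem Runs.ops (l : List Instr) (s : State) {Q : State → Prop}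
    (h : Q (l.foldl (fun s a => a.apply s) s)) :
    Runs detStep (ops l) s (l.length + 1) Q := by
  induction l generalizing s with
  | nil => exact ⟨1, s, le_rfl, .skip s, h⟩
  | cons a l ih =>
    have := Runs.seq (Q := Q) (Runs.op (step := detStep) (a := a) (s := s) (Q := fun s' => s' = a.apply s)
      rfl rfl) (d := Omniprediction.ops l) (T' := l.length + 1)
      (by rintro s' rfl; exact ih _ h)
    exact this.mono (by simp; omega) fun _ h => h

theorem Runs.opsSeq {l : List Instr} {c : Cmd Instr} {s : State} {T : ℕ} {Q : State → Prop}
    (h : ∀ s', s' = l.foldl (fun s a => a.apply s) s → Runs detStep c s' T Q) :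
    Runs detStep (.seq (Omniprediction.ops l) c) s (l.length + 1 + T) Q :=
  Runs.seq (Runs.ops (Q := fun s' => s' = l.foldl (fun s a => a.apply s) s) l s rfl) h

theorem Runs.frameSeq {c d : Cmd Instr} {s : State} {T T' : ℕ} {P Q : State → Prop}
    (h : Runs detStep c s T P) (h' : ∀ s', P s' → Frame c s s' → Runs detStep d s' T' Q) :
    Runs detStep (.seq c d) s (T + T') Q :=
  Runs.seq h.frame fun s' hs => h' s' hs.1 hs.2

/-- A sequence of programs. -/
def block {α : Type} : List (Cmd α) → Cmd α
  | [] => .skip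
  | [c] => c
  | c :: d :: l => .seq c (block (d :: l))

/-! ### Subroutines inside the main program -/

/-- A deterministic subroutine as a part of a main program. -/
def Cmd.lift : Cmd Instr → Cmd Op
  | .skip => .skip
  | .op a => .op (.basic a)
  | .seq c d => .seq c.lift d.lift
  | .ite b c d => .ite b c.lift d.lift
  | .loop b c => .loop b c.lift

theorem Exec.lift {step : Op → State → State → Prop}
    (hstep : ∀ a s, step (.basic a) s (a.apply s)) {c : Cmd Instr} {s s' : State} {t : ℕ}
    (h : Exec detStep c s t s') : Exec step c.lift s t s' := by
  induction h with
  | skip s => exact .skip s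
  | op h => exact .op (by rw [h]; exact hstep _ _)
  | seq _ _ ih ih' => exact .seq ih ih'
  | iteTrue hb _ ih => exact .iteTrue hb ih
  | iteFalse hb _ ih => exact .iteFalse hb ih
  | loopExit hb => exact .loopExit hb
  | loopStep hb _ _ ih ih' => exact .loopStep hb ih ih'

theorem Runs.lift {step : Op → State → State → Prop}
    (hstep : ∀ a s, step (.basic a) s (a.apply s)) {c : Cmd Instr} {s : State} {T : ℕ}
    {Q : State → Prop} (h : Runs detStep c s T Q) :
    Runs step c.lift s T (fun s' => Q s' ∧ Frame c s s') := by
  obtain ⟨t, s', h1, h2, h3⟩ := h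
  exact ⟨t, s', h1, h2.lift hstep, h3, h2.frame⟩

end Omniprediction

end

noncomputable section

set_option linter.unusedSimpArgs false

namespace Omniprediction

/-! ### The predictor computed from hypotheses and weights

The scaled predictor takes values in `{0, …, M}`. Row `r` contributes the features
`sign (K_r - v)`, `v = 0, …, M`, and the value of the hypothesis number `r`; the next value of the
predictor is obtained by adding a weighted sum of the features present so far. -/

/-- The features after row `r`. -/
def addFeatures (M r : ℕ) (κ h : ℝ) (G : ℕ → ℝ) (l : ℕ) : ℝ :=
  if l < r * (M + 2) then G l
  else if l < r * (M + 2) + (M + 1) then (if κ < ((l - r * (M + 2) : ℕ) : ℝ) then -1 else 1)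
  else h

/-- Truncation to `[0, M]`. -/
def truncate (M : ℕ) (x : ℝ) : ℝ := if x < 0 then 0 else if (M : ℝ) < x then M else x

/-- The scaled prediction and the features after `r` rows, from the weights `w` and the values
`h` of the hypotheses. -/
def rowsVal (M : ℕ) (w : ℕ → ℕ → ℝ) (h : ℕ → ℝ) : ℕ → ℝ × (ℕ → ℝ)
  | 0 => (0, fun _ => 0)
  | r + 1 =>
    let p := rowsVal M w h r
    let G := addFeatures M r p.1 (h r) p.2
    (truncate M (p.1 + ∑ l ∈ Finset.range ((r + 1) * (M + 2)), w r l * G l), G)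

/-- The address of the first weight of row `r`. -/
def rowStart (M r : ℕ) : ℕ := ∑ q ∈ Finset.range r, (q + 1) * (M + 2)

/-- The weights stored in a flat array. -/
def flatWeights (M : ℕ) (W : ℕ → ℝ) (r l : ℕ) : ℝ := W (rowStart M r + l)

/-- The value at `x` of hypothesis number `n`. -/
def hypVal (hyps : List (I → ℤˣ)) (n : ℕ) (x : ℝ) : ℝ :=
  (((hyps.getD n (fun _ => 1) (clip x) : ℤˣ) : ℤ) : ℝ)

/-! ### The program that evaluates the predictor

Index variables: 0 and 1 hold the constants 0 and 1; 2: `M + 1`; 15: number of rows; 16: number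
of points; 20: row; 21: number of a hypothesis; 22, 28: addresses in array 3; 23: point; 24: address
in array 5; 25: number of features; 26: threshold; 27: feature; 29: selected feature.
Real variables: 3: `M`; 7 and 8 hold the constants 0 and 1; 20–23, 25–28, 30: auxiliary;
24: prediction; 31: correlation of the residuals with the selected feature.
Arrays: 0: points; 1: outcomes; 2: numbers of the hypotheses of the rows; 3: values of these
hypotheses at the points; 4: features at a point; 5: weights. -/

/-- Arrays hold reals only, and reals cannot be converted to indices. An index stored as a real is
recovered by counting up to it, at a cost proportional to its value. -/
def decodeLoop : Cmd Instr :=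
  .loop (.realLt 20 21) (ops [.natAdd 21 21 1, .realAdd 20 20 8])

def queryLoop : Cmd Instr :=
  .loop (.natLt 23 16)
    (ops [.load 22 0 23, .query 23 21 22, .store 3 22 23, .natAdd 22 22 1, .natAdd 23 23 1])

/-- Decoding is done once per row, and then all points are queried. Decoding again for every point
would multiply the number of calls by the number of examples, both of order `log(2/δ)`, and spoil
the linear time bound. -/
def fillLoop : Cmd Instr :=
  .loop (.natLt 20 15) (block [
    ops [.load 21 2 20, .natConst 21 0, .realConst 20 0],
    decodeLoop,
    ops [.natConst 23 0],
    queryLoop,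
    ops [.natAdd 20 20 1]])

def signLoop : Cmd Instr :=
  .loop (.natLt 26 2) (block [
    .ite (.realLt 24 28) (ops [.realConst 26 (-1)]) (ops [.realConst 26 1]),
    ops [.store 4 25 26, .natAdd 25 25 1, .natAdd 26 26 1, .realAdd 28 28 8]])

def sumLoop : Cmd Instr :=
  .loop (.natLt 27 25)
    (ops [.load 27 5 24, .load 26 4 27, .realMul 27 27 26, .realAdd 25 25 27, .natAdd 24 24 1,
      .natAdd 27 27 1])

def rowLoop : Cmd Instr :=
  .loop (.natLt 20 15) (block [
    ops [.natConst 26 0, .realConst 28 0],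
    signLoop,
    ops [.load 26 3 28, .natAdd 28 28 16, .store 4 25 26, .natAdd 25 25 1, .realConst 25 0,
      .natConst 27 0],
    sumLoop,
    ops [.realAdd 24 24 25, .natAdd 20 20 1],
    .ite (.realLt 24 7) (ops [.realConst 24 0])
      -- Adding register 7, which holds 0, copies register 3.
      (.ite (.realLt 3 24) (ops [.realAdd 24 3 7]) .skip)])

def pointLoop : Cmd Instr :=
  .loop (.natLt 23 16) (block [
    ops [.realConst 24 0, .natConst 24 0, .natConst 25 0, .natConst 20 0, .natAdd 28 23 0],
    rowLoop,
    ops [.load 30 1 23, .realMul 30 3 30, .realSub 30 30 24, .load 26 4 29, .realMul 30 30 26,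
      .realAdd 31 31 30, .natAdd 23 23 1]])

/-- Evaluates the predictor at all points, and correlates the residuals with a feature. -/
def evalProg : Cmd Instr :=
  block [
    ops [.natConst 20 0, .natConst 22 0],
    fillLoop,
    ops [.realConst 31 0, .natConst 23 0],
    pointLoop]

attribute [local simp] Instr.apply State.setNat State.setReal Function.update_apply

theorem decodeLoop_runs (s : State) (n : ℕ) (h1 : s.nat 1 = 1) (h8 : s.real 8 = 1)
    (hn : s.real 21 = n) (h20 : s.real 20 = 0) (h21 : s.nat 21 = 0) :
    Runs detStep decodeLoop s (n * 4 + 1) (fun s' => s'.nat 21 = n) := by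
  refine (Runs.loopFrame (T := 3) n (fun k s' => s'.nat 21 = k ∧ s'.real 20 = k)
    ⟨h21, by simpa using h20⟩ ?_ ?_).mono le_rfl fun s' h => h.1.1
  · rintro k hk s' hF ⟨ha, hb⟩
    have h1' : s'.nat 1 = 1 := (hF.nat 1 rfl).trans h1
    have h8' : s'.real 8 = 1 := (hF.real 8 rfl).trans h8
    have h21' : s'.real 21 = n := (hF.real 21 rfl).trans hn
    refine ⟨by simpa [Test.holds, hb, h21'] using hk, Runs.ops _ _ ?_⟩
    simp [ha, hb, h1', h8']
  · rintro s' hF ⟨ha, hb⟩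
    have h21' : s'.real 21 = n := (hF.real 21 rfl).trans hn
    simp [Test.holds, hb, h21']

theorem queryLoop_runs (s : State) (n a cnt : ℕ) (h1 : s.nat 1 = 1) (h16 : s.nat 16 = cnt)
    (h21 : s.nat 21 = n) (h22 : s.nat 22 = a) (h23 : s.nat 23 = 0) :
    Runs detStep queryLoop s (cnt * 7 + 1) (fun s' => s'.nat 22 = a + cnt ∧
      (∀ x < a, s'.arr 3 x = s.arr 3 x) ∧
      (∀ i < cnt, s'.arr 3 (a + i) = hypVal s.hyps n (s.arr 0 i))) := by
  refine (Runs.loopFrame (T := 6) cnt (fun k s' => s'.nat 22 = a + k ∧ s'.nat 23 = k ∧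
      (∀ x < a, s'.arr 3 x = s.arr 3 x) ∧
      (∀ i < k, s'.arr 3 (a + i) = hypVal s.hyps n (s.arr 0 i)))
    ⟨h22, h23, by simp, by simp⟩ ?_ ?_).mono le_rfl
    fun s' h => ⟨h.1.1, h.1.2.2.1, h.1.2.2.2⟩
  · rintro k hk s' hF ⟨ha, hb, hc, hd⟩
    have h1' : s'.nat 1 = 1 := (hF.nat 1 rfl).trans h1
    have h16' : s'.nat 16 = cnt := (hF.nat 16 rfl).trans h16
    have h21' : s'.nat 21 = n := (hF.nat 21 rfl).trans h21
    have h0' : s'.arr 0 = s.arr 0 := hF.arr 0 rfl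
    refine ⟨by simpa [Test.holds, hb, h16'] using hk, Runs.ops _ _ ?_⟩
    simp only [List.foldl, Instr.apply, State.setNat, State.setReal, Function.update_apply, ha, hb,
      h1', h21', h0', hF.hyps]
    refine ⟨by simp; omega, by simp, fun x hx => ?_, fun i hi => ?_⟩
    · have : x ≠ a + k := by omega
      simpa [this] using hc x hx
    · rcases Nat.lt_succ_iff_lt_or_eq.mp hi with h | rfl
      · have : a + i ≠ a + k := by omega
        simpa [h.ne] using hd i h
      · simp [hypVal]
  · rintro s' hF ⟨ha, hb, -⟩
    have h16' : s'.nat 16 = cnt := (hF.nat 16 rfl).trans h16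
    simp [Test.holds, hb, h16']

theorem fillLoop_runs (s : State) (idx : ℕ → ℕ) (B rows cnt : ℕ) (h1 : s.nat 1 = 1)
    (h8 : s.real 8 = 1) (h15 : s.nat 15 = rows) (h16 : s.nat 16 = cnt) (h20 : s.nat 20 = 0)
    (h22 : s.nat 22 = 0) (hidx : ∀ q < rows, s.arr 2 q = idx q ∧ idx q ≤ B) :
    Runs detStep fillLoop s (rows * (B * 4 + cnt * 7 + 20) + 1) (fun s' =>
      ∀ q < rows, ∀ i < cnt, s'.arr 3 (q * cnt + i) = hypVal s.hyps (idx q) (s.arr 0 i)) := by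
  refine (Runs.loopFrame (T := B * 4 + cnt * 7 + 19) rows
    (fun k s' => s'.nat 20 = k ∧ s'.nat 22 = k * cnt ∧
      (∀ q < k, ∀ i < cnt, s'.arr 3 (q * cnt + i) = hypVal s.hyps (idx q) (s.arr 0 i)))
    ⟨h20, by simpa using h22, by simp⟩ ?_ ?_).mono le_rfl fun s' h => h.1.2.2
  · rintro k hk s' hF ⟨ha, hb, hc⟩
    have h1' : s'.nat 1 = 1 := (hF.nat 1 rfl).trans h1
    have h15' : s'.nat 15 = rows := (hF.nat 15 rfl).trans h15
    have h16' : s'.nat 16 = cnt := (hF.nat 16 rfl).trans h16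
    have h8' : s'.real 8 = 1 := (hF.real 8 rfl).trans h8
    have h0' : s'.arr 0 = s.arr 0 := hF.arr 0 rfl
    have h2' : s'.arr 2 = s.arr 2 := hF.arr 2 rfl
    refine ⟨by simpa [Test.holds, ha, h15'] using hk, ?_⟩
    obtain ⟨hi, hB⟩ := hidx k hk
    refine Runs.mono (T := 4 + ((B * 4 + 1) + (2 + ((cnt * 7 + 1) + 2)))) ?_ (by omega)
      fun _ h => h
    refine Runs.opsSeq fun s1 e1 => ?_
    refine Runs.frameSeq ((decodeLoop_runs s1 (idx k) ?_ ?_ ?_ ?_ ?_).mono (by omega)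
      fun _ h => h) fun s2 h2 F2 => ?_
    iterate 5 · simp [e1, h1', h8', ha, h2', hi]
    refine Runs.opsSeq fun s3 e3 => ?_
    refine Runs.frameSeq (queryLoop_runs s3 (idx k) (k * cnt) cnt ?_ ?_ ?_ ?_ ?_)
      fun s4 h4 F4 => Runs.ops _ _ ?_
    · simp [e3, F2.nat 1 rfl, e1, h1']
    · simp [e3, F2.nat 16 rfl, e1, h16']
    · simp [e3, h2]
    · simp [e3, F2.nat 22 rfl, e1, hb]
    · simp [e3]
    · have a0 : s3.arr 0 = s.arr 0 := by simp [e3, F2.arr 0 rfl, e1, h0']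
      have a3 : s3.arr 3 = s'.arr 3 := by simp [e3, F2.arr 3 rfl, e1]
      have y3 : s3.hyps = s'.hyps := by simp [e3, F2.hyps, e1]
      have n20 : s4.nat 20 = k := by simp [F4.nat 20 rfl, e3, F2.nat 20 rfl, e1, ha]
      have n1 : s4.nat 1 = 1 := by simp [F4.nat 1 rfl, e3, F2.nat 1 rfl, e1, h1']
      refine ⟨by simp [n20, n1], by simp [h4.1]; ring, fun q hq i hi' => ?_⟩
      simp only [List.foldl, Instr.apply, State.setNat]
      rcases Nat.lt_succ_iff_lt_or_eq.mp hq with h | rfl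
      · rw [h4.2.1, a3, hc q h i hi']
        calc q * cnt + i < (q + 1) * cnt := by rw [Nat.succ_mul]; omega
          _ ≤ k * cnt := Nat.mul_le_mul_right _ h
      · rw [h4.2.2 i hi', a0, y3, hF.hyps]
  · rintro s' hF ⟨ha, -⟩
    have h15' : s'.nat 15 = rows := (hF.nat 15 rfl).trans h15
    simp [Test.holds, ha, h15']

theorem signLoop_runs (s : State) (M a : ℕ) (h1 : s.nat 1 = 1) (h2 : s.nat 2 = M + 1)
    (h8 : s.real 8 = 1) (h25 : s.nat 25 = a) (h26 : s.nat 26 = 0) (h28 : s.real 28 = 0) :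
    Runs detStep signLoop s ((M + 1) * 9 + 1) (fun s' => s'.nat 25 = a + (M + 1) ∧
      (∀ x < a, s'.arr 4 x = s.arr 4 x) ∧
      (∀ v < M + 1, s'.arr 4 (a + v) = if s.real 24 < (v : ℝ) then -1 else 1)) := by
  refine (Runs.loopFrame (T := 8) (M + 1) (fun k s' => s'.nat 25 = a + k ∧ s'.nat 26 = k ∧
      s'.real 28 = k ∧ (∀ x < a, s'.arr 4 x = s.arr 4 x) ∧
      (∀ v < k, s'.arr 4 (a + v) = if s.real 24 < (v : ℝ) then -1 else 1))
    ⟨h25, h26, by simpa using h28, by simp, by simp⟩ ?_ ?_).mono le_rfl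
    fun s' h => ⟨h.1.1, h.1.2.2.2.1, h.1.2.2.2.2⟩
  · rintro k hk s' hF ⟨ha, hb, hc, hd, he⟩
    have h1' : s'.nat 1 = 1 := (hF.nat 1 rfl).trans h1
    have h2' : s'.nat 2 = M + 1 := (hF.nat 2 rfl).trans h2
    have h8' : s'.real 8 = 1 := (hF.real 8 rfl).trans h8
    have h24' : s'.real 24 = s.real 24 := hF.real 24 rfl
    refine ⟨by simpa [Test.holds, hb, h2'] using hk, ?_⟩
    refine Runs.mono (T := 3 + 5) ?_ (by omega) fun _ h => h
    refine Runs.frameSeq (P := fun s1 => s1.real 26 = if s.real 24 < (k : ℝ) then -1 else 1)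
      (Runs.ite (T := 2) (fun hb => Runs.ops _ _ ?_) (fun hb => Runs.ops _ _ ?_))
      fun s1 e1 F1 => Runs.ops _ _ ?_
    · have : s.real 24 < k := by simpa [Test.holds, hc, h24'] using hb
      simp [this]
    · have : ¬ s.real 24 < k := by simpa [Test.holds, hc, h24'] using hb
      simp [this]
    · simp only [List.foldl, Instr.apply, State.setNat, State.setReal, Function.update_apply, e1,
        F1.nat 25 rfl, ha, F1.nat 1 rfl, h1', F1.nat 26 rfl, hb, F1.real 28 rfl, hc, F1.real 8 rfl,
        h8', F1.arr 4 rfl]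
      refine ⟨by simp; omega, by simp, by simp, fun x hx => ?_, fun v hv => ?_⟩
      · have : x ≠ a + k := by omega
        simpa [this] using hd x hx
      · rcases Nat.lt_succ_iff_lt_or_eq.mp hv with h | rfl
        · simpa [h.ne] using he v h
        · simp
  · rintro s' hF ⟨ha, hb, -⟩
    have h2' : s'.nat 2 = M + 1 := (hF.nat 2 rfl).trans h2
    simp [Test.holds, hb, h2']

theorem sumLoop_runs (s : State) (a len : ℕ) (h1 : s.nat 1 = 1) (h24 : s.nat 24 = a)
    (h25 : s.nat 25 = len) (h27 : s.nat 27 = 0) (h25' : s.real 25 = 0) :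
    Runs detStep sumLoop s (len * 8 + 1) (fun s' => s'.nat 24 = a + len ∧
      s'.real 25 = ∑ l ∈ Finset.range len, s.arr 5 (a + l) * s.arr 4 l) := by
  refine (Runs.loopFrame (T := 7) len (fun k s' => s'.nat 24 = a + k ∧ s'.nat 27 = k ∧
      s'.real 25 = ∑ l ∈ Finset.range k, s.arr 5 (a + l) * s.arr 4 l)
    ⟨h24, h27, by simpa using h25'⟩ ?_ ?_).mono le_rfl fun s' h => ⟨h.1.1, h.1.2.2⟩
  · rintro k hk s' hF ⟨ha, hb, hc⟩
    have e1 : s'.nat 1 = 1 := (hF.nat 1 rfl).trans h1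
    have e25 : s'.nat 25 = len := (hF.nat 25 rfl).trans h25
    have e4 : s'.arr 4 = s.arr 4 := hF.arr 4 rfl
    have e5 : s'.arr 5 = s.arr 5 := hF.arr 5 rfl
    refine ⟨by simpa [Test.holds, hb, e25] using hk, Runs.ops _ _ ?_⟩
    simp [ha, hb, hc, e1, e4, e5, Finset.sum_range_succ]
    omega
  · rintro s' hF ⟨ha, hb, -⟩
    have e25 : s'.nat 25 = len := (hF.nat 25 rfl).trans h25
    simp [Test.holds, hb, e25]

theorem rowLoop_runs (s : State) (M rows cnt i : ℕ) (h : ℕ → ℝ) (h1 : s.nat 1 = 1)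
    (h2 : s.nat 2 = M + 1) (h15 : s.nat 15 = rows) (h16 : s.nat 16 = cnt) (h3 : s.real 3 = M)
    (h7 : s.real 7 = 0) (h8 : s.real 8 = 1) (h20 : s.nat 20 = 0) (h24 : s.nat 24 = 0)
    (h25 : s.nat 25 = 0) (h28 : s.nat 28 = i) (h24' : s.real 24 = 0)
    (hh : ∀ q < rows, s.arr 3 (q * cnt + i) = h q) :
    Runs detStep rowLoop s (rows * ((M + 1) * 9 + rows * (M + 2) * 8 + 30) + 1) (fun s' =>
      s'.real 24 = (rowsVal M (flatWeights M (s.arr 5)) h rows).1 ∧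
      ∀ l < rows * (M + 2),
        s'.arr 4 l = (rowsVal M (flatWeights M (s.arr 5)) h rows).2 l) := by
  set w := flatWeights M (s.arr 5) with hw
  refine (Runs.loopFrame (T := (M + 1) * 9 + rows * (M + 2) * 8 + 29) rows (fun k s' =>
      s'.nat 20 = k ∧ s'.nat 24 = rowStart M k ∧ s'.nat 25 = k * (M + 2) ∧
      s'.nat 28 = k * cnt + i ∧ s'.real 24 = (rowsVal M w h k).1 ∧
      ∀ l < k * (M + 2), s'.arr 4 l = (rowsVal M w h k).2 l)
    ⟨h20, by simpa [rowStart] using h24, by simpa using h25, by simpa using h28,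
      by simpa [rowsVal] using h24', by simp⟩ ?_ ?_).mono le_rfl
    fun s' h => ⟨h.1.2.2.2.2.1, h.1.2.2.2.2.2⟩
  · rintro k hk s' hF ⟨ha, hb, hc, hd, he, hf⟩
    have h1' : s'.nat 1 = 1 := (hF.nat 1 rfl).trans h1
    have h2' : s'.nat 2 = M + 1 := (hF.nat 2 rfl).trans h2
    have h15' : s'.nat 15 = rows := (hF.nat 15 rfl).trans h15
    have h16' : s'.nat 16 = cnt := (hF.nat 16 rfl).trans h16
    have h3' : s'.real 3 = M := (hF.real 3 rfl).trans h3
    have h7' : s'.real 7 = 0 := (hF.real 7 rfl).trans h7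
    have h8' : s'.real 8 = 1 := (hF.real 8 rfl).trans h8
    have a3 : s'.arr 3 = s.arr 3 := hF.arr 3 rfl
    have a5 : s'.arr 5 = s.arr 5 := hF.arr 5 rfl
    have hk' : (k + 1) * (M + 2) ≤ rows * (M + 2) := Nat.mul_le_mul_right _ hk
    refine ⟨by simpa [Test.holds, ha, h15'] using hk, ?_⟩
    refine Runs.mono (T := 3 + (((M + 1) * 9 + 1) + (7 + (((k + 1) * (M + 2) * 8 + 1) +
      (3 + 4))))) ?_ (by omega) fun _ h => h
    refine Runs.opsSeq fun s1 e1 => ?_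
    refine Runs.frameSeq (signLoop_runs s1 M (k * (M + 2)) ?_ ?_ ?_ ?_ ?_ ?_) fun s2 f2 F2 => ?_
    iterate 6 · simp [e1, h1', h2', h8', hc]
    refine Runs.opsSeq fun s3 e3 => ?_
    obtain ⟨g1, g2, g3⟩ := f2
    have n25 : s3.nat 25 = (k + 1) * (M + 2) := by
      simp [e3, g1, F2.nat 1 rfl, e1, h1']; ring
    refine Runs.frameSeq (sumLoop_runs s3 (rowStart M k) ((k + 1) * (M + 2)) ?_ ?_ n25 ?_ ?_)
      fun s4 f4 F4 => ?_
    · simp [e3, F2.nat 1 rfl, e1, h1']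
    · simp [e3, F2.nat 24 rfl, e1, hb]
    · simp [e3]
    · simp [e3]
    have hG : ∀ l < (k + 1) * (M + 2), s3.arr 4 l = (rowsVal M w h (k + 1)).2 l := by
      intro l hl
      simp only [rowsVal, addFeatures]
      have h26 : s2.arr 3 (k * cnt + i) = h k := by
        rw [F2.arr 3 rfl, e1]; simp [a3, hh k hk]
      simp only [e3, List.foldl, Instr.apply, State.setNat, State.setReal, Function.update_apply,
        g1]
      have hl' : l < k * (M + 2) + (M + 2) := by rw [Nat.succ_mul] at hl; exact hl
      rcases lt_or_ge l (k * (M + 2)) with hA | hA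
      · have : l ≠ k * (M + 2) + (M + 1) := by omega
        simp [hA, this, g2 l hA]
        simp [e1, hf l hA]
      · rcases lt_or_ge l (k * (M + 2) + (M + 1)) with hB | hB
        · have : l ≠ k * (M + 2) + (M + 1) := by omega
          obtain ⟨v, rfl⟩ := Nat.exists_eq_add_of_le hA
          have := g3 v (by omega)
          have hv : ¬ M + 1 ≤ v := by omega
          have hv' : v ≠ M + 1 := by omega
          simp [hv', this, show v < M + 1 by omega]
          simp [e1, he]
        · obtain rfl : l = k * (M + 2) + (M + 1) := by omega
          simp [F2.nat 28 rfl, e1, hd]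
          exact h26
    have a53 : s3.arr 5 = s.arr 5 := by simp [e3, F2.arr 5 rfl, e1, a5]
    refine Runs.opsSeq fun s5 e5 => ?_
    have r24 : s5.real 24 = (rowsVal M w h k).1 +
        ∑ l ∈ Finset.range ((k + 1) * (M + 2)), w k l * (rowsVal M w h (k + 1)).2 l := by
      have hs : s5.real 24 = s4.real 24 + s4.real 25 := by simp [e5]
      have hs' : s4.real 24 = (rowsVal M w h k).1 := by
        simp [F4.real 24 rfl, e3, F2.real 24 rfl, e1, he]
      rw [hs, hs', f4.2]
      congr 1
      refine Finset.sum_congr rfl fun l hl => ?_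
      rw [hG l (Finset.mem_range.mp hl), a53]
      rfl
    have r7 : s5.real 7 = 0 := by
      simp [e5, F4.real 7 rfl, e3, F2.real 7 rfl, e1, h7']
    have r3 : s5.real 3 = M := by
      simp [e5, F4.real 3 rfl, e3, F2.real 3 rfl, e1, h3']
    have n20 : s5.nat 20 = k + 1 := by
      simp [e5, F4.nat 20 rfl, e3, F2.nat 20 rfl, e1, ha, F4.nat 1 rfl, F2.nat 1 rfl, h1']
    have n24 : s5.nat 24 = rowStart M (k + 1) := by
      simp [e5, f4.1, rowStart, Finset.sum_range_succ]
    have n25' : s5.nat 25 = (k + 1) * (M + 2) := by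
      simp [e5, F4.nat 25 rfl, n25]
    have n28 : s5.nat 28 = (k + 1) * cnt + i := by
      simp [e5, F4.nat 28 rfl, e3, F2.nat 28 rfl, e1, hd, F2.nat 16 rfl, h16']; ring
    have a4 : s5.arr 4 = s3.arr 4 := by simp [e5, F4.arr 4 rfl]
    have key : Runs detStep (.ite (.realLt 24 7) (ops [.realConst 24 0])
        (.ite (.realLt 3 24) (ops [.realAdd 24 3 7]) .skip)) s5 4
        (fun s' => s'.real 24 = truncate M (s5.real 24)) := by
      refine Runs.ite (T := 3) (fun hb => ?_) (fun hb => ?_)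
      · refine (Runs.ops _ _ ?_).mono (T := 2) (by omega) fun _ h => h
        simp only [Test.holds, r7] at hb
        simp [truncate, hb]
      · simp only [Test.holds, r7] at hb
        refine Runs.ite (T := 2) (fun hb' => Runs.ops _ _ ?_) (fun hb' => ?_)
        · simp only [Test.holds, r3] at hb'
          simp [truncate, hb, hb', r3, r7]
        · simp only [Test.holds, r3] at hb'
          exact ⟨1, s5, by omega, .skip _, by simp [truncate, hb, hb']⟩
    refine key.frame.mono le_rfl ?_
    rintro s6 ⟨h6, F6⟩
    refine ⟨(F6.nat 20 rfl).trans n20, (F6.nat 24 rfl).trans n24, (F6.nat 25 rfl).trans n25',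
      (F6.nat 28 rfl).trans n28, ?_, fun l hl => ?_⟩
    · rw [h6, r24]; rfl
    · rw [F6.arr 4 rfl, a4, hG l hl]
  · rintro s' hF ⟨ha, -⟩
    have h15' : s'.nat 15 = rows := (hF.nat 15 rfl).trans h15
    simp [Test.holds, ha, h15']

/-- The scaled prediction and the features at point number `i` of the point array. -/
def pointVal (M cnt : ℕ) (s : State) (rows i : ℕ) : ℝ × (ℕ → ℝ) :=
  rowsVal M (flatWeights M (s.arr 5)) (fun q => s.arr 3 (q * cnt + i)) rows

theorem pointLoop_runs (s : State) (M rows cnt j : ℕ) (h0 : s.nat 0 = 0) (h1 : s.nat 1 = 1)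
    (h2 : s.nat 2 = M + 1) (h15 : s.nat 15 = rows) (h16 : s.nat 16 = cnt) (h29 : s.nat 29 = j)
    (h3 : s.real 3 = M) (h7 : s.real 7 = 0) (h8 : s.real 8 = 1) (h23 : s.nat 23 = 0)
    (h31 : s.real 31 = 0) (hj : j < rows * (M + 2)) :
    Runs detStep pointLoop s
      (cnt * (rows * ((M + 1) * 9 + rows * (M + 2) * 8 + 30) + 20) + 1) (fun s' =>
      s'.real 31 = ∑ i ∈ Finset.range cnt,
        (M * s.arr 1 i - (pointVal M cnt s rows i).1) * (pointVal M cnt s rows i).2 j ∧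
      (0 < cnt → s'.real 24 = (pointVal M cnt s rows (cnt - 1)).1)) := by
  refine (Runs.loopFrame (T := rows * ((M + 1) * 9 + rows * (M + 2) * 8 + 30) + 19) cnt
    (fun k s' => s'.nat 23 = k ∧ s'.real 31 = ∑ i ∈ Finset.range k,
        (M * s.arr 1 i - (pointVal M cnt s rows i).1) * (pointVal M cnt s rows i).2 j ∧
      (0 < k → s'.real 24 = (pointVal M cnt s rows (k - 1)).1))
    ⟨h23, by simpa using h31, by simp⟩ ?_ ?_).mono le_rfl fun s' h => h.1.2
  · rintro k hk s' hF ⟨ha, hb, -⟩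
    have h0' : s'.nat 0 = 0 := (hF.nat 0 rfl).trans h0
    have h1' : s'.nat 1 = 1 := (hF.nat 1 rfl).trans h1
    have h2' : s'.nat 2 = M + 1 := (hF.nat 2 rfl).trans h2
    have h15' : s'.nat 15 = rows := (hF.nat 15 rfl).trans h15
    have h16' : s'.nat 16 = cnt := (hF.nat 16 rfl).trans h16
    have h29' : s'.nat 29 = j := (hF.nat 29 rfl).trans h29
    have h3' : s'.real 3 = M := (hF.real 3 rfl).trans h3
    have h7' : s'.real 7 = 0 := (hF.real 7 rfl).trans h7
    have h8' : s'.real 8 = 1 := (hF.real 8 rfl).trans h8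
    have a1 : s'.arr 1 = s.arr 1 := hF.arr 1 rfl
    have a3 : s'.arr 3 = s.arr 3 := hF.arr 3 rfl
    have a5 : s'.arr 5 = s.arr 5 := hF.arr 5 rfl
    refine ⟨by simpa [Test.holds, ha, h16'] using hk, ?_⟩
    refine Runs.mono (T := 6 + ((rows * ((M + 1) * 9 + rows * (M + 2) * 8 + 30) + 1) + 8)) ?_
      (by omega) fun _ h => h
    refine Runs.opsSeq fun s1 e1 => ?_
    refine Runs.frameSeq (rowLoop_runs s1 M rows cnt k (fun q => s.arr 3 (q * cnt + k))
      ?_ ?_ ?_ ?_ ?_ ?_ ?_ ?_ ?_ ?_ ?_ ?_ ?_) fun s2 f2 F2 => Runs.ops _ _ ?_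
    iterate 12 · simp [e1, h0', h1', h2', h15', h16', h3', h7', h8', ha]
    · simp [e1, a3]
    have w1 : s1.arr 5 = s.arr 5 := by simp [e1, a5]
    rw [w1] at f2
    change s2.real 24 = (pointVal M cnt s rows k).1 ∧
      ∀ l < rows * (M + 2), s2.arr 4 l = (pointVal M cnt s rows k).2 l at f2
    have n23 : s2.nat 23 = k := by simp [F2.nat 23 rfl, e1, ha]
    have n29 : s2.nat 29 = j := by simp [F2.nat 29 rfl, e1, h29']
    have n1 : s2.nat 1 = 1 := by simp [F2.nat 1 rfl, e1, h1']
    have r3 : s2.real 3 = M := by simp [F2.real 3 rfl, e1, h3']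
    have r31 := F2.real 31 rfl
    have a1' : s2.arr 1 = s.arr 1 := by simp [F2.arr 1 rfl, e1, a1]
    have r31' : s1.real 31 = s'.real 31 := by simp [e1]
    refine ⟨by simp [n23, n1], ?_, fun _ => by simp [f2.1]⟩
    simp [n23, n29, r3, a1', r31, r31', hb, f2.1, f2.2 j hj, Finset.sum_range_succ]
  · rintro s' hF ⟨ha, -⟩
    have h16' : s'.nat 16 = cnt := (hF.nat 16 rfl).trans h16
    simp [Test.holds, ha, h16']

/-- The number of time units for the evaluation of the predictor. -/
def evalTime (M B rows cnt : ℕ) : ℕ :=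
  rows * (B * 4 + cnt * 7 + 20) +
    cnt * (rows * ((M + 1) * 9 + rows * (M + 2) * 8 + 30) + 20) + 10

/-- What the evaluation program expects. -/
structure EvalPre (M B rows cnt j : ℕ) (idx : ℕ → ℕ) (s : State) : Prop where
  n0 : s.nat 0 = 0
  n1 : s.nat 1 = 1
  n2 : s.nat 2 = M + 1
  n15 : s.nat 15 = rows
  n16 : s.nat 16 = cnt
  n29 : s.nat 29 = j
  r3 : s.real 3 = M
  r7 : s.real 7 = 0
  r8 : s.real 8 = 1
  hidx : ∀ q < rows, s.arr 2 q = idx q ∧ idx q ≤ B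
  hj : j < rows * (M + 2)

/-- The prediction and the features at point number `i`. -/
def evalVal (M : ℕ) (idx : ℕ → ℕ) (s : State) (rows i : ℕ) : ℝ × (ℕ → ℝ) :=
  rowsVal M (flatWeights M (s.arr 5)) (fun q => hypVal s.hyps (idx q) (s.arr 0 i)) rows

/-- Only the data of the first `r` rows matter. This is what identifies the predictor in memory with
that of a history, and shows that later rounds do not alter earlier predictors. -/
theorem rowsVal_congr {M : ℕ} {w w' : ℕ → ℕ → ℝ} {h h' : ℕ → ℝ} {r : ℕ}
    (hw : ∀ q < r, ∀ l < (q + 1) * (M + 2), w q l = w' q l) (hh : ∀ q < r, h q = h' q) :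
    rowsVal M w h r = rowsVal M w' h' r := by
  induction r with
  | zero => rfl
  | succ r ih =>
    simp only [rowsVal, ih (fun q hq => hw q (by omega)) (fun q hq => hh q (by omega)),
      hh r (by omega)]
    congr 3
    exact Finset.sum_congr rfl fun l hl => by rw [hw r (by omega) l (Finset.mem_range.mp hl)]

theorem evalProg_runs {M B rows cnt j : ℕ} {idx : ℕ → ℕ} {s : State}
    (h : EvalPre M B rows cnt j idx s) :
    Runs detStep evalProg s (evalTime M B rows cnt) (fun s' =>
      s'.real 31 = ∑ i ∈ Finset.range cnt,
        (M * s.arr 1 i - (evalVal M idx s rows i).1) * (evalVal M idx s rows i).2 j ∧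
      (0 < cnt → s'.real 24 = (evalVal M idx s rows (cnt - 1)).1)) := by
  refine Runs.mono (T := 3 + ((rows * (B * 4 + cnt * 7 + 20) + 1) + (3 +
    (cnt * (rows * ((M + 1) * 9 + rows * (M + 2) * 8 + 30) + 20) + 1)))) ?_
    (by rw [evalTime]; omega) fun _ h => h
  refine Runs.opsSeq fun s1 e1 => ?_
  refine Runs.frameSeq (fillLoop_runs s1 idx B rows cnt ?_ ?_ ?_ ?_ ?_ ?_ ?_) fun s2 f2 F2 => ?_
  iterate 6 · simp [e1, h.n1, h.r8, h.n15, h.n16]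
  · simpa [e1] using h.hidx
  refine Runs.opsSeq fun s3 e3 => ?_
  have hv : ∀ i < cnt, pointVal M cnt s3 rows i = evalVal M idx s rows i := by
    intro i hi
    refine rowsVal_congr (fun q _ l _ => ?_) fun q hq => ?_
    · simp [flatWeights, e3, F2.arr 5 rfl, e1]
    · simp [e3, f2 q hq i hi]
      simp [e1]
  refine (pointLoop_runs s3 M rows cnt j ?_ ?_ ?_ ?_ ?_ ?_ ?_ ?_ ?_ ?_ ?_ h.hj).mono le_rfl ?_
  iterate 11 · simp [e3, e1, F2.nat 0 rfl, F2.nat 1 rfl, F2.nat 2 rfl, F2.nat 15 rfl, F2.nat 16 rfl,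
      F2.nat 29 rfl, F2.real 3 rfl, F2.real 7 rfl, F2.real 8 rfl, h.n0, h.n1, h.n2, h.n15, h.n16,
      h.n29, h.r3, h.r7, h.r8]
  rintro s4 ⟨h4, h4'⟩
  refine ⟨?_, fun hc => by rw [h4' hc, hv _ (by omega)]⟩
  rw [h4]
  refine Finset.sum_congr rfl fun i hi => ?_
  rw [hv i (Finset.mem_range.mp hi)]
  simp [e3, F2.arr 1 rfl, e1]

end Omniprediction

end

noncomputable section

namespace Omniprediction

set_option linter.unusedSimpArgs false

/-! ### Frames for main programs -/

def Op.writesNat : Op → ℕ → Bool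
  | .basic a, x => a.writesNat x
  | _, _ => false

def Op.writesReal : Op → ℕ → Bool
  | .basic a, x => a.writesReal x
  | .sample i j, x => i == x || j == x
  | .uniform i, x => i == x
  | .call, _ => false

def Op.writesArr : Op → ℕ → Bool
  | .basic a, x => a.writesArr x
  | _, _ => false

/-- `s'` agrees with `s` outside the registers that `c` may change. -/
structure OpFrame (c : Cmd Op) (s s' : State) : Prop where
  nat : ∀ x, c.anyOp (fun a => a.writesNat x) = false → s'.nat x = s.nat x
  real : ∀ x, c.anyOp (fun a => a.writesReal x) = false → s'.real x = s.real x
  arr : ∀ x, c.anyOp (fun a => a.writesArr x) = false → s'.arr x = s.arr x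

theorem OpFrame.refl (c : Cmd Op) (s : State) : OpFrame c s s :=
  ⟨fun _ _ => rfl, fun _ _ => rfl, fun _ _ => rfl⟩

theorem OpFrame.trans {c : Cmd Op} {s s' s'' : State} (h : OpFrame c s s')
    (h' : OpFrame c s' s'') : OpFrame c s s'' :=
  ⟨fun x hx => (h'.nat x hx).trans (h.nat x hx), fun x hx => (h'.real x hx).trans (h.real x hx),
    fun x hx => (h'.arr x hx).trans (h.arr x hx)⟩

section

variable {A : Algorithm} {S : Type u} [MeasurableSpace S] {AL : Learner S} {W : ℝ}
  {ω : Tape AL.sampleSize S}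

theorem Op.step_nat {a : Op} {x : ℕ} {s s' : State} (h : a.step A AL W ω s s')
    (ha : a.writesNat x = false) : s'.nat x = s.nat x := by
  cases a with
  | basic a => rw [show s' = a.apply s from h]; exact Instr.apply_nat ha s
  | sample i j => rw [show s' = _ from h]; rfl
  | uniform i => rw [show s' = _ from h]; rfl
  | call => obtain ⟨z, -, rfl⟩ := h; rfl

theorem Op.step_real {a : Op} {x : ℕ} {s s' : State} (h : a.step A AL W ω s s')
    (ha : a.writesReal x = false) : s'.real x = s.real x := by
  cases a with
  | basic a => rw [show s' = a.apply s from h]; exact Instr.apply_real ha s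
  | sample i j =>
    simp only [Op.writesReal, Bool.or_eq_false_iff, beq_eq_false_iff_ne] at ha
    rw [show s' = _ from h]
    simp [State.setReal, Function.update_apply, ha.1.symm, ha.2.symm]
  | uniform i =>
    simp only [Op.writesReal, beq_eq_false_iff_ne] at ha
    rw [show s' = _ from h]
    simp [State.setReal, Function.update_apply, ha.symm]
  | call => obtain ⟨z, -, rfl⟩ := h; rfl

theorem Op.step_arr {a : Op} {x : ℕ} {s s' : State} (h : a.step A AL W ω s s')
    (ha : a.writesArr x = false) : s'.arr x = s.arr x := by
  cases a with
  | basic a => rw [show s' = a.apply s from h]; exact Instr.apply_arr ha s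
  | sample i j => rw [show s' = _ from h]; rfl
  | uniform i => rw [show s' = _ from h]; rfl
  | call => obtain ⟨z, -, rfl⟩ := h; rfl

theorem Exec.opFrame {c : Cmd Op} {s s' : State} {t : ℕ}
    (h : Exec (Op.step A AL W ω) c s t s') : OpFrame c s s' :=
  ⟨fun x hx => Exec.preserve (f := fun a : Op => a.writesNat x)
      (fun s s' => s'.nat x = s.nat x) (by simp)
      (fun _ _ _ h h' => h'.trans h) (fun _ _ _ ha h => Op.step_nat h ha) h hx,
    fun x hx => Exec.preserve (f := fun a : Op => a.writesReal x)
      (fun s s' => s'.real x = s.real x) (by simp)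
      (fun _ _ _ h h' => h'.trans h) (fun _ _ _ ha h => Op.step_real h ha) h hx,
    fun x hx => Exec.preserve (f := fun a : Op => a.writesArr x)
      (fun s s' => s'.arr x = s.arr x) (by simp)
      (fun _ _ _ h h' => h'.trans h) (fun _ _ _ ha h => Op.step_arr h ha) h hx⟩

theorem Runs.opFrame {c : Cmd Op} {s : State} {T : ℕ} {Q : State → Prop}
    (h : Runs (Op.step A AL W ω) c s T Q) :
    Runs (Op.step A AL W ω) c s T (fun s' => Q s' ∧ OpFrame c s s') := by
  obtain ⟨t, s', h1, h2, h3⟩ := h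
  exact ⟨t, s', h1, h2, h3, h2.opFrame⟩

theorem Runs.loopOpFrame {b : Test} {c : Cmd Op} {s₀ : State} {T : ℕ} (n : ℕ)
    (Inv : ℕ → State → Prop) (h0 : Inv 0 s₀)
    (hstep : ∀ k < n, ∀ s, OpFrame c s₀ s → Inv k s →
      b.holds s ∧ Runs (Op.step A AL W ω) c s T (Inv (k + 1)))
    (hend : ∀ s, OpFrame c s₀ s → Inv n s → ¬ b.holds s) :
    Runs (Op.step A AL W ω) (.loop b c) s₀ (n * (T + 1) + 1)
      (fun s => Inv n s ∧ OpFrame (.loop b c) s₀ s) := by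
  refine (Runs.loop n (fun k s => Inv k s ∧ OpFrame c s₀ s) ⟨h0, OpFrame.refl _ _⟩ ?_ ?_).mono
    le_rfl fun s h => ⟨h.1, ⟨h.2.nat, h.2.real, h.2.arr⟩⟩
  · rintro k hk s ⟨hI, hF⟩
    obtain ⟨hb, hr⟩ := hstep k hk s hF hI
    exact ⟨hb, hr.opFrame.mono le_rfl fun s' h => ⟨h.1, hF.trans h.2⟩⟩
  · rintro s ⟨hI, hF⟩
    exact hend s hF hI

theorem Runs.liftOp {c : Cmd Instr} {s : State} {T : ℕ}
    {Q : State → Prop} (h : Runs detStep c s T Q) :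
    Runs (Op.step A AL W ω) c.lift s T (fun s' => Q s' ∧ Frame c s s') :=
  Runs.lift (fun _ _ => rfl) h

theorem Runs.liftOpsSeq {l : List Instr} {c : Cmd Op} {s : State} {T : ℕ} {Q : State → Prop}
    (h : ∀ s', s' = l.foldl (fun s a => a.apply s) s → Runs (Op.step A AL W ω) c s' T Q) :
    Runs (Op.step A AL W ω) (.seq (Omniprediction.ops l).lift c) s (l.length + 1 + T) Q :=
  Runs.seq ((Runs.ops (Q := fun s' => s' = l.foldl (fun s a => a.apply s) s) l s rfl).liftOp)
    fun s' hs => h s' hs.1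

theorem Runs.sampleSeq {i j : ℕ} {c : Cmd Op} {s : State} {T : ℕ} {Q : State → Prop}
    (h : ∀ s', s' = { (s.setReal i (ω.1 s.examples).1).setReal j (outcome (ω.1 s.examples).2) with
        examples := s.examples + 1 } → Runs (Op.step A AL W ω) c s' T Q) :
    Runs (Op.step A AL W ω) (.seq (.op (.sample i j)) c) s (1 + T) Q :=
  Runs.seq (Runs.op (Q := fun s' => s' =
    { (s.setReal i (ω.1 s.examples).1).setReal j (outcome (ω.1 s.examples).2) with
        examples := s.examples + 1 }) rfl rfl) h

theorem Runs.callSeq {c : Cmd Op} {s : State} {T : ℕ} {Q : State → Prop}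
    (z : I → Bool → I → ℤˣ) (hz : Relabels A.relabel W s z)
    (h : ∀ s', s' = { s with
        hyps := s.hyps ++ [AL.run
          (fun n =>
            let x := (ω.2.2 s.hyps.length).1 n
            (x.1.1, z x.1.1 x.1.2 x.2))
          (ω.2.2 s.hyps.length).2] } → Runs (Op.step A AL W ω) c s' T Q) :
    Runs (Op.step A AL W ω) (.seq (.op .call) c) s (1 + T) Q :=
  Runs.seq (Runs.op (a := Op.call) (step := Op.step A AL W ω) (Q := fun s' => s' = { s with
        hyps := s.hyps ++ [AL.run
          (fun n =>
            let x := (ω.2.2 s.hyps.length).1 n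
            (x.1.1, z x.1.1 x.1.2 x.2))
          (ω.2.2 s.hyps.length).2] }) ⟨z, hz, rfl⟩ rfl) h

end

/-! ### The process described by the algorithm -/

/-- The numerical parameters: `M` is the inverse grid width, `N` the number of rounds, `R` the
number of steps of the search for a hypothesis in each round, `n` the number of examples used for
tests in each round. -/
structure Params where
  M : ℕ
  N : ℕ
  R : ℕ
  n : ℕ

/-- The hypotheses and the weights of the rounds. -/
structure Hist where
  hyp : ℕ → I → ℤˣ
  wt : ℕ → ℕ → ℝ

/-- The history with the hypothesis of row `r` replaced. -/
def Hist.push (H : Hist) (r : ℕ) (c : I → ℤˣ) : Hist := ⟨Function.update H.hyp r c, H.wt⟩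

/-- A label as a real number. -/
def lab (z : ℤˣ) : ℝ := ((z : ℤ) : ℝ)

/-- The scaled prediction and the features at `p` after `r` rounds. -/
def Hist.val (H : Hist) (M r : ℕ) (p : I) : ℝ × (ℕ → ℝ) :=
  rowsVal M H.wt (fun q => lab (H.hyp q p)) r

/-- The scaled predictor after `r` rounds. -/
def Hist.pred (H : Hist) (M r : ℕ) (p : I) : ℝ := (H.val M r p).1

/-- The features after `r` rounds. -/
def Hist.feat (H : Hist) (M r l : ℕ) (p : I) : ℝ := (H.val M r p).2 l

/-- The label encoding the residual of the scaled predictor `κ`. -/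
def residualLabel (M : ℕ) (κ : I → ℝ) (p : I) (y : Bool) (u : I) : ℤˣ :=
  signPlus (M + M * outcome y - κ p - M * u - M * u)

/-- The first of the weights ±1 given to a statistic of absolute value greater than `τ`. -/
def select (St : ℕ → ℝ) (τ : ℝ) (l : ℕ) : ℝ :=
  if ∀ l' < l, |St l'| ≤ τ then (if τ < St l then 1 else if St l < -τ then -1 else 0) else 0

section Rounds

variable (P : Params) {S : Type u} [MeasurableSpace S] (AL : Learner S)
  (ω : Tape AL.sampleSize S)

/-- The position of the first example of round `r`. -/
def Params.exStart (r : ℕ) : ℕ := r * (P.n + P.R)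

/-- The number of the first call of round `r`. -/
def Params.callStart (r : ℕ) : ℕ := r * (2 * P.R + 1)

/-- The correlation of the residuals of `κ` with `g` on the test examples of round `r`. -/
def testStat (r : ℕ) (κ g : I → ℝ) : ℝ :=
  ∑ i ∈ Finset.range P.n, (P.M * outcome (ω.1 (P.exStart r + i)).2 - κ (ω.1 (P.exStart r + i)).1) *
    g (ω.1 (P.exStart r + i)).1

/-- Whether the hypothesis `c` passes the test in round `r`. -/
def testBit (r : ℕ) (κ : I → ℝ) (c : I → ℤˣ) : ℤˣ :=
  signPlus (testStat P AL ω r κ (fun p => lab (c p)) - 4 * P.n)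

/-- The hypothesis returned by call `q` for the residuals of `κ`. -/
def fetchHyp (κ : I → ℝ) (q : ℕ) : I → ℤˣ :=
  AL.run (fun i => let x := (ω.2.2 q).1 i; (x.1.1, residualLabel P.M κ x.1.1 x.1.2 x.2))
    (ω.2.2 q).2

/-- The hypothesis returned by call `q` for the constant label `b`. -/
def readHyp (b : ℤˣ) (q : ℕ) : I → ℤˣ :=
  AL.run (fun i => (((ω.2.2 q).1 i).1.1, b)) (ω.2.2 q).2

/-- The answer to the question, put in step `t` of round `r` to the learner, whether the
hypothesis returned by call `c` passes the test. -/
def answer (r : ℕ) (κ : I → ℝ) (t c : ℕ) : ℤˣ :=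
  readHyp AL ω (testBit P AL ω r κ (fetchHyp P AL ω κ c)) (P.callStart r + 1 + 2 * t)
    (ω.1 (P.exStart r + P.n + t)).1

/-- The search for a hypothesis in round `r`: the number of the candidate and its level. -/
def walk (r : ℕ) (κ : I → ℝ) : ℕ → ℕ × ℕ
  | 0 => (P.callStart r, 0)
  | t + 1 =>
    if answer P AL ω r κ t (walk r κ t).1 = 1 then ((walk r κ t).1, (walk r κ t).2 + 1)
    else if 0 < (walk r κ t).2 then ((walk r κ t).1, (walk r κ t).2 - 1)
    else (P.callStart r + 2 + 2 * t, 0)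

/-- The history with the hypothesis of round `r` added. -/
def addHyp (r : ℕ) (H : Hist) : Hist :=
  H.push r (fetchHyp P AL ω (H.pred P.M r) (walk P AL ω r (H.pred P.M r) P.R).1)

/-- The test statistics of the features in round `r`. -/
def roundStat (r : ℕ) (H : Hist) (l : ℕ) : ℝ :=
  testStat P AL ω r (H.pred P.M r) ((addHyp P AL ω r H).feat P.M (r + 1) l)

/-- One round. -/
def nextHist (r : ℕ) (H : Hist) : Hist where
  hyp := (addHyp P AL ω r H).hyp
  wt := Function.update H.wt r (select (roundStat P AL ω r H) (2 * P.n))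

/-- The history before round `r`. -/
def hist : ℕ → Hist
  | 0 => ⟨fun _ _ => 1, fun _ _ => 0⟩
  | r + 1 => nextHist P AL ω r (hist r)

/-- All tests of features in round `r` are passed. -/
def Quiet (r : ℕ) : Prop :=
  ∀ l < (r + 1) * (P.M + 2), |roundStat P AL ω r (hist P AL ω r) l| ≤ 2 * P.n

open Classical in
/-- The last quiet round before round `r`. -/
def best : ℕ → ℕ
  | 0 => 0
  | r + 1 => if Quiet P AL ω r then r else best r

/-- The final post-processing. -/
def output (p : I) : I :=
  clip ((hist P AL ω P.N).pred P.M (best P AL ω P.N + 1) p / P.M)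

end Rounds

theorem truncate_mem (M : ℕ) (x : ℝ) : 0 ≤ truncate M x ∧ truncate M x ≤ M := by
  unfold truncate
  split_ifs with h1 h2
  · exact ⟨le_rfl, Nat.cast_nonneg _⟩
  · exact ⟨Nat.cast_nonneg _, le_rfl⟩
  · exact ⟨not_lt.mp h1, not_lt.mp h2⟩

theorem truncate_of_mem {M : ℕ} {x : ℝ} (h0 : 0 ≤ x) (h1 : x ≤ M) : truncate M x = x := by
  simp [truncate, not_lt.mpr h0, not_lt.mpr h1]

theorem rowsVal_mem (M : ℕ) (w : ℕ → ℕ → ℝ) (h : ℕ → ℝ) (r : ℕ) :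
    0 ≤ (rowsVal M w h r).1 ∧ (rowsVal M w h r).1 ≤ M := by
  cases r with
  | zero => simp [rowsVal]
  | succ r => exact truncate_mem _ _

/-- The current row has no weights until the round ends. Evaluating `r + 1` rows thus yields the
features of the current candidate together with the still uncorrected predictor. -/
theorem rowsVal_succ_of_zero {M : ℕ} {w : ℕ → ℕ → ℝ} {h : ℕ → ℝ} {r : ℕ}
    (hw : ∀ l < (r + 1) * (M + 2), w r l = 0) :
    (rowsVal M w h (r + 1)).1 = (rowsVal M w h r).1 := by
  rw [rowsVal]
  dsimp only
  rw [Finset.sum_eq_zero fun l hl => by rw [hw l (Finset.mem_range.mp hl), zero_mul], add_zero]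
  exact truncate_of_mem (rowsVal_mem _ _ _ _).1 (rowsVal_mem _ _ _ _).2

theorem clip_coe (p : I) : clip (p : ℝ) = p := Set.projIcc_val _ _

end Omniprediction

end

noncomputable section

namespace Omniprediction

set_option linter.unusedSimpArgs false

/-! ### The main program

Index variables: 0, 1: constants 0 and 1; 2: `M + 1`; 3: `M + 2`; 4: `N`; 5: `R`; 6: `n`;
7: round; 8: number of calls so far; 9: candidate; 10: address of the weights of the current row;
11: last quiet round; 12: step of the search; 13: level of the candidate; 14: number of examples
drawn; 15: number of rows; 16: number of points; 17: number of features; 18: flag; 19: address of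
the selected weight; 29: feature.
Real variables: 0: input and result of subroutines; 1: outcome; 2: random number; 3: `M`; 4: `n`;
5: candidate; 6: number of calls so far; 7, 8: constants 0 and 1; 9: kind of call; 10: result of a
query; 11, 12: example; 13: weight; 14, 15: thresholds. -/

/-- Register 9 selects the kind of call. If it is positive, every example gets the same label, the
sign of the candidate's test statistic minus `4n`; feature number `17 - 1`, the last one, is the
candidate. Otherwise the label is the randomized sign of the residual at the given point. That
branch overwrites the first stored test point, which is harmless because the state of the subroutine
is discarded. -/
def relabelProg : Cmd Instr :=
  .ite (.realLt 7 9)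
    (block [ops [.natSub 29 17 1], evalProg, ops [.realAdd 0 4 4, .realAdd 0 0 0, .realSub 0 31 0]])
    (block [ops [.natConst 16 1, .natConst 29 0, .store 0 29 0], evalProg,
      ops [.realMul 1 3 1, .realAdd 0 3 1, .realSub 0 0 24, .realMul 2 3 2, .realSub 0 0 2,
        .realSub 0 0 2]])

/-- Uses one row more than the number of the last quiet round. If that round is indeed quiet, its
row has zero weights and the value is its predictor. -/
def predictProg : Cmd Instr :=
  block [ops [.natAdd 15 11 1, .natConst 16 1, .natConst 29 0, .store 0 29 0], evalProg,
    ops [.realDiv 0 24 3]]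

def drawLoop : Cmd Op :=
  .loop (.natLt 14 6) (.seq (.op (.sample 11 12))
    (ops [.store 0 14 11, .store 1 14 12, .natAdd 14 14 1, .realAdd 4 4 8]).lift)

def walkUpdate : Cmd Instr :=
  block [
    .ite (.realLt 7 10) (ops [.natAdd 13 13 1])
      (.ite (.natLt 0 13) (ops [.natSub 13 13 1]) (ops [.natAdd 9 8 0, .realAdd 5 6 7])),
    ops [.natAdd 8 8 1, .realAdd 6 6 8, .natAdd 12 12 1]]

/-- Two calls in every step: one to read the test bit of the candidate at a fresh example, one to
fetch a replacement for it. The replacement is fetched even if it is not needed, so that the number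
of a call never depends on the course of the search. -/
def walkBody : Cmd Op :=
  block [
    (ops [.store 2 7 5, .realConst 9 1]).lift,
    .op .call,
    .op (.sample 11 12),
    (ops [.query 10 8 11, .natAdd 8 8 1, .realAdd 6 6 8, .realConst 9 0]).lift,
    .op .call,
    walkUpdate.lift]

def decideLoop : Cmd Instr :=
  .loop (.natLt 29 17) (block [
    evalProg,
    .ite (.natLt 18 1)
      (.ite (.realLt 14 31) (ops [.realConst 13 1, .natConst 18 1, .natAdd 19 10 29])
        (.ite (.realLt 31 15) (ops [.realConst 13 (-1), .natConst 18 1, .natAdd 19 10 29]) .skip))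
      .skip,
    ops [.natAdd 29 29 1]])

/-- The only place where the main program itself evaluates test statistics, once per round. At most
one weight of the row becomes nonzero; if no statistic is large, register 19 still points to the
first weight and the value 0 is stored there. -/
def decideProg : Cmd Instr :=
  block [
    ops [.store 2 7 5, .natConst 18 0, .realConst 13 0, .natAdd 19 10 0, .natConst 29 0,
      .realAdd 14 4 4, .realSub 15 7 14],
    decideLoop,
    ops [.store 5 19 13, .natAdd 10 10 17],
    .ite (.natLt 18 1) (ops [.natAdd 11 7 0]) .skip,
    ops [.natAdd 7 7 1]]

/-- The call before the search supplies its initial candidate. Since register 3 holds `M + 2`,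
register 17 becomes the number of features including the new row. -/
def roundBody : Cmd Op :=
  block [
    (ops [.natAdd 15 7 1, .natAdd 17 17 3, .natAdd 16 6 0, .natConst 14 0, .realConst 4 0,
      .realConst 9 0, .natConst 13 0, .natConst 12 0]).lift,
    drawLoop,
    .op .call,
    (ops [.natAdd 9 8 0, .realAdd 5 6 7, .natAdd 8 8 1, .realAdd 6 6 8]).lift,
    .loop (.natLt 12 5) walkBody,
    decideProg.lift]

attribute [local simp] Instr.apply State.setNat State.setReal Function.update_apply

/-! ### Facts about the process -/

section Rounds

variable (P : Params) {S : Type u} [MeasurableSpace S] (AL : Learner S)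
  (ω : Tape AL.sampleSize S)

/-- The number of the hypothesis of round `q`. -/
def roundIdx (q : ℕ) : ℕ := (walk P AL ω q ((hist P AL ω q).pred P.M q) P.R).1

/-- The scaled predictor at the beginning of round `r`. -/
def curPred (r : ℕ) : I → ℝ := (hist P AL ω r).pred P.M r

theorem hist_wt_zero {r q : ℕ} (h : r ≤ q) : (hist P AL ω r).wt q = 0 := by
  induction r with
  | zero => rfl
  | succ r ih =>
    have : q ≠ r := by omega
    simp only [hist, nextHist, Function.update_of_ne this]
    exact ih (by omega)

theorem hist_wt_stable {r q : ℕ} (h : q < r) :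
    (hist P AL ω r).wt q = (hist P AL ω (q + 1)).wt q := by
  induction r with
  | zero => omega
  | succ r ih =>
    rcases Nat.lt_succ_iff_lt_or_eq.mp h with h | rfl
    · rw [← ih h]
      simp only [hist, nextHist, Function.update_of_ne h.ne]
    · rfl

theorem hist_hyp {r q : ℕ} (h : q < r) :
    (hist P AL ω r).hyp q = fetchHyp P AL ω (curPred P AL ω q) (roundIdx P AL ω q) := by
  induction r with
  | zero => omega
  | succ r ih =>
    rcases Nat.lt_succ_iff_lt_or_eq.mp h with h | rfl
    · rw [← ih h]
      simp only [hist, nextHist, addHyp, Hist.push, Function.update_of_ne h.ne]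
    · simp [hist, nextHist, addHyp, Hist.push, roundIdx, curPred]

theorem walk_fst_mem (r : ℕ) (κ : I → ℝ) (t : ℕ) :
    P.callStart r ≤ (walk P AL ω r κ t).1 ∧
      (walk P AL ω r κ t).1 < P.callStart r + 1 + 2 * t := by
  induction t with
  | zero => simp [walk]
  | succ t ih =>
    rw [walk]
    split_ifs <;> dsimp only <;> omega

theorem roundIdx_lt (q : ℕ) : roundIdx P AL ω q < P.callStart (q + 1) := by
  have := (walk_fst_mem P AL ω q ((hist P AL ω q).pred P.M q) P.R).2
  rw [roundIdx, Params.callStart, Nat.succ_mul]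
  rw [Params.callStart] at this
  omega

theorem callStart_mono {q r : ℕ} (h : q ≤ r) : P.callStart q ≤ P.callStart r :=
  Nat.mul_le_mul_right _ h

theorem rowStart_add_lt {M q r l : ℕ} (h : q < r) (hl : l < (q + 1) * (M + 2)) :
    rowStart M q + l < rowStart M r := by
  have h1 : rowStart M (q + 1) ≤ rowStart M r :=
    Finset.sum_le_sum_of_subset (Finset.range_subset_range.mpr h)
  rw [rowStart, Finset.sum_range_succ] at h1
  rw [rowStart]
  omega

theorem rowStart_succ (M r : ℕ) : rowStart M (r + 1) = rowStart M r + (r + 1) * (M + 2) :=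
  Finset.sum_range_succ _ _

/-! ### States of the main program inside a round -/

/-- The registers holding the parameters. -/
structure Consts (s : State) : Prop where
  n0 : s.nat 0 = 0
  n1 : s.nat 1 = 1
  n2 : s.nat 2 = P.M + 1
  n3 : s.nat 3 = P.M + 2
  n4 : s.nat 4 = P.N
  n5 : s.nat 5 = P.R
  n6 : s.nat 6 = P.n
  r3 : s.real 3 = P.M
  r7 : s.real 7 = 0
  r8 : s.real 8 = 1

/-- The data of the rounds before round `r`. -/
structure Past (r : ℕ) (s : State) : Prop where
  consts : Consts P s
  idx : ∀ q < r, s.arr 2 q = roundIdx P AL ω q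
  wts : ∀ q < r, ∀ l < (q + 1) * (P.M + 2),
    flatWeights P.M (s.arr 5) q l = (hist P AL ω r).wt q l
  wz : ∀ a, rowStart P.M r ≤ a → s.arr 5 a = 0
  hyps : ∀ q < r, s.hyps.getD (roundIdx P AL ω q) (fun _ => 1) = (hist P AL ω r).hyp q
  len : P.callStart r ≤ s.hyps.length

/-- The state in round `r`, with `c` as hypothesis of the last row. -/
structure InRound (r c : ℕ) (s : State) : Prop where
  past : Past P AL ω r s
  n7 : s.nat 7 = r
  n10 : s.nat 10 = rowStart P.M r
  n11 : s.nat 11 = best P AL ω r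
  n15 : s.nat 15 = r + 1
  n16 : s.nat 16 = P.n
  n17 : s.nat 17 = (r + 1) * (P.M + 2)
  r4 : s.real 4 = P.n
  last : s.arr 2 r = c
  blank : ∀ q, r < q → s.arr 2 q = 0
  points : ∀ i < P.n, s.arr 0 i = (ω.1 (P.exStart r + i)).1
  outcomes : ∀ i < P.n, s.arr 1 i = outcome (ω.1 (P.exStart r + i)).2

variable {P AL ω}

theorem Consts.congr {s s' : State} (h : Consts P s)
    (hn : ∀ x ∈ [0, 1, 2, 3, 4, 5, 6], s'.nat x = s.nat x)
    (hr : ∀ x ∈ [3, 7, 8], s'.real x = s.real x) : Consts P s' := by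
  simp only [List.mem_cons, List.not_mem_nil, or_false, forall_eq_or_imp, forall_eq] at hn hr
  obtain ⟨e0, e1, e2, e3, e4, e5, e6⟩ := hn
  obtain ⟨e3', e7', e8'⟩ := hr
  exact ⟨e0.trans h.n0, e1.trans h.n1, e2.trans h.n2, e3.trans h.n3, e4.trans h.n4, e5.trans h.n5,
    e6.trans h.n6, e3'.trans h.r3, e7'.trans h.r7, e8'.trans h.r8⟩

theorem Past.congr {r : ℕ} {s s' : State} (h : Past P AL ω r s)
    (hn : ∀ x ∈ [0, 1, 2, 3, 4, 5, 6], s'.nat x = s.nat x)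
    (hr : ∀ x ∈ [3, 7, 8], s'.real x = s.real x) (h5 : s'.arr 5 = s.arr 5)
    (h2 : ∀ q < r, s'.arr 2 q = s.arr 2 q) (hh : ∃ l, s'.hyps = s.hyps ++ l) :
    Past P AL ω r s' := by
  obtain ⟨l, hl⟩ := hh
  refine ⟨h.consts.congr hn hr, fun q hq => (h2 q hq).trans (h.idx q hq), ?_, ?_, ?_, ?_⟩
  · rw [h5]; exact h.wts
  · rw [h5]; exact h.wz
  · intro q hq
    rw [hl, List.getD_append, h.hyps q hq]
    exact (roundIdx_lt P AL ω q).trans_le ((callStart_mono P hq).trans h.len)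
  · rw [hl, List.length_append]
    exact h.len.trans (Nat.le_add_right _ _)

theorem InRound.congr {r c c' : ℕ} {s s' : State} (h : InRound P AL ω r c s)
    (hn : ∀ x ∈ [0, 1, 2, 3, 4, 5, 6, 7, 10, 11, 15, 16, 17], s'.nat x = s.nat x)
    (hr : ∀ x ∈ [3, 4, 7, 8], s'.real x = s.real x) (h0 : s'.arr 0 = s.arr 0)
    (h1 : s'.arr 1 = s.arr 1) (h5 : s'.arr 5 = s.arr 5)
    (h2 : ∀ q, q ≠ r → s'.arr 2 q = s.arr 2 q) (hc : s'.arr 2 r = c')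
    (hh : ∃ l, s'.hyps = s.hyps ++ l) : InRound P AL ω r c' s' := by
  have hp := h.past.congr (fun x hx => hn x (by simp at hx ⊢; omega))
    (fun x hx => hr x (by simp at hx ⊢; omega)) h5 (fun q hq => h2 q hq.ne) hh
  refine ⟨hp, (hn 7 (by simp)).trans h.n7, (hn 10 (by simp)).trans h.n10,
    (hn 11 (by simp)).trans h.n11, (hn 15 (by simp)).trans h.n15, (hn 16 (by simp)).trans h.n16,
    (hn 17 (by simp)).trans h.n17, (hr 4 (by simp)).trans h.r4, hc,
    fun q hq => (h2 q hq.ne').trans (h.blank q hq), ?_, ?_⟩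
  · rw [h0]; exact h.points
  · rw [h1]; exact h.outcomes

/-- The history of round `r` with the hypothesis number `c` of the list. -/
def listHist (P : Params) (AL : Learner S) (ω : Tape AL.sampleSize S) (r c : ℕ) (s : State) :
    Hist :=
  (hist P AL ω r).push r (s.hyps.getD c fun _ => 1)

theorem push_pred (M : ℕ) (H : Hist) (r : ℕ) (c : I → ℤˣ) (hz : H.wt r = 0) (p : I) :
    (H.push r c).pred M (r + 1) p = H.pred M r p := by
  rw [Hist.pred, Hist.val, rowsVal_succ_of_zero fun l _ => by simp [Hist.push, hz]]
  rw [Hist.pred, Hist.val]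
  congr 1
  refine rowsVal_congr (fun q hq l _ => rfl) fun q hq => ?_
  simp [Hist.push, hq.ne]

theorem evalVal_eq {r c : ℕ} {s : State} (h : Past P AL ω r s) (i : ℕ) :
    evalVal P.M (Function.update (roundIdx P AL ω) r c) s (r + 1) i =
      (listHist P AL ω r c s).val P.M (r + 1) (clip (s.arr 0 i)) := by
  refine rowsVal_congr (fun q hq l hl => ?_) fun q hq => ?_
  · rcases Nat.lt_succ_iff_lt_or_eq.mp hq with hq | rfl
    · exact h.wts q hq l hl
    · rw [flatWeights, h.wz _ (by omega)]
      simp [listHist, Hist.push, hist_wt_zero P AL ω le_rfl]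
  · rcases Nat.lt_succ_iff_lt_or_eq.mp hq with hq | rfl
    · simp [hypVal, lab, listHist, Hist.push, hq.ne, ← h.hyps q hq]
    · simp [hypVal, lab, listHist, Hist.push]

/-- Evaluation of the predictor inside round `r`. -/
theorem evalProg_round {r c B cnt j : ℕ} {s : State} (h : Past P AL ω r s) (h15 : s.nat 15 = r + 1)
    (h16 : s.nat 16 = cnt) (h29 : s.nat 29 = j) (hc : s.arr 2 r = c) (hcB : c ≤ B)
    (hB : P.callStart r ≤ B) (hj : j < (r + 1) * (P.M + 2)) :
    Runs detStep evalProg s (evalTime P.M B (r + 1) cnt) (fun s' =>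
      s'.real 31 = ∑ i ∈ Finset.range cnt,
        (P.M * s.arr 1 i - (hist P AL ω r).pred P.M r (clip (s.arr 0 i))) *
          (listHist P AL ω r c s).feat P.M (r + 1) j (clip (s.arr 0 i)) ∧
      (0 < cnt → s'.real 24 = (hist P AL ω r).pred P.M r (clip (s.arr 0 (cnt - 1))))) := by
  have hp : ∀ p, ((listHist P AL ω r c s).val P.M (r + 1) p).1 = (hist P AL ω r).pred P.M r p :=
    push_pred _ _ _ _ (hist_wt_zero P AL ω le_rfl)
  have pre : EvalPre P.M B (r + 1) cnt j (Function.update (roundIdx P AL ω) r c) s := by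
    refine ⟨h.consts.n0, h.consts.n1, h.consts.n2, h15, h16, h29, h.consts.r3, h.consts.r7,
      h.consts.r8, fun q hq => ?_, hj⟩
    rcases Nat.lt_succ_iff_lt_or_eq.mp hq with hq | rfl
    · simp only [Function.update_of_ne hq.ne]
      exact ⟨h.idx q hq, (roundIdx_lt P AL ω q).le.trans ((callStart_mono P hq).trans hB)⟩
    · simpa using ⟨hc, hcB⟩
  refine (evalProg_runs pre).mono le_rfl ?_
  simp only [evalVal_eq h, hp]
  exact fun s' h => h

theorem Hist.feat_last (M : ℕ) (H : Hist) (r : ℕ) (p : I) :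
    H.feat M (r + 1) ((r + 1) * (M + 2) - 1) p = lab (H.hyp r p) := by
  have h1 : (r + 1) * (M + 2) - 1 = r * (M + 2) + (M + 1) := by rw [Nat.succ_mul]; omega
  rw [h1]
  simp [Hist.feat, Hist.val, rowsVal, addFeatures]

/-- The time needed to evaluate the predictor at the test examples. -/
def roundEval (P : Params) (B : ℕ) : ℕ := evalTime P.M B P.N P.n

theorem evalTime_mono {M B rows rows' cnt cnt' : ℕ} (h : rows ≤ rows') (h' : cnt ≤ cnt') :
    evalTime M B rows cnt ≤ evalTime M B rows' cnt' := by
  unfold evalTime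
  gcongr

theorem relabelProg_read {r c B : ℕ} {s : State} {W : ℝ} (h : InRound P AL ω r c s)
    (h9 : s.real 9 = 1) (hr : r < P.N) (hcB : c ≤ B) (hB : P.callStart r ≤ B)
    (hW : ((roundEval P B + 20 : ℕ) : ℝ) ≤ W) :
    Relabels relabelProg W s (fun _ _ _ => testBit P AL ω r ((hist P AL ω r).pred P.M r)
      (s.hyps.getD c fun _ => 1)) := by
  intro p y u
  set s0 := ((s.setReal 0 p).setReal 1 (outcome y)).setReal 2 u with hs0
  have key : Runs detStep relabelProg s0 (roundEval P B + 20) (fun s' =>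
      testBit P AL ω r ((hist P AL ω r).pred P.M r) (s.hyps.getD c fun _ => 1) =
        signPlus (s'.real 0)) := by
    refine Runs.mono (T := 2 + (evalTime P.M B (r + 1) P.n + 4) + 1) ?_ ?_ fun _ h => h
    · refine Runs.ite (fun _ => ?_) fun hb => ?_
      swap
      · exact absurd hb (by simp [Test.holds, hs0, h9, h.past.consts.r7])
      refine Runs.opsSeq fun s1 e1 => ?_
      have hp : Past P AL ω r s1 := h.past.congr (by simp [e1, hs0]) (by simp [e1, hs0])
        (by simp [e1, hs0]) (by simp [e1, hs0]) ⟨[], by simp [e1, hs0]⟩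
      -- The last feature of the current row is the candidate itself, so the correlation computed
      -- here is its test statistic.
      refine Runs.frameSeq (evalProg_round (c := c) (cnt := P.n)
        (j := (r + 1) * (P.M + 2) - 1) hp ?_ ?_ ?_ ?_ hcB hB ?_) fun s2 f2 F2 => Runs.ops _ _ ?_
      · simp [e1, hs0, h.n15]
      · simp [e1, hs0, h.n16]
      · simp [e1, hs0, h.n17, h.past.consts.n1]
      · simp [e1, hs0, h.last]
      · rw [Nat.succ_mul]; omega
      have r4 : s2.real 4 = P.n := by simp [F2.real 4 rfl, e1, hs0, h.r4]
      simp only [List.foldl, Instr.apply, State.setReal, Function.update_self,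
        Function.update_apply, r4, f2.1, testBit, testStat]
      simp only [Nat.reduceEqDiff, if_false]
      congr 1
      congr 1
      · refine Finset.sum_congr rfl fun i hi => ?_
        have hi := Finset.mem_range.mp hi
        have e0 : s1.arr 0 i = (ω.1 (P.exStart r + i)).1 := by simp [e1, hs0, h.points i hi]
        have e1' : s1.arr 1 i = outcome (ω.1 (P.exStart r + i)).2 := by
          simp [e1, hs0, h.outcomes i hi]
        have e2 : s1.hyps = s.hyps := by simp [e1, hs0]
        rw [e0, e1', clip_coe, Hist.feat_last, listHist, e2]
        simp [Hist.push]
      · ring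
    · have := evalTime_mono (M := P.M) (B := B) (cnt := P.n) (show r + 1 ≤ P.N from hr) le_rfl
      simp only [roundEval]
      omega
  obtain ⟨t, s', h1, h2, h3⟩ := key
  exact ⟨t, s', le_trans (by exact_mod_cast h1) hW, h2, h3⟩

theorem relabelProg_fetch {r c B : ℕ} {s : State} {W : ℝ} (h : InRound P AL ω r c s)
    (h9 : s.real 9 = 0) (hr : r < P.N) (hcB : c ≤ B) (hB : P.callStart r ≤ B) (hn : 0 < P.n)
    (hW : ((roundEval P B + 20 : ℕ) : ℝ) ≤ W) :
    Relabels relabelProg W s (residualLabel P.M ((hist P AL ω r).pred P.M r)) := by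
  intro p y u
  set s0 := ((s.setReal 0 p).setReal 1 (outcome y)).setReal 2 u with hs0
  have key : Runs detStep relabelProg s0 (roundEval P B + 20) (fun s' =>
      residualLabel P.M ((hist P AL ω r).pred P.M r) p y u = signPlus (s'.real 0)) := by
    refine Runs.mono (T := 4 + (evalTime P.M B (r + 1) 1 + 7) + 1) ?_ ?_ fun _ h => h
    · refine Runs.ite (fun hb => ?_) fun _ => ?_
      · exact absurd hb (by simp [Test.holds, hs0, h9, h.past.consts.r7])
      refine Runs.opsSeq fun s1 e1 => ?_
      have hp : Past P AL ω r s1 := h.past.congr (by simp [e1, hs0]) (by simp [e1, hs0])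
        (by simp [e1, hs0]) (by simp [e1, hs0]) ⟨[], by simp [e1, hs0]⟩
      -- Only the prediction at one point is wanted; feature 0 is an arbitrary admissible choice.
      refine Runs.frameSeq (evalProg_round (c := c) (cnt := 1)
        (j := 0) hp ?_ ?_ ?_ ?_ hcB hB ?_) fun s2 f2 F2 => Runs.ops _ _ ?_
      · simp [e1, hs0, h.n15]
      · simp [e1, hs0]
      · simp [e1, hs0]
      · simp [e1, hs0, h.last]
      · positivity
      have r24 := f2.2 one_pos
      have e0 : s1.arr 0 (1 - 1) = p := by simp [e1, hs0]
      rw [e0, clip_coe] at r24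
      have r3 : s2.real 3 = P.M := by simp [F2.real 3 rfl, e1, hs0, h.past.consts.r3]
      have r1 : s2.real 1 = outcome y := by simp [F2.real 1 rfl, e1, hs0]
      have r2 : s2.real 2 = u := by simp [F2.real 2 rfl, e1, hs0]
      simp [r24, r3, r1, r2, residualLabel]
    · have := evalTime_mono (M := P.M) (B := B) (show r + 1 ≤ P.N from hr)
        (show 1 ≤ P.n from hn)
      simp only [roundEval]
      omega
  obtain ⟨t, s', h1, h2, h3⟩ := key
  exact ⟨t, s', le_trans (by exact_mod_cast h1) hW, h2, h3⟩

end Rounds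

end Omniprediction

end

noncomputable section

namespace Omniprediction

set_option linter.unusedSimpArgs false

attribute [local simp] Instr.apply State.setNat State.setReal Function.update_apply

/-! ### The rounds of the main program -/

section Rounds

variable {P : Params} {S : Type u} [MeasurableSpace S] {AL : Learner S}
  {ω : Tape AL.sampleSize S} {A : Algorithm} {W : ℝ}

theorem drawLoop_runs {s : State} {r n : ℕ} (h1 : s.nat 1 = 1) (h6 : s.nat 6 = n)
    (h8 : s.real 8 = 1) (h14 : s.nat 14 = 0) (h4 : s.real 4 = 0) (he : s.examples = r) :
    Runs (Op.step A AL W ω) drawLoop s (n * 7 + 1) (fun s' =>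
      (s'.real 4 = n ∧ s'.examples = r + n ∧ s'.hyps = s.hyps ∧
      (∀ i < n, s'.arr 0 i = (ω.1 (r + i)).1) ∧
      (∀ i < n, s'.arr 1 i = outcome (ω.1 (r + i)).2)) ∧ OpFrame drawLoop s s') := by
  refine (Runs.loopOpFrame (A := A) (AL := AL) (W := W) (ω := ω) (T := 6) n (fun k s' => s'.nat 14 = k ∧ s'.real 4 = k ∧
      s'.examples = r + k ∧ s'.hyps = s.hyps ∧ (∀ i < k, s'.arr 0 i = (ω.1 (r + i)).1) ∧
      (∀ i < k, s'.arr 1 i = outcome (ω.1 (r + i)).2))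
    ⟨h14, by simpa using h4, by simpa using he, rfl, by simp, by simp⟩ ?_ ?_).mono le_rfl
    fun s' h => ⟨h.1.2, h.2⟩
  · rintro k hk s' hF ⟨ha, hb, hc, hh, hd, he⟩
    have h1' : s'.nat 1 = 1 := (hF.nat 1 rfl).trans h1
    have h6' : s'.nat 6 = n := (hF.nat 6 rfl).trans h6
    have h8' : s'.real 8 = 1 := (hF.real 8 rfl).trans h8
    refine ⟨by simpa [Test.holds, ha, h6'] using hk, ?_⟩
    refine Runs.sampleSeq (AL := AL) (A := A) (W := W) (ω := ω) (T := 5) fun s1 e1 => ?_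
    refine Runs.mono (Runs.liftOp (A := A) (AL := AL) (W := W) (ω := ω) (Runs.ops _ _ ?_)) le_rfl
      fun _ h => h.1
    simp only [e1, List.foldl, Instr.apply, State.setNat, State.setReal, Function.update_apply, ha,
      hb, hc, h1', h8', Nat.reduceEqDiff, if_true, if_false]
    refine ⟨trivial, by simp, by ring, hh, fun i hi => ?_, fun i hi => ?_⟩
    · rcases Nat.lt_succ_iff_lt_or_eq.mp hi with h | rfl
      · simpa [h.ne] using hd i h
      · simp
    · rcases Nat.lt_succ_iff_lt_or_eq.mp hi with h | rfl
      · simpa [h.ne] using he i h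
      · simp
  · rintro s' hF ⟨ha, -⟩
    have h6' : s'.nat 6 = n := (hF.nat 6 rfl).trans h6
    simp [Test.holds, ha, h6']

/-- The state after `t` steps of the search. -/
structure Searching (P : Params) (AL : Learner S) (ω : Tape AL.sampleSize S) (r t : ℕ)
    (s : State) : Prop where
  inRound : ∃ c, c < P.callStart (r + 1) ∧ InRound P AL ω r c s
  n8 : s.nat 8 = P.callStart r + 1 + 2 * t
  r6 : s.real 6 = (P.callStart r + 1 + 2 * t : ℕ)
  n9 : s.nat 9 = (walk P AL ω r (curPred P AL ω r) t).1
  r5 : s.real 5 = (walk P AL ω r (curPred P AL ω r) t).1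
  n13 : s.nat 13 = (walk P AL ω r (curPred P AL ω r) t).2
  n12 : s.nat 12 = t
  len : s.hyps.length = P.callStart r + 1 + 2 * t
  cand : s.hyps.getD (walk P AL ω r (curPred P AL ω r) t).1 (fun _ => 1) =
    fetchHyp P AL ω (curPred P AL ω r) (walk P AL ω r (curPred P AL ω r) t).1
  ex : s.examples = P.exStart r + P.n + t

theorem callStart_succ (P : Params) (r : ℕ) :
    P.callStart (r + 1) = P.callStart r + 1 + 2 * P.R := by
  rw [Params.callStart, Params.callStart]; ring

theorem walkUpdate_runs {s : State} {cnd lev q t : ℕ} {a : ℤˣ} (h0 : s.nat 0 = 0)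
    (h1 : s.nat 1 = 1) (h7 : s.real 7 = 0) (h8 : s.real 8 = 1) (h10 : s.real 10 = lab a)
    (h9 : s.nat 9 = cnd) (h5 : s.real 5 = cnd) (h13 : s.nat 13 = lev) (hq : s.nat 8 = q)
    (hq' : s.real 6 = q) (h12 : s.nat 12 = t) :
    Runs detStep walkUpdate s 9 (fun s' => s'.nat 8 = q + 1 ∧ s'.real 6 = (q + 1 : ℕ) ∧
      s'.nat 9 = (if a = 1 then (cnd, lev + 1) else if 0 < lev then (cnd, lev - 1) else (q, 0)).1 ∧
      s'.real 5 = (if a = 1 then (cnd, lev + 1) else if 0 < lev then (cnd, lev - 1) else (q, 0)).1 ∧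
      s'.nat 13 = (if a = 1 then (cnd, lev + 1) else if 0 < lev then (cnd, lev - 1) else (q, 0)).2 ∧
      s'.nat 12 = t + 1) := by
  refine Runs.mono (T := 5 + 4) ?_ le_rfl fun _ h => h
  refine Runs.frameSeq (P := fun s' =>
      s'.nat 9 = (if a = 1 then (cnd, lev + 1) else if 0 < lev then (cnd, lev - 1) else (q, 0)).1 ∧
      s'.real 5 = (if a = 1 then (cnd, lev + 1) else if 0 < lev then (cnd, lev - 1) else (q, 0)).1 ∧
      s'.nat 13 = (if a = 1 then (cnd, lev + 1) else if 0 < lev then (cnd, lev - 1) else (q, 0)).2)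
    ?_ fun s1 e1 F1 => Runs.ops _ _ ?_
  · have ha : (s.real 7 < s.real 10) ↔ a = 1 := by
      rw [h7, h10]
      rcases Int.units_eq_one_or a with rfl | rfl <;> simp [lab]
    refine Runs.ite (T := 4) (fun hb => ?_) fun hb => ?_
    · have hb := ha.mp hb
      exact (Runs.ops _ _ (by simp [hb, h9, h5, h13, h1])).mono (T := 2) (by omega) fun _ h => h
    · have hb : ¬ a = 1 := fun h => hb (ha.mpr h)
      refine Runs.ite (T := 3) (fun hb' => ?_) fun hb' => ?_
      · have hb' : 0 < lev := by simpa [Test.holds, h0, h13] using hb'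
        refine (Runs.ops _ _ ?_).mono (T := 2) (by omega) fun _ h => h
        simp [hb, hb', h9, h5, h13, h1]
      · have hb' : ¬ 0 < lev := by simpa [Test.holds, h0, h13] using hb'
        refine (Runs.ops _ _ ?_).mono (T := 3) (by omega) fun _ h => h
        simp [hb, hb', h9, h5, h13, h1, hq, hq', h0, h7]
        omega
  · have n1 := (F1.nat 1 rfl).trans h1
    have n8 := (F1.nat 8 rfl).trans hq
    have n12 := (F1.nat 12 rfl).trans h12
    have r8 := (F1.real 8 rfl).trans h8
    have r6 := (F1.real 6 rfl).trans hq'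
    simp [n1, n8, n12, r8, r6, e1]

theorem walkBody_runs {r t B : ℕ} {s : State} (hA : A.relabel = relabelProg)
    (h : Searching P AL ω r t s) (hr : r < P.N) (ht : t < P.R) (hn : 0 < P.n)
    (hB : P.callStart P.N ≤ B) (hW : ((roundEval P B + 20 : ℕ) : ℝ) ≤ W) :
    Runs (Op.step A AL W ω) walkBody s 20 (Searching P AL ω r (t + 1)) := by
  obtain ⟨c, hc, hI⟩ := h.inRound
  set κ := curPred P AL ω r with hκ
  set cnd := (walk P AL ω r κ t).1 with hcnd
  have hcs := callStart_succ P r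
  have hBr : P.callStart (r + 1) ≤ B := (callStart_mono P hr).trans hB
  have hcnd' : cnd < P.callStart r + 1 + 2 * t := (walk_fst_mem P AL ω r κ t).2
  refine Runs.mono (T := 3 + (1 + (1 + (5 + (1 + 9))))) ?_ (by omega) fun _ h => h
  refine Runs.liftOpsSeq fun s1 e1 => ?_
  have I1 : InRound P AL ω r cnd s1 := hI.congr (by simp [e1]) (by simp [e1]) (by simp [e1])
    (by simp [e1]) (by simp [e1]) (fun q hq => by simp [e1, hI.n7, hq])
    (by simp [e1, hI.n7, h.r5]; rfl) ⟨[], by simp [e1]⟩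
  refine Runs.callSeq _ (hA ▸ relabelProg_read I1 (by simp [e1]) hr (by omega) (by omega) hW)
    fun s2 e2 => ?_
  have hyp1 : s1.hyps = s.hyps := by simp [e1]
  have len1 : s1.hyps.length = P.callStart r + 1 + 2 * t := by rw [hyp1, h.len]
  -- The number of a call on the tape is the current length of the list of hypotheses, so it agrees
  -- with the numbering used by the search.
  rw [len1, hyp1, h.cand] at e2
  change s2 = { s1 with hyps := s.hyps ++ [readHyp AL ω (testBit P AL ω r κ
    (fetchHyp P AL ω κ cnd)) (P.callStart r + 1 + 2 * t)] } at e2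
  refine Runs.sampleSeq fun s3 e3 => ?_
  refine Runs.liftOpsSeq fun s4 e4 => ?_
  have hyp2 : s4.hyps = s.hyps ++ [readHyp AL ω (testBit P AL ω r κ
    (fetchHyp P AL ω κ cnd)) (P.callStart r + 1 + 2 * t)] := by simp [e4, e3, e2]
  have I4 : InRound P AL ω r cnd s4 := I1.congr (by simp [e4, e3, e2]) (by simp [e4, e3, e2])
    (by simp [e4, e3, e2]) (by simp [e4, e3, e2]) (by simp [e4, e3, e2]) (by simp [e4, e3, e2])
    (by rw [← I1.last]; simp [e4, e3, e2]) ⟨_, by rw [hyp2, hyp1]⟩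
  refine Runs.callSeq _ (hA ▸ relabelProg_fetch I4 (by simp [e4]) hr (by omega) (by omega) hn hW)
    fun s5 e5 => ?_
  have len4 : s4.hyps.length = P.callStart r + 2 + 2 * t := by
    rw [hyp2, List.length_append, h.len]
    simp
    omega
  rw [len4, hyp2] at e5
  change s5 = { s4 with hyps := (s.hyps ++ [readHyp AL ω (testBit P AL ω r κ
    (fetchHyp P AL ω κ cnd)) (P.callStart r + 1 + 2 * t)]) ++
      [fetchHyp P AL ω κ (P.callStart r + 2 + 2 * t)] } at e5
  have hans : s5.real 10 = lab (answer P AL ω r κ t cnd) := by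
    have hex : s1.examples = P.exStart r + P.n + t := by simp [e1, h.ex]
    have hn8 : s1.nat 8 = P.callStart r + 1 + 2 * t := by simp [e1, h.n8]
    simp [e5, e4, e3, e2, hex, hn8, clip_coe, answer, lab]
    rw [List.getElem?_append_right h.len.le, h.len]
    simp
  have hw : walk P AL ω r κ (t + 1) =
      if answer P AL ω r κ t cnd = 1 then (cnd, (walk P AL ω r κ t).2 + 1)
      else if 0 < (walk P AL ω r κ t).2 then (cnd, (walk P AL ω r κ t).2 - 1)
      else (P.callStart r + 2 + 2 * t, 0) := by
    rw [walk]
  have c0 := hI.past.consts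
  refine (Runs.liftOp (walkUpdate_runs (cnd := cnd) (lev := (walk P AL ω r κ t).2)
    (q := P.callStart r + 2 + 2 * t) (t := t) (a := answer P AL ω r κ t cnd)
    ?_ ?_ ?_ ?_ hans ?_ ?_ ?_ ?_ ?_ ?_)).mono le_rfl ?_
  · simp [e5, e4, e3, e2, e1, c0.n0]
  · simp [e5, e4, e3, e2, e1, c0.n1]
  · simp [e5, e4, e3, e2, e1, c0.r7]
  · simp [e5, e4, e3, e2, e1, c0.r8]
  · simp [e5, e4, e3, e2, e1, h.n9]; rfl
  · simp [e5, e4, e3, e2, e1, h.r5]; rfl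
  · simp [e5, e4, e3, e2, e1, h.n13]; rfl
  · simp [e5, e4, e3, e2, e1, h.n8, c0.n1]; omega
  · simp [e5, e4, e3, e2, e1, h.r6, c0.r8]; ring
  · simp [e5, e4, e3, e2, e1, h.n12]
  rintro s6 ⟨⟨g8, g6, g9, g5, g13, g12⟩, F6⟩
  rw [← hw] at g9 g5 g13
  have hyp6 : s6.hyps = (s.hyps ++ [readHyp AL ω (testBit P AL ω r κ
    (fetchHyp P AL ω κ cnd)) (P.callStart r + 1 + 2 * t)]) ++
      [fetchHyp P AL ω κ (P.callStart r + 2 + 2 * t)] := by rw [F6.hyps, e5]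
  refine ⟨⟨cnd, by omega, I4.congr ?_ ?_ ?_ ?_ ?_ ?_ ?_ ?_⟩, ?_, ?_, g9, g5, g13, g12, ?_, ?_, ?_⟩
  · intro x hx
    rw [F6.nat x, e5]
    simp only [List.mem_cons, List.not_mem_nil, or_false] at hx
    rcases hx with rfl | rfl | rfl | rfl | rfl | rfl | rfl | rfl | rfl | rfl | rfl | rfl | rfl <;>
      rfl
  · intro x hx
    rw [F6.real x, e5]
    simp only [List.mem_cons, List.not_mem_nil, or_false] at hx
    rcases hx with rfl | rfl | rfl | rfl <;> rfl
  · rw [F6.arr 0 rfl, e5]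
  · rw [F6.arr 1 rfl, e5]
  · rw [F6.arr 5 rfl, e5]
  · intro q _; rw [F6.arr 2 rfl, e5]
  · rw [F6.arr 2 rfl, e5, ← I4.last]
  · exact ⟨_, by rw [hyp6, hyp2]⟩
  · rw [g8]; ring
  · rw [g6]; congr 1; ring
  · rw [hyp6]; simp [h.len]; omega
  · have hl : s.hyps.length = P.callStart r + 1 + 2 * t := h.len
    rw [hyp6, hw]
    split_ifs
    · rw [List.append_assoc, List.getD_append _ _ _ _ (by simp; omega)]
      exact h.cand
    · rw [List.append_assoc, List.getD_append _ _ _ _ (by simp; omega)]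
      exact h.cand
    · rw [List.getD_append_right _ _ _ _ (by simp; omega), List.length_append, hl,
        List.length_singleton,
        show P.callStart r + 2 + 2 * t - (P.callStart r + 1 + 2 * t + 1) = 0 by omega]
      rfl
  · rw [F6.examples]
    simp [e5, e4, e3, e2, e1, h.ex]
    omega

theorem walkLoop_runs {r B : ℕ} {s : State} (hA : A.relabel = relabelProg)
    (h : Searching P AL ω r 0 s) (hr : r < P.N) (hn : 0 < P.n)
    (hB : P.callStart P.N ≤ B) (hW : ((roundEval P B + 20 : ℕ) : ℝ) ≤ W) :
    Runs (Op.step A AL W ω) (.loop (.natLt 12 5) walkBody) s (P.R * 21 + 1)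
      (Searching P AL ω r P.R) := by
  refine Runs.loop (T := 20) P.R (fun t s => Searching P AL ω r t s) h (fun t ht s h => ?_)
    fun s h => ?_
  · refine ⟨?_, walkBody_runs hA h hr ht hn hB hW⟩
    obtain ⟨c, hc, hI⟩ := h.inRound
    simpa [Test.holds, h.n12, hI.past.consts.n5] using ht
  · obtain ⟨c, hc, hI⟩ := h.inRound
    simp [Test.holds, h.n12, hI.past.consts.n5]

end Rounds

end Omniprediction

end

/-! ### Choice of the correction at the end of a round, and complete rounds. -/

noncomputable section

namespace Omniprediction

set_option linter.unusedSimpArgs false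

attribute [local simp] Instr.apply State.setNat State.setReal Function.update_apply

section Decide

variable {P : Params} {S : Type u} [MeasurableSpace S] {AL : Learner S}
  {ω : Tape AL.sampleSize S} {A : Algorithm} {W : ℝ}

/-- The result of looking for the first large statistic among the first `k`. -/
def Found (P : Params) (St : ℕ → ℝ) (a k : ℕ) (s : State) : Prop :=
  (s.nat 18 = 0 ∧ s.real 13 = 0 ∧ s.nat 19 = a ∧ ∀ l < k, |St l| ≤ 2 * P.n) ∨
  (s.nat 18 = 1 ∧ ∃ l0 < k, s.nat 19 = a + l0 ∧ (∀ l < l0, |St l| ≤ 2 * P.n) ∧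
    2 * P.n < |St l0| ∧ s.real 13 = select St (2 * P.n) l0)

theorem decideLoop_runs {r c B : ℕ} {s : State} (h : InRound P AL ω r c s) (hcB : c ≤ B)
    (hB : P.callStart r ≤ B) (hr : r < P.N)
    (hc : s.hyps.getD c (fun _ => 1) = fetchHyp P AL ω (curPred P AL ω r) (roundIdx P AL ω r))
    (h18 : s.nat 18 = 0) (h13 : s.real 13 = 0) (h19 : s.nat 19 = rowStart P.M r)
    (h29 : s.nat 29 = 0) (h14 : s.real 14 = 2 * P.n) (h15 : s.real 15 = -(2 * P.n)) :
    Runs detStep decideLoop s ((r + 1) * (P.M + 2) * (roundEval P B + 12 + 1) + 1) (fun s' =>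
      Found P (roundStat P AL ω r (hist P AL ω r)) (rowStart P.M r) ((r + 1) * (P.M + 2)) s' ∧
      Frame decideLoop s s') := by
  set St := roundStat P AL ω r (hist P AL ω r) with hSt
  refine (Runs.loopFrame (T := roundEval P B + 12) ((r + 1) * (P.M + 2))
    (fun k s' => s'.nat 29 = k ∧ Found P St (rowStart P.M r) k s')
    ⟨h29, Or.inl ⟨h18, h13, h19, by simp⟩⟩ ?_ ?_).mono le_rfl
    fun s' h => ⟨h.1.2, ⟨h.2.nat, h.2.real, h.2.arr, h.2.hyps, h.2.examples, h.2.coins⟩⟩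
  · rintro k hk s' hF ⟨ha, hb⟩
    have n17 := (hF.nat 17 rfl).trans h.n17
    refine ⟨by simpa [Test.holds, ha, n17] using hk, ?_⟩
    have hev := evalTime_mono (M := P.M) (B := B) (cnt := P.n) (show r + 1 ≤ P.N from hr) le_rfl
    refine Runs.mono (T := evalTime P.M B (r + 1) P.n + (7 + 2)) ?_
      (by simp only [roundEval]; omega) fun _ h => h
    have I' : InRound P AL ω r c s' := h.congr ?_ ?_ (hF.arr 0 rfl) (hF.arr 1 rfl) (hF.arr 5 rfl)
      (fun q _ => by rw [hF.arr 2 rfl]) (by rw [hF.arr 2 rfl, h.last]) ⟨[], by simp [hF.hyps]⟩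
    rotate_left
    · intro x hx
      rw [hF.nat x]
      simp only [List.mem_cons, List.not_mem_nil, or_false] at hx
      rcases hx with rfl | rfl | rfl | rfl | rfl | rfl | rfl | rfl | rfl | rfl | rfl | rfl | rfl <;>
        rfl
    · intro x hx
      rw [hF.real x]
      simp only [List.mem_cons, List.not_mem_nil, or_false] at hx
      rcases hx with rfl | rfl | rfl | rfl <;> rfl
    refine Runs.frameSeq (evalProg_round (c := c) (cnt := P.n) (j := k) I'.past I'.n15 I'.n16 ha
      I'.last hcB hB hk) fun s1 f1 F1 => ?_
    have r31 : s1.real 31 = St k := by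
      rw [f1.1, hSt]
      refine Finset.sum_congr rfl fun i hi => ?_
      have hi := Finset.mem_range.mp hi
      rw [I'.points i hi, I'.outcomes i hi, clip_coe]
      have : listHist P AL ω r c s' = addHyp P AL ω r (hist P AL ω r) := by
        rw [listHist, hF.hyps, hc]; rfl
      rw [this]
    have n0 := (F1.nat 0 rfl).trans I'.past.consts.n0
    have n1 := (F1.nat 1 rfl).trans I'.past.consts.n1
    have n10 := (F1.nat 10 rfl).trans I'.n10
    have n29 := (F1.nat 29 rfl).trans ha
    have r14 := (F1.real 14 rfl).trans ((hF.real 14 rfl).trans h14)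
    have r15 := (F1.real 15 rfl).trans ((hF.real 15 rfl).trans h15)
    have n18 := F1.nat 18 rfl
    have n19 := F1.nat 19 rfl
    have r13 := F1.real 13 rfl
    refine Runs.frameSeq (P := fun s2 => Found P St (rowStart P.M r) (k + 1) s2)
      (Runs.ite (T := 6) (fun hb' => ?_) fun hb' => ?_)
      fun s2 e2 F2 => Runs.ops _ _ ⟨?_, ?_⟩
    · have h18' : s'.nat 18 = 0 := by simpa [Test.holds, n18, n1] using hb'
      rcases hb with hb | ⟨hb, -⟩
      swap
      · omega
      obtain ⟨-, g13, g19, gl⟩ := hb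
      have hsel : select St (2 * P.n) k = if 2 * P.n < St k then 1 else
          if St k < -(2 * P.n) then -1 else 0 := by rw [select, if_pos gl]
      refine Runs.ite (T := 5) (fun hb1 => ?_) fun hb1 => ?_
      · simp only [Test.holds, r14, r31] at hb1
        refine (Runs.ops _ _ (Or.inr ?_)).mono (T := 4) (by omega) fun _ h => h
        refine ⟨by simp, k, by omega, by simp [n10, n29], gl, hb1.trans_le (le_abs_self _), ?_⟩
        simp [hsel, hb1]
      · simp only [Test.holds, r14, r31] at hb1
        refine Runs.ite (T := 4) (fun hb2 => ?_) fun hb2 => ?_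
        · simp only [Test.holds, r15, r31] at hb2
          refine (Runs.ops _ _ (Or.inr ?_)).mono (T := 4) (by omega) fun _ h => h
          refine ⟨by simp, k, by omega, by simp [n10, n29], gl,
            lt_of_lt_of_le (by linarith) (neg_le_abs _), ?_⟩
          simp [hsel, hb1, hb2]
        · simp only [Test.holds, r15, r31] at hb2
          refine ⟨1, s1, by omega, .skip _, Or.inl ⟨by omega, r13.trans g13, n19.trans g19, ?_⟩⟩
          intro l hl
          rcases Nat.lt_succ_iff_lt_or_eq.mp hl with hl | rfl
          · exact gl l hl
          · exact abs_le.mpr ⟨not_lt.mp hb2, not_lt.mp hb1⟩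
    · have h18' : s'.nat 18 ≠ 0 := by simpa [Test.holds, n18, n1] using hb'
      rcases hb with ⟨hb, -⟩ | hb
      · exact absurd hb h18'
      refine ⟨1, s1, by omega, .skip _, Or.inr ?_⟩
      obtain ⟨g, l0, g1, g2, g3, g4, g5⟩ := hb
      exact ⟨n18.trans g, l0, by omega, n19.trans g2, g3, g4, r13.trans g5⟩
    · simp [F2.nat 29 rfl, n29, F2.nat 1 rfl, n1]
    · simpa [Found] using e2
  · rintro s' hF ⟨ha, -⟩
    have n17 := (hF.nat 17 rfl).trans h.n17
    simp [Test.holds, ha, n17]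

/-- The state of the main program before round `r`. -/
structure RoundStart (P : Params) (AL : Learner S) (ω : Tape AL.sampleSize S) (r : ℕ)
    (s : State) : Prop where
  past : Past P AL ω r s
  n7 : s.nat 7 = r
  n8 : s.nat 8 = P.callStart r
  r6 : s.real 6 = P.callStart r
  n10 : s.nat 10 = rowStart P.M r
  n11 : s.nat 11 = best P AL ω r
  n17 : s.nat 17 = r * (P.M + 2)
  blank : ∀ q, r ≤ q → s.arr 2 q = 0
  len : s.hyps.length = P.callStart r
  ex : s.examples = P.exStart r

/-- The selected weights vanish at all places but one, so a single store into a blank row records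
all of them; and the flag tells whether the round is quiet. -/
theorem select_of_found {St : ℕ → ℝ} {a k : ℕ} {s : State} (h : Found P St a k s) (hk : 0 < k) :
    (s.nat 18 = 0 ↔ ∀ l < k, |St l| ≤ 2 * P.n) ∧
    ∃ l0 < k, s.nat 19 = a + l0 ∧ s.real 13 = select St (2 * P.n) l0 ∧
      ∀ l < k, l ≠ l0 → select St (2 * P.n) l = 0 := by
  have key : ∀ l, |St l| ≤ 2 * P.n → select St (2 * P.n) l = 0 := by
    intro l hl
    rw [abs_le] at hl
    rw [select, if_neg (not_lt.mpr hl.2), if_neg (not_lt.mpr hl.1), ite_self]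
  rcases h with ⟨h1, h2, h3, h4⟩ | ⟨h1, l0, h2, h3, h4, h5, h6⟩
  · refine ⟨⟨fun _ => h4, fun _ => h1⟩, 0, hk, by simpa using h3, ?_, fun l hl _ => key l (h4 l hl)⟩
    rw [h2, key 0 (h4 0 hk)]
  · refine ⟨⟨fun h => by omega, fun h => absurd (h l0 h2) (not_le.mpr h5)⟩, l0, h2, h3, h6, ?_⟩
    intro l hl hne
    rcases lt_or_gt_of_ne hne with hlt | hgt
    · exact key l (h4 l hlt)
    · rw [select, if_neg]
      exact fun h => absurd (h l0 hgt) (not_le.mpr h5)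

theorem decideProg_runs {r B : ℕ} {s : State} (h : Searching P AL ω r P.R s) (hr : r < P.N)
    (hB : P.callStart P.N ≤ B) :
    Runs detStep decideProg s ((r + 1) * (P.M + 2) * (roundEval P B + 12 + 1) + 17)
      (RoundStart P AL ω (r + 1)) := by
  obtain ⟨c0, hc0, hI⟩ := h.inRound
  have hBr : P.callStart (r + 1) ≤ B := (callStart_mono P hr).trans hB
  have hBr' : P.callStart r ≤ B := (callStart_mono P hr.le).trans hB
  set L := (r + 1) * (P.M + 2) with hL
  have hL0 : 0 < L := by positivity
  set St := roundStat P AL ω r (hist P AL ω r) with hSt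
  refine Runs.mono (T := 8 + (L * (roundEval P B + 12 + 1) + 1 + (3 + (3 + 2)))) ?_ (by omega)
    fun _ h => h
  refine Runs.opsSeq fun s1 e1 => ?_
  have hci : roundIdx P AL ω r < P.callStart (r + 1) := roundIdx_lt P AL ω r
  have I1 : InRound P AL ω r (roundIdx P AL ω r) s1 := hI.congr (by simp [e1]) (by simp [e1])
    (by simp [e1]) (by simp [e1]) (by simp [e1]) (fun q hq => by simp [e1, hI.n7, hq])
    (by simp [e1, hI.n7, h.r5]; rfl) ⟨[], by simp [e1]⟩
  have cst := I1.past.consts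
  have hyp1 : s1.hyps = s.hyps := by simp [e1]
  refine Runs.seq (decideLoop_runs I1 (hci.le.trans hBr) hBr' hr (by rw [hyp1]; exact h.cand)
    ?_ ?_ ?_ ?_ ?_ ?_) ?_
  · simp [e1]
  · simp [e1]
  · simp [e1, hI.n10, hI.past.consts.n0]
  · simp [e1]
  · simp [e1, hI.r4]; ring
  · simp [e1, hI.r4, hI.past.consts.r7]; ring
  rintro s2 ⟨f2, F2⟩
  obtain ⟨g18, l0, hl0, g19, g13, gz⟩ := select_of_found f2 hL0
  refine Runs.opsSeq fun s3 e3 => ?_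
  have n10 : s2.nat 10 = rowStart P.M r := (F2.nat 10 rfl).trans I1.n10
  have n7 : s2.nat 7 = r := (F2.nat 7 rfl).trans I1.n7
  have n11 : s2.nat 11 = best P AL ω r := (F2.nat 11 rfl).trans I1.n11
  have n17 : s2.nat 17 = L := (F2.nat 17 rfl).trans I1.n17
  have n1 : s2.nat 1 = 1 := (F2.nat 1 rfl).trans cst.n1
  have n0 : s2.nat 0 = 0 := (F2.nat 0 rfl).trans cst.n0
  have a5 : s2.arr 5 = s1.arr 5 := F2.arr 5 rfl
  have a2 : s2.arr 2 = s1.arr 2 := F2.arr 2 rfl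
  refine Runs.frameSeq (P := fun s4 => s4.nat 11 = best P AL ω (r + 1))
    (Runs.ite (T := 2) (fun hb => Runs.ops _ _ ?_) fun hb => ?_) fun s4 e4 F4 => Runs.ops _ _ ?_
  · have : s2.nat 18 = 0 := by simpa [Test.holds, e3, n1] using hb
    have hq : Quiet P AL ω r := g18.mp this
    simp [e3, n7, n0, best, hq]
  · have : s2.nat 18 ≠ 0 := by simpa [Test.holds, e3, n1] using hb
    have hq : ¬ Quiet P AL ω r := fun h => this (g18.mpr h)
    exact ⟨1, s3, by omega, .skip _, by simp [e3, n11, best, hq]⟩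
  · have hw5 : ∀ a, s4.arr 5 a =
        if a = rowStart P.M r + l0 then select St (2 * P.n) l0 else s1.arr 5 a := by
      intro a
      rw [F4.arr 5 rfl]
      simp [e3, g19, g13, a5, hSt]
    have hs : ∀ x < 7, s4.nat x = s1.nat x := by
      intro x hx
      rw [F4.nat x, e3]
      · have : F2.nat x = F2.nat x := rfl
        have h2 : s2.nat x = s1.nat x := F2.nat x (by interval_cases x <;> rfl)
        have : x ≠ 10 := by omega
        simp [this, h2]
      · interval_cases x <;> rfl
    have hsr : ∀ x ∈ [3, 7, 8], s4.real x = s1.real x := by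
      intro x hx
      simp only [List.mem_cons, List.not_mem_nil, or_false] at hx
      rw [F4.real x, e3]
      · have h2 : s2.real x = s1.real x := F2.real x (by rcases hx with rfl | rfl | rfl <;> rfl)
        simp [h2]
      · rcases hx with rfl | rfl | rfl <;> rfl
    have hyp4 : s4.hyps = s.hyps := by rw [F4.hyps, e3]; simp [F2.hyps, hyp1]
    have arr2 : s4.arr 2 = s1.arr 2 := by rw [F4.arr 2 rfl, e3]; simp [a2]
    have n7' : s4.nat 7 = r := by rw [F4.nat 7 rfl, e3]; simp [n7]
    have n1' : s4.nat 1 = 1 := (hs 1 (by omega)).trans cst.n1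
    have hlen : s.hyps.length = P.callStart (r + 1) := by rw [h.len, callStart_succ]
    refine ⟨⟨?_, ?_, ?_, ?_, ?_, ?_⟩, ?_, ?_, ?_, ?_, ?_, ?_, ?_, ?_, ?_⟩
    · refine cst.congr (fun x hx => ?_) fun x hx => ?_
      · have hx7 : x < 7 := by simp at hx; omega
        have : x ≠ 7 := by omega
        simp [this, hs x hx7]
      · simpa using hsr x hx
    · intro q hq
      simp only [List.foldl, Instr.apply, State.setNat, arr2]
      rcases Nat.lt_succ_iff_lt_or_eq.mp hq with hq | rfl
      · exact I1.past.idx q hq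
      · exact I1.last
    · intro q hq l hl
      simp only [List.foldl, Instr.apply, State.setNat, flatWeights, hw5]
      rcases Nat.lt_succ_iff_lt_or_eq.mp hq with hq | rfl
      · rw [if_neg, hist_wt_stable P AL ω (show q < r + 1 by omega), ← hist_wt_stable P AL ω hq]
        · exact I1.past.wts q hq l hl
        · have := rowStart_add_lt (M := P.M) hq hl
          omega
      · have e : (hist P AL ω (q + 1)).wt q l = select St (2 * P.n) l := by
          simp [hist, nextHist, hSt]
        rw [e]
        split_ifs with hl'
        · rw [show l = l0 by omega]
        · rw [I1.past.wz _ (by omega), gz l hl (by omega)]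
    · intro a ha
      rw [rowStart_succ] at ha
      simp only [List.foldl, Instr.apply, State.setNat, hw5]
      rw [if_neg (by omega), I1.past.wz _ (by omega)]
    · intro q hq
      simp only [List.foldl, Instr.apply, State.setNat, hyp4]
      rcases Nat.lt_succ_iff_lt_or_eq.mp hq with hq' | rfl
      · rw [hist_hyp P AL ω hq, ← hist_hyp P AL ω hq', ← hyp1]
        exact I1.past.hyps q hq'
      · rw [hist_hyp P AL ω hq]
        exact h.cand
    · simp only [List.foldl, Instr.apply, State.setNat, hyp4, hlen, le_refl]
    · simp [n7', n1']
    · have : s4.nat 8 = P.callStart (r + 1) := by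
        rw [F4.nat 8 rfl, e3, callStart_succ]
        simp [F2.nat 8 rfl, e1, h.n8]
      simpa using this
    · have : s4.real 6 = P.callStart (r + 1) := by
        rw [F4.real 6 rfl, e3, callStart_succ]
        simp [F2.real 6 rfl, e1, h.r6]
      simpa using this
    · have : s4.nat 10 = rowStart P.M (r + 1) := by
        rw [F4.nat 10 rfl, e3, rowStart_succ]
        simp [n10, n17, hL]
      simpa using this
    · simpa using e4
    · have : s4.nat 17 = L := by
        rw [F4.nat 17 rfl, e3]
        simp [n17]
      simpa using this
    · intro q hq
      simp only [List.foldl, Instr.apply, State.setNat, arr2]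
      exact I1.blank q (by omega)
    · simp [hyp4, hlen]
    · have : s4.examples = s.examples := by rw [F4.examples, e3]; simp [F2.examples, e1]
      simp only [List.foldl, Instr.apply, State.setNat, this, h.ex, Params.exStart]
      ring

/-- The time of a round. -/
def roundTime (P : Params) (B : ℕ) : ℕ :=
  8 * P.n + 21 * P.R + P.N * (P.M + 2) * (roundEval P B + 13) + 40

theorem roundBody_runs {r B : ℕ} {s : State} (hA : A.relabel = relabelProg)
    (h : RoundStart P AL ω r s) (hr : r < P.N) (hn : 0 < P.n)
    (hB : P.callStart P.N ≤ B) (hW : ((roundEval P B + 20 : ℕ) : ℝ) ≤ W) :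
    Runs (Op.step A AL W ω) roundBody s (roundTime P B) (RoundStart P AL ω (r + 1)) := by
  have hBr : P.callStart r ≤ B := (callStart_mono P hr.le).trans hB
  refine Runs.mono (T := 9 + ((P.n * 7 + 1) + (1 + (5 + ((P.R * 21 + 1) +
    ((r + 1) * (P.M + 2) * (roundEval P B + 12 + 1) + 17)))))) ?_ ?_ fun _ h => h
  swap
  · have : (r + 1) * (P.M + 2) * (roundEval P B + 12 + 1) ≤
        P.N * (P.M + 2) * (roundEval P B + 13) := by
      gcongr
      exact hr
    rw [roundTime]
    omega
  refine Runs.liftOpsSeq fun s1 e1 => ?_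
  have c0 := h.past.consts
  refine Runs.seq (drawLoop_runs (r := P.exStart r) (n := P.n) ?_ ?_ ?_ ?_ ?_ ?_) ?_
  · simp [e1, c0.n1]
  · simp [e1, c0.n6]
  · simp [e1, c0.r8]
  · simp [e1]
  · simp [e1]
  · simp [e1, h.ex]
  rintro s2 ⟨⟨f4, fe, fh, f0, f1⟩, F2⟩
  have hyp1 : s1.hyps = s.hyps := by simp [e1]
  have hyp2 : s2.hyps = s.hyps := fh.trans hyp1
  have cn : ∀ x ∈ [0, 1, 2, 3, 4, 5, 6], s2.nat x = s.nat x := by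
    intro x hx
    simp only [List.mem_cons, List.not_mem_nil, or_false] at hx
    rcases hx with rfl | rfl | rfl | rfl | rfl | rfl | rfl <;> rw [F2.nat _ rfl] <;> simp [e1]
  have cr : ∀ x ∈ [3, 7, 8], s2.real x = s.real x := by
    intro x hx
    simp only [List.mem_cons, List.not_mem_nil, or_false] at hx
    rcases hx with rfl | rfl | rfl <;> rw [F2.real _ rfl] <;> simp [e1]
  have a2 : s2.arr 2 = s.arr 2 := by rw [F2.arr 2 rfl]; simp [e1]
  have a5 : s2.arr 5 = s.arr 5 := by rw [F2.arr 5 rfl]; simp [e1]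
  have I2 : InRound P AL ω r 0 s2 := by
    refine ⟨h.past.congr cn cr a5 (fun q _ => by rw [a2]) ⟨[], by simp [hyp2]⟩,
      ?_, ?_, ?_, ?_, ?_, ?_, f4, ?_, ?_, f0, f1⟩
    · rw [F2.nat 7 rfl]; simp [e1, h.n7]
    · rw [F2.nat 10 rfl]; simp [e1, h.n10]
    · rw [F2.nat 11 rfl]; simp [e1, h.n11]
    · rw [F2.nat 15 rfl]; simp [e1, h.n7, c0.n1]
    · rw [F2.nat 16 rfl]; simp [e1, c0.n0, c0.n6]
    · rw [F2.nat 17 rfl]; simp [e1, h.n17, c0.n3]; ring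
    · simp [a2, h.blank r le_rfl]
    · intro q hq; simp [a2, h.blank q hq.le]
  have len2 : s2.hyps.length = P.callStart r := by rw [hyp2, h.len]
  have r9 : s2.real 9 = 0 := by rw [F2.real 9 rfl]; simp [e1]
  refine Runs.callSeq _ (hA ▸ relabelProg_fetch I2 (B := B) r9 hr (by omega) hBr hn hW)
    fun s3 e3 => ?_
  rw [len2] at e3
  change s3 = { s2 with hyps := s2.hyps ++
    [fetchHyp P AL ω (curPred P AL ω r) (P.callStart r)] } at e3
  refine Runs.liftOpsSeq fun s4 e4 => ?_
  have c2 := I2.past.consts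
  have n8 : s2.nat 8 = P.callStart r := by rw [F2.nat 8 rfl]; simp [e1, h.n8]
  have r6 : s2.real 6 = P.callStart r := by rw [F2.real 6 rfl]; simp [e1, h.r6]
  have n12 : s2.nat 12 = 0 := by rw [F2.nat 12 rfl]; simp [e1]
  have n13 : s2.nat 13 = 0 := by rw [F2.nat 13 rfl]; simp [e1]
  have hS : Searching P AL ω r 0 s4 := by
    refine ⟨⟨0, ?_, I2.congr (by simp [e4, e3]) (by simp [e4, e3]) (by simp [e4, e3])
      (by simp [e4, e3]) (by simp [e4, e3]) (by simp [e4, e3])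
      (by simpa [e4, e3] using I2.last) ⟨[fetchHyp P AL ω (curPred P AL ω r) (P.callStart r)],
        by simp [e4, e3]⟩⟩, ?_, ?_, ?_, ?_, ?_, ?_, ?_, ?_, ?_⟩
    · rw [callStart_succ]; omega
    · simp [e4, e3, n8, c2.n1]
    · simp [e4, e3, r6, c2.r8]
    · simp [e4, e3, n8, c2.n0, walk]
    · simp [e4, e3, r6, c2.r7, walk]
    · simp [e4, e3, n13, walk]
    · simp [e4, e3, n12]
    · simp [e4, e3, len2]
    · simp only [e4, e3, List.foldl, Instr.apply, State.setNat, State.setReal, walk]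
      rw [List.getD_append_right _ _ _ _ len2.le, len2]
      simp
    · simp [e4, e3, fe]
  refine Runs.seq (walkLoop_runs hA hS hr hn hB hW) fun s5 h5 => ?_
  exact (decideProg_runs h5 hr hB).liftOp.mono le_rfl fun _ h => h.1

end Decide

end Omniprediction

end

noncomputable section

namespace Omniprediction

set_option linter.unusedSimpArgs false

attribute [local simp] Instr.apply State.setNat State.setReal Function.update_apply

/-! ### Computation of the parameters -/

/-- The inverse grid width. -/
def gridSize (ε : ℝ) : ℕ := ⌈42 / ε⌉₊

/-- The least `k` such that `2⁻ᵏ ≤ δ`. -/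
def halvings (δ : ℝ) : ℕ := sInf {k : ℕ | (1 / 2 : ℝ) ^ k ≤ δ}

/-- The parameters for grid width `1 / M` and confidence `2⁻ᴸ`. -/
def paramsOf (M L : ℕ) : Params where
  M := M
  N := 50 * (M * M)
  R := 10 * L
  n := 50 * (M * M) * (50 * (M * M)) * (10 * L)

/-- The parameters for accuracy `ε` and confidence `δ`. -/
def params (ε δ : ℝ) : Params := paramsOf (gridSize ε) (halvings δ + 1)

theorem halvings_spec {δ : ℝ} (hδ : 0 < δ) : (1 / 2 : ℝ) ^ halvings δ ≤ δ := by
  obtain ⟨k, hk⟩ := exists_pow_lt_of_lt_one hδ (show (1 / 2 : ℝ) < 1 by norm_num)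
  exact Nat.sInf_mem (s := {k : ℕ | (1 / 2 : ℝ) ^ k ≤ δ}) ⟨k, hk.le⟩

theorem lt_of_lt_halvings {δ : ℝ} {k : ℕ} (hk : k < halvings δ) : δ < (1 / 2 : ℝ) ^ k :=
  not_le.mp fun h => Nat.notMem_of_lt_sInf hk h

/-- Indices cannot be multiplied by a single operation; the product is a repeated sum. -/
def mulLoop (i a b c : ℕ) : Cmd Instr :=
  .loop (.natLt c a) (ops [.natAdd i i b, .natAdd c c 1])

/-- `M` is the number of times `ε` must be added to reach 42. Register 31 starts at 1 and counts
halvings of 1 until `δ` is reached, so it ends one above their number. Short addition chains give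
the factors 10 and 50. -/
def setupProg : Cmd Instr :=
  block [
    ops [.natConst 1 1, .realConst 8 1, .realConst 11 42],
    .loop (.realLt 10 11) (ops [.realAdd 10 10 0, .natAdd 30 30 1, .realAdd 3 3 8]),
    ops [.natAdd 2 30 1, .natAdd 3 2 1, .natConst 31 1, .realConst 12 1, .realConst 13 (1 / 2)],
    .loop (.realLt 1 12) (ops [.realMul 12 12 13, .natAdd 31 31 1]),
    mulLoop 32 30 30 33,
    ops [.natAdd 5 31 31, .natAdd 5 5 5, .natAdd 5 5 31, .natAdd 5 5 5,
      .natAdd 4 32 32, .natAdd 4 4 32, .natAdd 4 4 4, .natAdd 4 4 4, .natAdd 4 4 4, .natAdd 4 4 32,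
      .natAdd 4 4 4],
    mulLoop 34 4 4 35,
    mulLoop 6 34 5 36]

theorem mulLoop_runs {i a b c x y : ℕ} {s : State} (h1 : s.nat 1 = 1) (ha : s.nat a = x)
    (hb : s.nat b = y) (hc : s.nat c = 0) (hi : s.nat i = 0) (hi1 : i ≠ 1) (hc1 : c ≠ 1)
    (hia : i ≠ a) (hib : i ≠ b) (hca : c ≠ a) (hcb : c ≠ b) (hic : i ≠ c) :
    Runs detStep (mulLoop i a b c) s (x * 4 + 1) (fun s' => s'.nat i = x * y) := by
  refine (Runs.loopFrame (T := 3) x (fun k s' => s'.nat c = k ∧ s'.nat i = k * y)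
    ⟨hc, by simpa using hi⟩ ?_ ?_).mono le_rfl fun s' h => h.1.2
  · rintro k hk s' hF ⟨g1, g2⟩
    have e1 := (hF.nat 1 (by simp [ops, Cmd.anyOp, Instr.writesNat, hi1, hc1])).trans h1
    have ea := (hF.nat a (by simp [ops, Cmd.anyOp, Instr.writesNat, hia, hca])).trans ha
    have eb := (hF.nat b (by simp [ops, Cmd.anyOp, Instr.writesNat, hib, hcb])).trans hb
    refine ⟨by simpa [Test.holds, g1, ea] using hk, Runs.ops _ _ ?_⟩
    simp [g1, g2, e1, eb, hic, hic.symm, hi1.symm, hc1.symm]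
    ring
  · rintro s' hF ⟨g1, -⟩
    have ea := (hF.nat a (by simp [ops, Cmd.anyOp, Instr.writesNat, hia, hca])).trans ha
    simp [Test.holds, g1, ea]

/-- The time for the computation of the parameters. -/
def setupTime (P : Params) (L : ℕ) : ℕ := 9 * P.M + 4 * L + 4 * P.N + 4 * (P.N * P.N) + 40

theorem setupProg_runs {ε δ : ℝ} (hε : 0 < ε) (hδ : 0 < δ) :
    Runs detStep setupProg (initState ε δ) (setupTime (params ε δ) (halvings δ))
      (fun s => Consts (params ε δ) s ∧ Frame setupProg (initState ε δ) s) := by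
  refine Runs.frame ?_
  set M := gridSize ε with hM
  set k0 := halvings δ with hk0
  refine Runs.mono (T := 4 + ((M * 5 + 1) + (6 + ((k0 * 4 + 1) + ((M * 4 + 1) + (12 +
    ((50 * (M * M) * 4 + 1) + (50 * (M * M) * (50 * (M * M)) * 4 + 1)))))))) ?_ ?_ fun _ h => h
  swap
  · simp only [setupTime, params, paramsOf, ← hM]
    omega
  refine Runs.opsSeq fun s1 e1 => ?_
  refine Runs.frameSeq (P := fun s => s.nat 30 = M ∧ s.real 3 = M) ?_ fun s2 h2 F2 => ?_
  · refine (Runs.loopFrame (T := 4) M (fun k s' => s'.real 10 = k * ε ∧ s'.nat 30 = k ∧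
      s'.real 3 = k) ?_ ?_ ?_).mono le_rfl fun s' h => h.1.2
    · simp [e1, initState]
    · rintro k hk s' hF ⟨g1, g2, g3⟩
      have e0 : s'.real 0 = ε := (hF.real 0 rfl).trans (by simp [e1, initState])
      have e8 : s'.real 8 = 1 := (hF.real 8 rfl).trans (by simp [e1, initState])
      have e11 : s'.real 11 = 42 := (hF.real 11 rfl).trans (by simp [e1, initState])
      have en1 : s'.nat 1 = 1 := (hF.nat 1 rfl).trans (by simp [e1, initState])
      refine ⟨?_, Runs.ops _ _ ?_⟩
      · have := Nat.lt_ceil.mp hk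
        rw [lt_div_iff₀ hε] at this
        simpa [Test.holds, g1, e11] using this
      · simp [g1, g2, g3, e0, e8, en1]
        ring
    · rintro s' hF ⟨g1, -⟩
      have e11 : s'.real 11 = 42 := (hF.real 11 rfl).trans (by simp [e1, initState])
      have := Nat.le_ceil (42 / ε)
      rw [div_le_iff₀ hε] at this
      rw [Test.holds, g1, e11]
      exact not_lt.mpr this
  refine Runs.opsSeq fun s3 e3 => ?_
  have c2 : s2.nat 1 = 1 := (F2.nat 1 rfl).trans (by simp [e1, initState])
  refine Runs.frameSeq (P := fun s => s.nat 31 = k0 + 1) ?_ fun s4 h4 F4 => ?_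
  · refine (Runs.loopFrame (T := 3) k0 (fun k s' => s'.real 12 = (1 / 2) ^ k ∧ s'.nat 31 = k + 1)
      ?_ ?_ ?_).mono le_rfl fun s' h => h.1.2
    · simp [e3]
    · rintro k hk s' hF ⟨g1, g2⟩
      have e1' : s'.real 1 = δ := (hF.real 1 rfl).trans
        (by simp [e3, F2.real 1 rfl]; simp [e1, initState])
      have e13 : s'.real 13 = 1 / 2 := (hF.real 13 rfl).trans (by simp [e3])
      have en1 : s'.nat 1 = 1 := (hF.nat 1 rfl).trans (by simp [e3, c2])
      refine ⟨?_, Runs.ops _ _ ?_⟩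
      · have := lt_of_lt_halvings hk
        simpa [Test.holds, g1, e1'] using this
      · simp [g1, g2, e13, en1, pow_succ]
    · rintro s' hF ⟨g1, -⟩
      have e1' : s'.real 1 = δ := (hF.real 1 rfl).trans
        (by simp [e3, F2.real 1 rfl]; simp [e1, initState])
      have := halvings_spec hδ
      simpa [Test.holds, g1, e1'] using this
  have n30 : s4.nat 30 = M := (F4.nat 30 rfl).trans (by simp [e3, h2.1])
  have n1 : s4.nat 1 = 1 := (F4.nat 1 rfl).trans (by simp [e3, c2])
  have z4 : ∀ i, 32 ≤ i → s4.nat i = 0 := by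
    intro i hi
    have h30 : i ≠ 30 := by omega
    have h31 : i ≠ 31 := by omega
    have h2' : i ≠ 2 := by omega
    have h3' : i ≠ 3 := by omega
    have h1' : i ≠ 1 := by omega
    rw [F4.nat i (by simp [ops, Cmd.anyOp, Instr.writesNat, h31.symm]), e3]
    simp [h31, h2', h3']
    rw [F2.nat i (by simp [ops, Cmd.anyOp, Instr.writesNat, h30.symm])]
    simp [e1, h1', initState]
  refine Runs.frameSeq (mulLoop_runs (x := M) (y := M) n1 n30 n30 (z4 _ (by norm_num))
    (z4 _ (by norm_num)) (by norm_num) (by norm_num) (by norm_num) (by norm_num) (by norm_num)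
    (by norm_num) (by norm_num)) fun s5 h5 F5 => ?_
  refine Runs.opsSeq fun s6 e6 => ?_
  have n4 : s6.nat 4 = 50 * (M * M) := by simp [e6, h5]; ring
  have n31 : s5.nat 31 = k0 + 1 := (F5.nat 31 rfl).trans h4
  have n5 : s6.nat 5 = 10 * (k0 + 1) := by simp [e6, n31]; ring
  have n1' : s6.nat 1 = 1 := by simp [e6, F5.nat 1 rfl, n1]
  refine Runs.frameSeq (mulLoop_runs (x := 50 * (M * M)) (y := 50 * (M * M)) n1' n4 n4 ?_ ?_
    (by norm_num) (by norm_num) (by norm_num) (by norm_num) (by norm_num)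
    (by norm_num) (by norm_num)) fun s7 h7 F7 => ?_
  · simp [e6, F5.nat 35 rfl, z4]
  · simp [e6, F5.nat 34 rfl, z4]
  have n5' : s7.nat 5 = 10 * (k0 + 1) := (F7.nat 5 rfl).trans n5
  have z6 : s4.nat 6 = 0 := by
    rw [F4.nat 6 rfl, e3]; simp [F2.nat 6 rfl, e1, initState]
  refine (mulLoop_runs (x := 50 * (M * M) * (50 * (M * M))) (y := 10 * (k0 + 1)) ?_ h7 n5' ?_ ?_
    (by norm_num) (by norm_num) (by norm_num) (by norm_num) (by norm_num)
    (by norm_num) (by norm_num)).frame.mono le_rfl ?_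
  · exact (F7.nat 1 rfl).trans n1'
  · rw [F7.nat 36 rfl, e6]; simp [F5.nat 36 rfl, z4]
  · rw [F7.nat 6 rfl, e6]; simp [F5.nat 6 rfl, z6]
  rintro s8 ⟨h8, F8⟩
  refine ⟨?_, ?_, ?_, ?_, ?_, ?_, ?_, ?_, ?_, ?_⟩
  · rw [F8.nat 0 rfl, F7.nat 0 rfl, e6]
    simp [F5.nat 0 rfl, F4.nat 0 rfl, e3, F2.nat 0 rfl, e1, initState]
  · rw [F8.nat 1 rfl, F7.nat 1 rfl, n1']
  · rw [F8.nat 2 rfl, F7.nat 2 rfl, e6]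
    simp [F5.nat 2 rfl, F4.nat 2 rfl, e3, h2.1, c2, params, paramsOf, ← hM]
  · rw [F8.nat 3 rfl, F7.nat 3 rfl, e6]
    simp [F5.nat 3 rfl, F4.nat 3 rfl, e3, h2.1, c2, params, paramsOf, ← hM]
  · rw [F8.nat 4 rfl, F7.nat 4 rfl, n4]; rfl
  · rw [F8.nat 5 rfl, n5']; rfl
  · exact h8
  · rw [F8.real 3 rfl, F7.real 3 rfl, e6]
    simp [F5.real 3 rfl, F4.real 3 rfl, e3, h2.2, params, paramsOf, ← hM]
  · rw [F8.real 7 rfl, F7.real 7 rfl, e6]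
    simp [F5.real 7 rfl, F4.real 7 rfl, e3, F2.real 7 rfl, e1, initState]
  · rw [F8.real 8 rfl, F7.real 8 rfl, e6]
    simp [F5.real 8 rfl, F4.real 8 rfl, e3, F2.real 8 rfl, e1, initState]

/-! ### The algorithm -/

/-- Omniprediction from agnostic learning. -/
def omnipredict : Algorithm where
  main := .seq setupProg.lift (.loop (.natLt 7 4) roundBody)
  relabel := relabelProg
  predict := predictProg

/-! ### Correctness of the program on every tape. -/

section Outputs

variable {P : Params} {S : Type u} [MeasurableSpace S] {AL : Learner S}
  {ω : Tape AL.sampleSize S} {W : ℝ}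

theorem best_lt (r : ℕ) (hr : 0 < r) : best P AL ω r < r := by
  induction r with
  | zero => omega
  | succ r ih =>
    rw [best]
    split_ifs
    · omega
    · rcases Nat.eq_zero_or_pos r with rfl | h
      · simp [best]
      · have := ih h; omega

theorem predictProg_evaluates {s : State} {B : ℕ} (h : RoundStart P AL ω P.N s) (hN : 0 < P.N)
    (hM : 0 < P.M) (hn : 0 < P.n) (hB : P.callStart P.N ≤ B)
    (hW : ((roundEval P B + 20 : ℕ) : ℝ) ≤ W) :
    Evaluates predictProg W s (output P AL ω) := by
  intro p
  set b := best P AL ω P.N with hb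
  have hbN : b + 1 ≤ P.N := best_lt P.N hN
  have c := h.past.consts
  have key : Runs detStep predictProg (s.setReal 0 p) (roundEval P B + 20)
      (fun s' => s'.real 0 = output P AL ω p) := by
    have hev := evalTime_mono (M := P.M) (B := B) hbN (show 1 ≤ P.n from hn)
    refine Runs.mono (T := 5 + (evalTime P.M B (b + 1) 1 + 2)) ?_
      (by simp only [roundEval]; omega) fun _ h => h
    refine Runs.opsSeq fun s1 e1 => ?_
    have pre : EvalPre P.M B (b + 1) 1 0 (roundIdx P AL ω) s1 := by
      refine ⟨?_, ?_, ?_, ?_, ?_, ?_, ?_, ?_, ?_, fun q hq => ⟨?_, ?_⟩, by positivity⟩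
      · simp [e1, c.n0]
      · simp [e1, c.n1]
      · simp [e1, c.n2]
      · simp [e1, h.n11, c.n1, ← hb]
      · simp [e1]
      · simp [e1]
      · simp [e1, c.r3]
      · simp [e1, c.r7]
      · simp [e1, c.r8]
      · simp [e1, h.past.idx q (by omega)]
      · exact (roundIdx_lt P AL ω q).le.trans ((callStart_mono P (by omega)).trans hB)
    refine Runs.frameSeq (evalProg_runs pre) fun s2 f2 F2 => Runs.ops _ _ ?_
    have hv : evalVal P.M (roundIdx P AL ω) s1 (b + 1) 0 =
        (hist P AL ω P.N).val P.M (b + 1) p := by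
      refine rowsVal_congr (fun q hq l hl => ?_) fun q hq => ?_
      · have := h.past.wts q (by omega) l hl
        simpa [e1] using this
      · rw [← h.past.hyps q (by omega)]
        simp [e1, hypVal, lab, clip_coe]
    have r24 := f2.2 one_pos
    rw [Nat.sub_self, hv] at r24
    have r3 : s2.real 3 = P.M := by simp [F2.real 3 rfl, e1, c.r3]
    simp only [List.foldl, Instr.apply, State.setReal, Function.update_self, r24, r3]
    rw [output, clip, Set.coe_projIcc, ← hb]
    have hm := rowsVal_mem P.M (hist P AL ω P.N).wt
      (fun q => lab ((hist P AL ω P.N).hyp q p)) (b + 1)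
    have hM' : (0 : ℝ) < P.M := by exact_mod_cast hM
    rw [Hist.pred, Hist.val]
    rw [min_eq_right ((div_le_one hM').mpr hm.2), max_eq_right (div_nonneg hm.1 hM'.le)]
  obtain ⟨t, s', h1, h2, h3⟩ := key
  exact ⟨t, s', le_trans (by exact_mod_cast h1) hW, h2, h3⟩

/-- The total time. -/
def totalTime (P : Params) (L : ℕ) : ℕ :=
  setupTime P L + (P.N * (roundTime P (P.callStart P.N) + 1) + 1)

theorem omnipredict_outputs {ε δ : ℝ} (hε : 0 < ε) (hδ : 0 < δ) {N : ℝ}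
    (hP : P = params ε δ) (hW : ((totalTime P (halvings δ) : ℕ) : ℝ) ≤ W)
    (hN : (P.callStart P.N : ℝ) ≤ N) :
    omnipredict.Outputs AL N W ε δ ω (output P AL ω) := by
  have hM : 0 < P.M := by
    rw [hP]; exact Nat.ceil_pos.mpr (by positivity)
  have hP' : P = paramsOf P.M (halvings δ + 1) := by rw [hP]; rfl
  have hNp : 0 < P.N := by rw [hP']; simp [paramsOf]; omega
  have hn : 0 < P.n := by rw [hP']; simp [paramsOf]; omega
  set B := P.callStart P.N with hB
  -- One evaluation takes less time than the whole run, so a single bound serves for the main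
  -- program and both subroutines.
  have hE : roundEval P B + 20 ≤ totalTime P (halvings δ) := by
    have h1 : roundEval P B + 13 ≤ P.N * (P.M + 2) * (roundEval P B + 13) :=
      Nat.le_mul_of_pos_left _ (by positivity)
    have h2 : roundTime P B + 1 ≤ P.N * (roundTime P B + 1) := Nat.le_mul_of_pos_left _ hNp
    have h3 : P.N * (P.M + 2) * (roundEval P B + 13) + 40 ≤ roundTime P B := by
      rw [roundTime]; omega
    rw [totalTime, ← hB]
    omega
  have hWE : ((roundEval P B + 20 : ℕ) : ℝ) ≤ W := le_trans (by exact_mod_cast hE) hW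
  have main : Runs (Op.step omnipredict AL W ω) omnipredict.main (initState ε δ)
      (totalTime P (halvings δ)) (RoundStart P AL ω P.N) := by
    rw [totalTime, hP]
    refine Runs.seq (setupProg_runs hε hδ).liftOp ?_
    rw [← hP]
    rintro s ⟨⟨h1, F⟩, -⟩
    refine Runs.loop (T := roundTime P B) P.N (fun r s => RoundStart P AL ω r s) ?_ ?_ ?_
    · refine ⟨⟨h1, by simp, by simp, ?_, by simp, by simp [Params.callStart]⟩, ?_, ?_, ?_, ?_, ?_,
        ?_, ?_, ?_, ?_⟩
      · intro a _; rw [F.arr 5 rfl]; rfl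
      · rw [F.nat 7 rfl]; rfl
      · rw [F.nat 8 rfl]; simp [initState, Params.callStart]
      · rw [F.real 6 rfl]; simp [initState, Params.callStart]
      · rw [F.nat 10 rfl]; simp [initState, rowStart]
      · rw [F.nat 11 rfl]; rfl
      · rw [F.nat 17 rfl]; simp [initState]
      · intro q _; rw [F.arr 2 rfl]; rfl
      · rw [F.hyps]; simp [initState, Params.callStart]
      · rw [F.examples]; simp [initState, Params.exStart]
    · intro r hr s hs
      refine ⟨by simpa [Test.holds, hs.n7, hs.past.consts.n4] using hr, ?_⟩
      exact roundBody_runs rfl hs hr hn le_rfl hWE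
    · intro s hs
      simp [Test.holds, hs.n7, hs.past.consts.n4]
  obtain ⟨t, s, h1, h2, h3⟩ := main
  refine ⟨t, s, h2, le_trans (by exact_mod_cast h1) hW, ?_,
    predictProg_evaluates h3 hNp hM hn le_rfl hWE⟩
  rw [h3.len]
  exact hN

end Outputs

/-! ### Bounds for the running time -/

theorem calls_le {M L : ℕ} (hL : 1 ≤ L) :
    (paramsOf M L).callStart (paramsOf M L).N ≤ 1050 * (M ^ 2 * L) := by
  simp only [Params.callStart, paramsOf]
  calc 50 * (M * M) * (2 * (10 * L) + 1) ≤ 50 * (M * M) * (2 * (10 * L) + L) := by gcongr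
    _ = 1050 * (M ^ 2 * L) := by ring

/-- There are `O(M²)` rows with `O(M³)` weights each, so a prediction costs `O(M⁵)`, and `O(M⁹ L)`
over the `O(M⁴ L)` test points. This is done for `O(M³)` features in each of `O(M²)` rounds. The
dependence on `L` stays linear because the cost of decoding, also linear in `L`, is added to the
number of test points and not multiplied by it. -/
theorem totalTime_le {M L : ℕ} (hM : 1 ≤ M) (hL : 1 ≤ L) :
    totalTime (paramsOf M L) L ≤ 10 ^ 14 * (M ^ 14 * L) := by
  set P := paramsOf M L with hP
  set B := P.callStart P.N with hB
  have hBle : B ≤ 1050 * (M ^ 2 * L) := calls_le hL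
  have pw : ∀ a b : ℕ, a ≤ b → M ^ a * L ≤ M ^ b * L := fun a b h =>
    Nat.mul_le_mul_right _ (Nat.pow_le_pow_right hM h)
  have pw' : ∀ a b : ℕ, a ≤ b → M ^ a ≤ M ^ b := fun a b h => Nat.pow_le_pow_right hM h
  have one : ∀ b : ℕ, 1 ≤ M ^ b * L := fun b => Nat.mul_pos (pow_pos hM b) hL
  have hN : P.N = 50 * M ^ 2 := by simp only [hP, paramsOf]; ring
  have hn : P.n = 25000 * (M ^ 4 * L) := by simp only [hP, paramsOf]; ring
  have hR : P.R = 10 * L := rfl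
  have hPM : P.M = M := rfl
  have hM1 : (M ^ 1 : ℕ) = M := pow_one M
  have E : roundEval P B ≤ 2 * 10 ^ 9 * (M ^ 9 * L) := by
    rw [roundEval, evalTime, hN, hn, hPM]
    have h1 : B * 4 + 25000 * (M ^ 4 * L) * 7 + 20 ≤ 180000 * (M ^ 4 * L) := by
      have := pw 2 4 (by norm_num); have := one 4; linarith
    have h2 : 50 * M ^ 2 * ((M + 1) * 9 + 50 * M ^ 2 * (M + 2) * 8 + 30) + 20 ≤
        70000 * M ^ 5 := by
      have h3 : (M + 1) * 9 + 50 * M ^ 2 * (M + 2) * 8 + 30 ≤ 1300 * M ^ 3 := by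
        have e : 50 * M ^ 2 * (M + 2) * 8 = 400 * M ^ 3 + 800 * M ^ 2 := by ring
        have := pw' 2 3 (by norm_num); have := pw' 1 3 (by norm_num)
        have := pw' 0 3 (by norm_num)
        rw [e]; linarith
      have h4 := Nat.mul_le_mul_left (50 * M ^ 2) h3
      have e : 50 * M ^ 2 * (1300 * M ^ 3) = 65000 * M ^ 5 := by ring
      have := pw' 0 5 (by norm_num)
      linarith
    have h3 := Nat.mul_le_mul_left (50 * M ^ 2) h1
    have h4 := Nat.mul_le_mul_left (25000 * (M ^ 4 * L)) h2
    have e3 : 50 * M ^ 2 * (180000 * (M ^ 4 * L)) = 9000000 * (M ^ 6 * L) := by ring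
    have e4 : 25000 * (M ^ 4 * L) * (70000 * M ^ 5) = 1750000000 * (M ^ 9 * L) := by ring
    have := pw 6 9 (by norm_num); have := one 9
    linarith
  have T : roundTime P B ≤ 4 * 10 ^ 11 * (M ^ 12 * L) := by
    rw [roundTime, hN, hn, hR, hPM]
    have h1 : 50 * M ^ 2 * (M + 2) ≤ 150 * M ^ 3 := by
      have e : 50 * M ^ 2 * (M + 2) = 50 * M ^ 3 + 100 * M ^ 2 := by ring
      have := pw' 2 3 (by norm_num); linarith
    have h2 : roundEval P B + 13 ≤ 2100000000 * (M ^ 9 * L) := by have := one 9; linarith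
    have h3 := Nat.mul_le_mul h1 h2
    have e3 : 150 * M ^ 3 * (2100000000 * (M ^ 9 * L)) = 315000000000 * (M ^ 12 * L) := by ring
    have := pw 4 12 (by norm_num); have := pw 0 12 (by norm_num); have := one 12
    linarith
  rw [totalTime, setupTime, ← hB, hN, hPM]
  have h1 : 50 * M ^ 2 * (roundTime P B + 1) ≤ 50 * M ^ 2 * (5 * 10 ^ 11 * (M ^ 12 * L)) := by
    refine Nat.mul_le_mul_left _ ?_
    have := one 12; linarith
  have e1 : 50 * M ^ 2 * (5 * 10 ^ 11 * (M ^ 12 * L)) = 25 * 10 ^ 12 * (M ^ 14 * L) := by ring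
  have e2 : 50 * M ^ 2 * (50 * M ^ 2) = 2500 * M ^ 4 := by ring
  have l1 : ∀ a, a ≤ 14 → M ^ a ≤ M ^ 14 * L := fun a ha =>
    (pw' a 14 ha).trans (Nat.le_mul_of_pos_right _ hL)
  have := l1 1 (by norm_num); have := l1 2 (by norm_num); have := l1 4 (by norm_num)
  have := pw 0 14 (by norm_num); have := one 14
  linarith

theorem gridSize_le {ε : ℝ} (hε : 0 < ε) (hε1 : ε < 1) : (gridSize ε : ℝ) ≤ 43 * (1 / ε) := by
  have h1 := (Nat.ceil_lt_add_one (show 0 ≤ 42 / ε by positivity)).le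
  have h2 : 1 ≤ 1 / ε := by rw [le_div_iff₀ hε]; linarith
  have h3 : 42 / ε = 42 * (1 / ε) := by ring
  rw [gridSize]
  linarith

theorem le_gridSize_mul {ε : ℝ} (hε : 0 < ε) : 42 ≤ gridSize ε * ε := by
  rw [← div_le_iff₀ hε]; exact Nat.le_ceil _

theorem halvings_le {δ : ℝ} (hδ : 0 < δ) (hδ1 : δ < 1) :
    ((halvings δ + 1 : ℕ) : ℝ) ≤ 3 * Real.log (2 / δ) := by
  have hl2 := Real.log_two_gt_d9
  have e : Real.log (2 / δ) = Real.log 2 - Real.log δ := Real.log_div (by norm_num) hδ.ne'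
  have hlog : Real.log δ < 0 := Real.log_neg hδ hδ1
  rcases Nat.eq_zero_or_pos (halvings δ) with h | h
  · rw [h, e]; norm_num; linarith
  · have h1 := lt_of_lt_halvings (show halvings δ - 1 < halvings δ by omega)
    have h2 := Real.log_lt_log hδ h1
    rw [Real.log_pow, one_div, Real.log_inv, Nat.cast_sub h] at h2
    rw [e]
    push_cast at h2 ⊢
    have h3 : (1 : ℝ) ≤ halvings δ := by exact_mod_cast h
    -- With `h` halvings, `log 2 - log δ > h log 2`, and `3 h log 2 > 2 h ≥ h + 1`.
    nlinarith

end Omniprediction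

end

noncomputable section

namespace Omniprediction

/-! ### Proper losses -/

open Classical in
/-- The sign function of a set of predictions. -/
def upSign (U : Set I) (q : I) : ℝ := if q ∈ U then 1 else -1

theorem outcome_mem (y : Bool) : 0 ≤ outcome y ∧ outcome y ≤ 1 := by
  cases y <;> simp [outcome]

theorem measurable_outcome : Measurable outcome := measurable_of_countable _

/-- The slope of a loss. -/
def slope (l : I → Bool → ℝ) (p : I) : ℝ := l p true - l p false

theorem loss_eq (l : I → Bool → ℝ) (p : I) (y : Bool) :
    l p y = l p false + outcome y * slope l p := by
  cases y <;> simp [outcome, slope]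

theorem IsProper.le {l : I → Bool → ℝ} (h : IsProper l) (p q : I) :
    l q false + q * slope l q ≤ l p false + q * slope l p := by
  have := h p q
  simp only [bernoulliMean, slope] at this ⊢
  linarith

/-- The sum of the optimality inequalities at `p` and at `q` is `(q - p)(slope q - slope p) ≤ 0`. -/
theorem IsProper.antitone {l : I → Bool → ℝ} (h : IsProper l) : Antitone (slope l) := by
  intro p q hpq
  rcases hpq.eq_or_lt with rfl | hlt
  · exact le_rfl
  have h1 := h.le p q
  have h2 := h.le q p
  have hlt' : (p : ℝ) < q := hlt
  nlinarith

theorem measurable_slope {l : I → Bool → ℝ} (h : IsProper l) : Measurable (slope l) :=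
  h.antitone.measurable

theorem abs_slope_le {l : I → Bool → ℝ} (h : l ∈ properLosses) (p : I) : |slope l p| ≤ 1 := h.2 p

/-- The Bayes risk is an infimum of affine functions with slopes in `[-1, 1]`. Its continuity yields
measurability and boundedness of the loss. -/
theorem lipschitz_bayes {l : I → Bool → ℝ} (h : l ∈ properLosses) :
    LipschitzWith 1 (fun q : I => l q false + q * slope l q) := by
  refine LipschitzWith.of_le_add fun q p => ?_
  have h1 := h.1.le p q
  have h2 := abs_slope_le h p
  have h3 : ((q : ℝ) - p) * slope l p ≤ |(q : ℝ) - p| := by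
    calc ((q : ℝ) - p) * slope l p ≤ |((q : ℝ) - p) * slope l p| := le_abs_self _
      _ = |(q : ℝ) - p| * |slope l p| := abs_mul _ _
      _ ≤ |(q : ℝ) - p| * 1 := by gcongr
      _ = _ := mul_one _
  have h4 : dist q p = |(q : ℝ) - p| := by rw [Subtype.dist_eq, Real.dist_eq]
  rw [h4]
  linarith

/-- No measurability of losses is assumed: it follows from properness, since a loss is assembled
from its continuous Bayes risk and its monotone slope. -/
theorem measurable_loss {l : I → Bool → ℝ} (h : l ∈ properLosses) :
    Measurable (fun x : I × Bool => l x.1 x.2) := by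
  have h1 : (fun x : I × Bool => l x.1 x.2) = fun x =>
      (l x.1 false + x.1 * slope l x.1) - x.1 * slope l x.1 + outcome x.2 * slope l x.1 := by
    funext x
    rw [loss_eq l x.1 x.2]
    ring
  rw [h1]
  have m1 : Measurable fun x : I × Bool => slope l x.1 := (measurable_slope h.1).comp measurable_fst
  have m2 : Measurable fun x : I × Bool => (x.1 : ℝ) := measurable_subtype_coe.comp measurable_fst
  have m3 : Measurable fun x : I × Bool => l x.1 false + (x.1 : ℝ) * slope l x.1 :=
    (lipschitz_bayes h).continuous.measurable.comp measurable_fst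
  exact (m3.sub (m2.mul m1)).add ((measurable_outcome.comp measurable_snd).mul m1)

theorem exists_loss_bound {l : I → Bool → ℝ} (h : l ∈ properLosses) :
    ∃ B, ∀ p y, |l p y| ≤ B := by
  obtain ⟨B, hB⟩ := isCompact_univ.exists_bound_of_continuousOn
    (lipschitz_bayes h).continuous.continuousOn
  refine ⟨B + 2, fun p y => ?_⟩
  have h1 := hB p (Set.mem_univ p)
  rw [Real.norm_eq_abs] at h1
  have h2 := abs_slope_le h p
  have h3 : |(outcome y - p) * slope l p| ≤ 2 := by
    rw [abs_mul]
    have h4 : |outcome y - (p : ℝ)| ≤ 2 := by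
      have := outcome_mem y
      rw [abs_le]
      constructor <;> linarith [p.2.1, p.2.2]
    nlinarith [abs_nonneg (outcome y - (p : ℝ)), abs_nonneg (slope l p)]
  have e : l p y = (l p false + p * slope l p) + (outcome y - p) * slope l p := by
    rw [loss_eq l p y]; ring
  rw [e]
  exact (abs_add_le _ _).trans (by linarith)

theorem integrable_of_abs_le {α : Type*} [MeasurableSpace α] {μ : Measure α} [IsFiniteMeasure μ]
    {f : α → ℝ} (hf : Measurable f) {B : ℝ} (hB : ∀ x, |f x| ≤ B) : Integrable f μ :=
  Integrable.of_bound hf.aestronglyMeasurable B (Filter.Eventually.of_forall hB)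

set_option linter.unusedSectionVars false

variable {J : Measure (I × Bool)} [IsProbabilityMeasure J]

theorem integrable_loss {l : I → Bool → ℝ} (h : l ∈ properLosses) {κ : I → I}
    (hκ : Measurable κ) : Integrable (fun x => l (κ x.1) x.2) J := by
  obtain ⟨B, hB⟩ := exists_loss_bound h
  exact integrable_of_abs_le ((measurable_loss h).comp
    ((hκ.comp measurable_fst).prodMk measurable_snd)) fun x => hB _ _

/-- Layer-cake formula: a number in `[-1, 1]` is an average of signs. It is applied to the slope of
a loss. -/
theorem integral_sign_sub {φ : ℝ} (h : |φ| ≤ 1) :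
    ∫ t in Set.Ioc (-1 : ℝ) 1, (if φ ≤ t then (1 : ℝ) else -1) = -2 * φ := by
  rw [abs_le] at h
  have e : (fun t : ℝ => if φ ≤ t then (1 : ℝ) else -1) =
      fun t => 2 * (Set.Ici φ).indicator (fun _ => (1 : ℝ)) t - 1 := by
    funext t
    by_cases ht : φ ≤ t <;> simp [ht]
    norm_num
  have hi : Integrable (fun t => (Set.Ici φ).indicator (fun _ => (1 : ℝ)) t)
      (volume.restrict (Set.Ioc (-1 : ℝ) 1)) :=
    (integrable_const 1).indicator measurableSet_Ici
  rw [e, integral_sub (hi.const_mul 2) (integrable_const 1), integral_const_mul,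
    integral_indicator_const _ measurableSet_Ici]
  have hv : (volume.restrict (Set.Ioc (-1 : ℝ) 1)).real (Set.Ici φ) = 1 - φ := by
    rw [measureReal_def, Measure.restrict_apply measurableSet_Ici]
    -- For `φ = -1` the two sets differ in the point -1.
    have h1 : volume (Set.Ici φ ∩ Set.Ioc (-1 : ℝ) 1) = volume (Set.Icc φ 1) := by
      apply measure_congr
      have : ∀ᵐ t : ℝ ∂volume, t ≠ -1 := by simp [ae_iff]
      filter_upwards [this] with t ht
      apply propext
      change (φ ≤ t ∧ (-1 < t ∧ t ≤ 1)) ↔ (φ ≤ t ∧ t ≤ 1)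
      constructor
      · rintro ⟨a, b, c⟩; exact ⟨a, c⟩
      · rintro ⟨a, c⟩; exact ⟨a, lt_of_le_of_ne (h.1.trans a) (Ne.symm ht), c⟩
    rw [h1, Real.volume_Icc, ENNReal.toReal_ofReal (by linarith)]
  rw [hv]
  simp
  ring

/-- If correlations with all upper level sets of `k` are small, then so are the correlations with
slopes of losses. -/
theorem integral_mul_slope_le {l : I → Bool → ℝ} (hl : l ∈ properLosses) {k : I → I}
    (hk : Measurable k) {a : I × Bool → ℝ} (ha : Measurable a) (ha1 : ∀ x, |a x| ≤ 1) {B : ℝ}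
    (hB : ∀ U : Set I, IsUpperSet U → ∫ x, a x * upSign U (k x.1) ∂J ≤ B) :
    -∫ x, a x * slope l (k x.1) ∂J ≤ B := by
  have mk : Measurable fun x : I × Bool => slope l (k x.1) :=
    (measurable_slope hl.1).comp (hk.comp measurable_fst)
  have e : ∀ x : I × Bool, -(a x * slope l (k x.1)) =
      ∫ t in Set.Ioc (-1 : ℝ) 1, 1 / 2 * (a x * (if slope l (k x.1) ≤ t then (1 : ℝ) else -1)) := by
    intro x
    rw [integral_const_mul, integral_const_mul, integral_sign_sub (abs_slope_le hl _)]
    ring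
  rw [← integral_neg]
  simp only [e]
  -- After exchanging the integrals, each threshold `t` contributes a correlation with a single
  -- level set.
  rw [integral_integral_swap]
  · have h1 : ∀ t ∈ Set.Ioc (-1 : ℝ) 1, ∫ x, 1 / 2 * (a x *
        (if slope l (k x.1) ≤ t then (1 : ℝ) else -1)) ∂J ≤ 1 / 2 * B := by
      intro t _
      rw [integral_const_mul]
      refine mul_le_mul_of_nonneg_left ?_ (by norm_num)
      -- This is where monotonicity of the slope, hence properness, enters.
      have hU : IsUpperSet {q : I | slope l q ≤ t} := fun p q hpq hp =>
        le_trans (hl.1.antitone hpq) hp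
      have := hB _ hU
      simpa [upSign] using this
    have h2 := setIntegral_mono_on_ae (μ := volume) (s := Set.Ioc (-1 : ℝ) 1)
      (f := fun t => ∫ x, 1 / 2 * (a x * (if slope l (k x.1) ≤ t then (1 : ℝ) else -1)) ∂J)
      (g := fun _ => 1 / 2 * B) ?_ (integrable_const _) measurableSet_Ioc
      (Filter.Eventually.of_forall h1)
    · refine h2.trans (le_of_eq ?_)
      simp
      norm_num
      ring
    · refine Integrable.of_bound (C := 1) ?_ (Filter.Eventually.of_forall fun t => ?_)
      · refine (StronglyMeasurable.integral_prod_right (f := fun t x => 1 / 2 * (a x *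
          (if slope l (k x.1) ≤ t then (1 : ℝ) else -1))) ?_).aestronglyMeasurable
        refine Measurable.stronglyMeasurable ?_
        refine ((ha.comp measurable_snd).mul (Measurable.ite ?_ measurable_const
          measurable_const)).const_mul _
        exact measurableSet_le (mk.comp measurable_snd) measurable_fst
      · refine (norm_integral_le_of_norm_le_const (C := 1) (Filter.Eventually.of_forall
          fun x => ?_)).trans (by simp)
        rw [Real.norm_eq_abs, abs_mul, abs_mul]
        have := ha1 x
        split_ifs <;> simp <;> linarith
  · refine Integrable.of_bound (C := 1) ?_ (Filter.Eventually.of_forall fun x => ?_)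
    · refine Measurable.aestronglyMeasurable ?_
      refine ((ha.comp measurable_fst).mul (Measurable.ite ?_ measurable_const
          measurable_const)).const_mul _
      exact measurableSet_le (mk.comp measurable_fst) measurable_snd
    · have := ha1 x.1
      simp only [Function.uncurry]
      rw [Real.norm_eq_abs, abs_mul, abs_mul]
      split_ifs <;> simp <;> linarith

theorem abs_outcome_sub_le (y : Bool) (p : I) : |outcome y - (p : ℝ)| ≤ 1 := by
  have := outcome_mem y
  rw [abs_le]
  constructor <;> linarith [p.2.1, p.2.2]

theorem measurable_residual {k : I → I} (hk : Measurable k) :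
    Measurable fun x : I × Bool => outcome x.2 - (k x.1 : ℝ) :=
  (measurable_outcome.comp measurable_snd).sub
    (measurable_subtype_coe.comp (hk.comp measurable_fst))

/-- Calibration of `k₁` and small correlation of its residuals with the level sets of `k₂` imply
that `k₁` is at most slightly worse than `k₂`. -/
theorem integral_loss_le {l : I → Bool → ℝ} (hl : l ∈ properLosses) {k₁ k₂ : I → I}
    (h₁ : Measurable k₁) (h₂ : Measurable k₂) {B₁ B₂ : ℝ}
    (hB₁ : ∀ U : Set I, IsUpperSet U →
      ∫ x, (outcome x.2 - (k₁ x.1 : ℝ)) * upSign U (k₂ x.1) ∂J ≤ B₁)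
    (hB₂ : ∀ U : Set I, IsUpperSet U →
      -∫ x, (outcome x.2 - (k₁ x.1 : ℝ)) * upSign U (k₁ x.1) ∂J ≤ B₂) :
    ∫ x, l (k₁ x.1) x.2 ∂J ≤ ∫ x, l (k₂ x.1) x.2 ∂J + (B₁ + B₂) := by
  have ma := measurable_residual h₁
  have ha1 : ∀ x : I × Bool, |outcome x.2 - (k₁ x.1 : ℝ)| ≤ 1 := fun x => abs_outcome_sub_le _ _
  have c1 := integral_mul_slope_le (J := J) hl h₂ ma ha1 hB₁
  have c2 := integral_mul_slope_le (J := J) hl h₁ ma.neg (fun x => by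
    simpa only [Pi.neg_apply, abs_neg] using ha1 x) (B := B₂) (fun U hU => by
    have := hB₂ U hU
    rw [← integral_neg] at this
    simpa only [Pi.neg_apply, neg_mul] using this)
  have i : ∀ {k : I → I}, Measurable k → Integrable
      (fun x : I × Bool => (outcome x.2 - (k₁ x.1 : ℝ)) * slope l (k x.1)) J := fun {k} hk => by
    refine integrable_of_abs_le (B := 1) (ma.mul ((measurable_slope hl.1).comp
      (hk.comp measurable_fst))) fun x => ?_
    rw [abs_mul]
    exact mul_le_one₀ (ha1 x) (abs_nonneg _) (abs_slope_le hl _)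
  -- Properness with true mean `k₁` compares the Bayes risks; the rest of each loss is `(y - k₁)`
  -- times its slope.
  have key : ∫ x, (l (k₁ x.1) x.2 - l (k₂ x.1) x.2) ∂J ≤
      ∫ x, ((outcome x.2 - (k₁ x.1 : ℝ)) * slope l (k₁ x.1) -
        (outcome x.2 - (k₁ x.1 : ℝ)) * slope l (k₂ x.1)) ∂J := by
    refine integral_mono ((integrable_loss hl h₁).sub (integrable_loss hl h₂))
      ((i h₁).sub (i h₂)) fun x => ?_
    have := hl.1.le (k₂ x.1) (k₁ x.1)
    simp only
    rw [loss_eq l (k₁ x.1) x.2, loss_eq l (k₂ x.1) x.2]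
    linarith
  rw [integral_sub (integrable_loss hl h₁) (integrable_loss hl h₂),
    integral_sub (i h₁) (i h₂)] at key
  simp only [Pi.neg_apply, neg_mul, integral_neg, neg_neg] at c2
  linarith

/-! ### Upper level sets of post-processings -/

/-- Thresholds of post-processings of a valid class belong to the threshold class. -/
theorem threshold_mem_thr {K : Set (I → I)} (hK : IsValid K) {κ : I → I} (hκ : κ ∈ K) (a : ℝ) :
    (fun p => signPlus ((κ p : ℝ) - a)) ∈ thr K := by
  refine ⟨_, hK.2 κ hκ 0 (1 / 2 - a), ?_⟩
  funext p
  have h1 : clip ((p : ℝ) + 0) = p := by rw [add_zero, clip_coe]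
  simp only [h1, signPlus]
  -- Clipping does not affect the comparison with `1/2`, an interior point of `[0, 1]`; this covers
  -- also `a` outside `[0, 1]`.
  have h2 : (0 ≤ (κ p : ℝ) - a) ↔ 0 ≤ ((clip ((κ p : ℝ) + (1 / 2 - a)) : I) : ℝ) - 1 / 2 := by
    rw [clip, Set.coe_projIcc]
    constructor
    · intro h
      have : (1 / 2 : ℝ) ≤ max 0 (min 1 ((κ p : ℝ) + (1 / 2 - a))) :=
        le_max_of_le_right (le_min (by norm_num) (by linarith))
      linarith
    · intro h
      have h3 : (1 / 2 : ℝ) ≤ max 0 (min 1 ((κ p : ℝ) + (1 / 2 - a))) := by linarith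
      rcases le_max_iff.mp h3 with h4 | h4
      · norm_num at h4
      · have := (le_min_iff.mp h4).2
        linarith
  simp only [h2]

/-- Thresholds of the identity at 0 and at 2. Constants in the class allow the learner to transmit a
bit: on constantly labelled examples the best error is 0. -/
theorem const_mem_thr {K : Set (I → I)} (hK : IsValid K) (b : ℤˣ) : (fun _ => b) ∈ thr K := by
  rcases Int.units_eq_one_or b with rfl | rfl
  · convert threshold_mem_thr hK hK.1 0 using 1
    funext p
    simp [signPlus, p.2.1]
  · convert threshold_mem_thr hK hK.1 2 using 1
    funext p
    have : ¬ (0 : ℝ) ≤ p - 2 := by linarith [p.2.2]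
    rw [signPlus, if_neg this]

theorem measurable_signPlus : Measurable signPlus :=
  Measurable.ite measurableSet_Ici measurable_const measurable_const

theorem measurable_of_mem_thr {K : Set (I → I)} (hm : ∀ κ ∈ K, Measurable κ) {f : I → ℤˣ}
    (hf : f ∈ thr K) : Measurable f := by
  obtain ⟨κ, hκ, rfl⟩ := hf
  exact measurable_signPlus.comp ((measurable_subtype_coe.comp (hm κ hκ)).sub_const _)

instance : MeasurableSingletonClass ℤˣ where
  measurableSet_singleton b := by
    refine ⟨{(b : ℤ)}, trivial, ?_⟩
    ext x
    exact ⟨fun h => Units.ext h, fun h => congrArg Units.val h⟩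

theorem measurable_lab : Measurable lab := measurable_of_countable _

theorem abs_lab (z : ℤˣ) : |lab z| = 1 := by
  rcases Int.units_eq_one_or z with rfl | rfl <;> simp [lab]

/-- Correlations with upper level sets of post-processings are bounded by correlations with
thresholds. -/
theorem integral_upSign_le {K : Set (I → I)} (hK : IsValid K) (hm : ∀ κ ∈ K, Measurable κ)
    {a : I × Bool → ℝ} (ha : Measurable a) (ha1 : ∀ x, |a x| ≤ 1) {B : ℝ}
    (hB : ∀ f ∈ thr K, ∫ x, a x * lab (f x.1) ∂J ≤ B) {κ : I → I} (hκ : κ ∈ K) {U : Set I}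
    (hU : IsUpperSet U) : ∫ x, a x * upSign U (κ x.1) ∂J ≤ B := by
  rcases U.eq_empty_or_nonempty with rfl | hne
  · have := hB _ (const_mem_thr hK (-1))
    simpa [upSign, lab] using this
  have hlab : ∀ t : ℝ, lab (signPlus t) = if 0 ≤ t then 1 else -1 := fun t => by
    unfold signPlus lab; split_ifs <;> simp
  set b := sInf U with hb
  have lower : ∀ q ∈ U, b ≤ q := fun q hq => sInf_le hq
  have above : ∀ q, b < q → q ∈ U := fun q hq => by
    obtain ⟨u, hu, huq⟩ := sInf_lt_iff.mp hq
    exact hU huq.le hu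
  by_cases hbU : b ∈ U
  · have := hB _ (threshold_mem_thr hK hκ b)
    refine le_trans (le_of_eq ?_) this
    congr 1
    funext x
    rw [hlab, upSign]
    congr 2
    rw [sub_nonneg]
    exact propext ⟨fun h => lower _ h, fun h => hU h hbU⟩
  -- The half-open interval `(b, 1]` is not a threshold set of this form, but the limit of the
  -- thresholds at `b + 1/(n+1)`.
  · have hlim : Filter.Tendsto (fun n : ℕ => ∫ x, a x *
        lab (signPlus ((κ x.1 : ℝ) - (b + 1 / ((n : ℝ) + 1)))) ∂J) Filter.atTop
        (nhds (∫ x, a x * upSign U (κ x.1) ∂J)) := by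
      refine tendsto_integral_of_dominated_convergence (fun _ => 1) (fun n => ?_)
        (integrable_const _) (fun n => Filter.Eventually.of_forall fun x => ?_)
        (Filter.Eventually.of_forall fun x => ?_)
      · exact (ha.mul (measurable_lab.comp ((measurable_of_mem_thr hm
          (threshold_mem_thr hK hκ _)).comp measurable_fst))).aestronglyMeasurable
      · rw [Real.norm_eq_abs, abs_mul, abs_lab, mul_one]
        exact ha1 x
      · refine Filter.Tendsto.const_mul _ ?_
        simp only [hlab]
        by_cases hx : κ x.1 ∈ U
        · have hlt : (b : ℝ) < κ x.1 :=
            lt_of_le_of_ne (lower _ hx) fun h => hbU (by rwa [Subtype.ext h])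
          refine tendsto_const_nhds.congr' ?_
          have h0 := tendsto_one_div_add_atTop_nhds_zero_nat (𝕜 := ℝ)
          have := h0.eventually (gt_mem_nhds (sub_pos.mpr hlt))
          filter_upwards [this] with n hn
          rw [upSign, if_pos hx, if_pos (by linarith)]
        · have hle : (κ x.1 : ℝ) ≤ b := not_lt.mp fun h => hx (above _ h)
          refine tendsto_const_nhds.congr fun n => ?_
          have : (0 : ℝ) < 1 / ((n : ℝ) + 1) := by positivity
          rw [upSign, if_neg hx, if_neg (by linarith)]
    exact le_of_tendsto' hlim fun n => hB _ (threshold_mem_thr hK hκ _)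

end Omniprediction

end

/-! ### Agnostic learning as maximization of the correlation with residuals. -/

noncomputable section

namespace Omniprediction

set_option linter.unusedSectionVars false

section Learning

variable (J : Measure (I × Bool)) [IsProbabilityMeasure J]

/-- The correlation of the residuals of the scaled predictor `κ` with `g`. -/
def corr (M : ℕ) (κ g : I → ℝ) : ℝ := ∫ x, (M * outcome x.2 - κ x.1) * g x.1 ∂J

/-- The error of the hypothesis `h` for the labels `z`. -/
def labelErr (z : I → Bool → I → ℤˣ) (h : I → ℤˣ) : ℝ :=
  (J.prod (volume : Measure I)).real {x | h x.1.1 ≠ z x.1.1 x.1.2 x.2}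

/-- The hypothesis returned by a call of the learner. -/
def relabelRun {S : Type u} [MeasurableSpace S] (AL : Learner S) (z : I → Bool → I → ℤˣ)
    (c : (Fin AL.sampleSize → (I × Bool) × I) × S) : I → ℤˣ :=
  AL.run (fun i => ((c.1 i).1.1, z (c.1 i).1.1 (c.1 i).1.2 (c.1 i).2)) c.2

/-- The law of the randomness of one call. -/
def callLaw {S : Type u} [MeasurableSpace S] (ν : Measure S) (m : ℕ) :
    Measure ((Fin m → (I × Bool) × I) × S) :=
  (Measure.pi (fun _ : Fin m => J.prod (volume : Measure I))).prod ν

variable {J}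

theorem abs_residual_le {M : ℕ} {k : ℝ} (h0 : 0 ≤ k) (h1 : k ≤ M) (y : Bool) :
    |M * outcome y - k| ≤ M := by
  have hM : (0 : ℝ) ≤ M := Nat.cast_nonneg M
  rw [abs_le]
  cases y <;> simp [outcome] <;> constructor <;> linarith

theorem measurable_scaled_residual {M : ℕ} {κ : I → ℝ} (hκ : Measurable κ) :
    Measurable fun x : I × Bool => M * outcome x.2 - κ x.1 :=
  ((measurable_outcome.comp measurable_snd).const_mul _).sub (hκ.comp measurable_fst)

/-- Agnostic learning of relabelled examples. -/
theorem learner_success {S : Type u} [MeasurableSpace S] {ν : Measure S} [IsProbabilityMeasure ν]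
    {AL : Learner S} {ε : ℝ} {C C' : Set (I → ℤˣ)} (hAL : IsAgnosticLearner ν AL ε C)
    (hC : C' ⊆ C) (hc : C'.Countable) {z : I → Bool → I → ℤˣ}
    (hz : Measurable fun x : (I × Bool) × I => z x.1.1 x.1.2 x.2) (hm : ∀ f ∈ C', Measurable f) :
    9 / 10 ≤ (callLaw J ν AL.sampleSize).real
      {c | ∀ f ∈ C', labelErr J z (relabelRun AL z c) ≤ labelErr J z f + ε} := by
  set g : (I × Bool) × I → I × ℤˣ := fun x => (x.1.1, z x.1.1 x.1.2 x.2) with hg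
  have mg : Measurable g := (measurable_fst.comp measurable_fst).prodMk hz
  set D := (J.prod (volume : Measure I)).map g with hD
  have : IsProbabilityMeasure D := Measure.isProbabilityMeasure_map mg.aemeasurable
  have hne : ∀ h : I → ℤˣ, Measurable h → MeasurableSet {x : I × ℤˣ | h x.1 ≠ x.2} := fun h hh =>
    (measurableSet_eq_fun (hh.comp measurable_fst) measurable_snd).compl
  have err : ∀ h : I → ℤˣ, Measurable h → D.real {x | h x.1 ≠ x.2} = labelErr J z h :=
    fun h hh => by
      rw [hD, measureReal_def, Measure.map_apply mg (hne h hh)]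
      rfl
  -- The success event for the full class may fail to be measurable, so its probability is only an
  -- outer measure. The larger event for a countable subclass is measurable and can be pulled back
  -- to the relabelled examples.
  set E' : Set ((Fin AL.sampleSize → I × ℤˣ) × S) :=
    {ω | ∀ f ∈ C', D.real {x | AL.run ω.1 ω.2 x.1 ≠ x.2} ≤ D.real {x | f x.1 ≠ x.2} + ε} with hE'
  have mE' : MeasurableSet E' := by
    have : E' = ⋂ f ∈ C', {ω | D.real {x | AL.run ω.1 ω.2 x.1 ≠ x.2} ≤
        D.real {x | f x.1 ≠ x.2} + ε} := by ext; simp [hE']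
    rw [this]
    refine MeasurableSet.biInter hc fun f hf => measurableSet_le ?_ measurable_const
    have ms : MeasurableSet {q : ((Fin AL.sampleSize → I × ℤˣ) × S) × (I × ℤˣ) |
        AL.run q.1.1 q.1.2 q.2.1 ≠ q.2.2} := by
      have mr : Measurable fun q : ((Fin AL.sampleSize → I × ℤˣ) × S) × (I × ℤˣ) =>
          AL.run q.1.1 q.1.2 q.2.1 :=
        AL.measurable_run.comp ((measurable_fst.comp measurable_fst).prodMk
          ((measurable_snd.comp measurable_fst).prodMk (measurable_fst.comp measurable_snd)))
      exact (measurableSet_eq_fun mr (measurable_snd.comp measurable_snd)).compl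
    exact (measurable_measure_prodMk_left ms).ennreal_toReal
  set Φ : (Fin AL.sampleSize → (I × Bool) × I) × S → (Fin AL.sampleSize → I × ℤˣ) × S :=
    Prod.map (fun x i => g (x i)) id with hΦ
  have mp : Measurable fun (x : Fin AL.sampleSize → (I × Bool) × I) i => g (x i) :=
    measurable_pi_lambda _ fun i => mg.comp (measurable_pi_apply i)
  have mΦ : Measurable Φ := mp.prodMap measurable_id
  have law : (callLaw J ν AL.sampleSize).map Φ =
      (Measure.pi (fun _ : Fin AL.sampleSize => D)).prod ν := by
    rw [callLaw, hΦ, ← Measure.map_prod_map _ _ mp measurable_id,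
      Measure.map_id, ← Measure.pi_map_pi (fun _ => mg.aemeasurable)]
  have h1 := hAL D
  have h2 : (9 / 10 : ℝ) ≤ ((Measure.pi (fun _ : Fin AL.sampleSize => D)).prod ν).real E' :=
    h1.trans (measureReal_mono fun ω h f hf => h f (hC hf))
  rw [← law, measureReal_def, Measure.map_apply mΦ mE'] at h2
  refine h2.trans (le_of_eq ?_)
  rw [measureReal_def]
  congr 2
  ext c
  have mrun : Measurable (relabelRun AL z c) :=
    AL.measurable_run.comp (measurable_const.prodMk (measurable_const.prodMk measurable_id))
  refine forall₂_congr fun f hf => ?_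
  rw [← err _ mrun, ← err f (hm f hf)]
  rfl

theorem volume_le_real {q : ℝ} (h0 : 0 ≤ q) (h1 : q ≤ 1) :
    (volume : Measure I).real {u : I | (u : ℝ) ≤ q} = q := by
  have := unitInterval.volume_Iic (⟨q, h0, h1⟩ : I)
  rw [measureReal_def]
  change (volume (Set.Iic (⟨q, h0, h1⟩ : I))).toReal = q
  rw [this, ENNReal.toReal_ofReal h0]

theorem measurable_residualLabel {α : Type*} [MeasurableSpace α] {M : ℕ} {κ : α → I → ℝ}
    {p : α → I} {y : α → Bool} {u : α → I} (hκ : Measurable fun x => κ x (p x))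
    (hy : Measurable y) (hu : Measurable u) :
    Measurable fun x => residualLabel M (κ x) (p x) (y x) (u x) := by
  have m2 : Measurable fun x => outcome (y x) := measurable_outcome.comp hy
  have m3 : Measurable fun x => (u x : ℝ) := measurable_subtype_coe.comp hu
  exact measurable_signPlus.comp (((((m2.const_mul _).const_add _).sub hκ).sub
    (m3.const_mul _)).sub (m3.const_mul _))

theorem residualLabel_eq {M : ℕ} (hM : 0 < M) (κ : I → ℝ) (p : I) (y : Bool) (u : I) :
    residualLabel M κ p y u =
      if (u : ℝ) ≤ (M + (M * outcome y - κ p)) / (2 * M) then 1 else -1 := by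
  have hM' : (0 : ℝ) < M := by exact_mod_cast hM
  rw [residualLabel, signPlus]
  congr 1
  rw [le_div_iff₀ (by positivity)]
  apply propext
  constructor <;> intro <;> linarith

/-- The label is `+1` with probability `(1 + ρ)/2`, where `ρ = (M y - κ)/M` lies in `[-1, 1]`, so
its mean is the unscaled residual. -/
theorem volume_ne_residualLabel {M : ℕ} (hM : 0 < M) {κ : I → ℝ}
    (h0 : ∀ p, 0 ≤ κ p ∧ κ p ≤ M) (p : I) (y : Bool) (b : ℤˣ) :
    (volume : Measure I).real {u | b ≠ residualLabel M κ p y u} =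
      1 / 2 - (M * outcome y - κ p) * lab b / (2 * M) := by
  have hM' : (0 : ℝ) < M := by exact_mod_cast hM
  have hr := abs_le.mp (abs_residual_le (h0 p).1 (h0 p).2 y)
  set q := (M + (M * outcome y - κ p)) / (2 * M) with hq
  have q0 : 0 ≤ q := div_nonneg (by linarith) (by positivity)
  have q1 : q ≤ 1 := by rw [hq, div_le_one (by positivity)]; linarith
  have hne : (1 : ℤˣ) ≠ -1 := by decide
  rcases Int.units_eq_one_or b with rfl | rfl
  · have : {u | 1 ≠ residualLabel M κ p y u} = {u : I | (u : ℝ) ≤ q}ᶜ := by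
      ext u
      simp only [Set.mem_ofPred_eq, residualLabel_eq hM, Set.mem_compl_iff, ← hq]
      split_ifs with h <;> simp [h, hne]
    rw [this, probReal_compl_eq_one_sub
      (measurableSet_le measurable_subtype_coe measurable_const), volume_le_real q0 q1]
    simp only [lab, hq, Units.val_one, Int.cast_one]
    field_simp
    ring
  · have : {u | -1 ≠ residualLabel M κ p y u} = {u : I | (u : ℝ) ≤ q} := by
      ext u
      simp only [Set.mem_ofPred_eq, residualLabel_eq hM, ← hq]
      split_ifs with h <;> simp [h, hne.symm]
    rw [this, volume_le_real q0 q1]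
    simp only [lab, hq, Units.val_neg, Units.val_one, Int.cast_neg, Int.cast_one]
    field_simp
    ring

/-- Small error means large correlation with the residual; an excess error `ε` costs `2Mε` of scaled
correlation. -/
theorem labelErr_residualLabel {M : ℕ} (hM : 0 < M) {κ : I → ℝ} (hκ : Measurable κ)
    (h0 : ∀ p, 0 ≤ κ p ∧ κ p ≤ M) {h : I → ℤˣ} (hh : Measurable h) :
    labelErr J (residualLabel M κ) h = 1 / 2 - corr J M κ (fun p => lab (h p)) / (2 * M) := by
  have mz : Measurable fun x : (I × Bool) × I => residualLabel M κ x.1.1 x.1.2 x.2 :=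
    measurable_residualLabel (hκ.comp (measurable_fst.comp measurable_fst))
      (measurable_snd.comp measurable_fst) measurable_snd
  have ms : MeasurableSet {x : (I × Bool) × I | h x.1.1 ≠ residualLabel M κ x.1.1 x.1.2 x.2} :=
    (measurableSet_eq_fun (hh.comp (measurable_fst.comp measurable_fst)) mz).compl
  have mg : Measurable fun x : I × Bool => (M * outcome x.2 - κ x.1) * lab (h x.1) :=
    (measurable_scaled_residual hκ).mul (measurable_lab.comp (hh.comp measurable_fst))
  rw [labelErr, measureReal_def, Measure.prod_apply ms, ← integral_toReal
    (measurable_measure_prodMk_left ms).aemeasurable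
    (Filter.Eventually.of_forall fun x => measure_lt_top _ _)]
  have : ∀ x : I × Bool, (volume (Prod.mk x ⁻¹' {x : (I × Bool) × I |
      h x.1.1 ≠ residualLabel M κ x.1.1 x.1.2 x.2})).toReal =
      1 / 2 - (M * outcome x.2 - κ x.1) * lab (h x.1) / (2 * M) := fun x =>
    volume_ne_residualLabel hM h0 x.1 x.2 (h x.1)
  simp only [this]
  rw [integral_sub (integrable_const _)]
  · simp only [corr, integral_const, probReal_univ, smul_eq_mul, one_mul]
    rw [integral_div]
  · refine Integrable.div_const ?_ _
    refine integrable_of_abs_le (B := M) mg fun x => ?_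
    rw [abs_mul, abs_lab, mul_one]
    exact abs_residual_le (h0 x.1).1 (h0 x.1).2 x.2

theorem labelErr_const (b : ℤˣ) (h : I → ℤˣ) :
    labelErr J (fun _ _ _ => b) h = J.real {x | h x.1 ≠ b} := by
  have : {x : (I × Bool) × I | h x.1.1 ≠ b} = {x : I × Bool | h x.1 ≠ b} ×ˢ Set.univ := by
    ext; simp
  rw [labelErr, this, measureReal_prod_prod]
  simp

/-- A class of measurable hypotheses has a countable subclass that is dense in mean. -/
theorem exists_countable_dense (C : Set (I → ℤˣ)) (hC : ∀ f ∈ C, Measurable f) :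
    ∃ C' ⊆ C, C'.Countable ∧ ∀ f ∈ C, ∀ η > 0, ∃ f' ∈ C',
      ∫ x, |lab (f x.1) - lab (f' x.1)| ∂J < η := by
  have : Fact ((1 : ENNReal) ≠ ⊤) := ⟨ENNReal.one_ne_top⟩
  have mem : ∀ f : C, MemLp (fun x : I × Bool => lab (f.1 x.1)) 1 J := fun f =>
    MemLp.of_bound (measurable_lab.comp ((hC f.1 f.2).comp measurable_fst)).aestronglyMeasurable 1
      (Filter.Eventually.of_forall fun x => (abs_lab _).le)
  set Ψ : C → Lp ℝ 1 J := fun f => (mem f).toLp with hΨ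
  -- `L¹(J)` is separable, and so is the image of the class in it.
  obtain ⟨t, ht, htc, hd⟩ :=
    (TopologicalSpace.IsSeparable.of_separableSpace (Set.range Ψ)).exists_countable_dense_subset
  choose e he using fun x : t => ht x.2
  have := htc.to_subtype
  refine ⟨Set.range fun x => (e x).1, ?_, Set.countable_range _, fun f hf η hη => ?_⟩
  · rintro _ ⟨x, rfl⟩
    exact (e x).2
  · obtain ⟨x, hx, hlt⟩ := Metric.mem_closure_iff.mp (hd ⟨⟨f, hf⟩, rfl⟩) η hη
    refine ⟨_, ⟨⟨x, hx⟩, rfl⟩, ?_⟩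
    have hx' : Ψ (e ⟨x, hx⟩) = x := he ⟨x, hx⟩
    rw [← hx', L1.dist_eq_integral_dist] at hlt
    refine lt_of_eq_of_lt (integral_congr_ae ?_) hlt
    filter_upwards [(mem ⟨f, hf⟩).coeFn_toLp, (mem (e ⟨x, hx⟩)).coeFn_toLp] with y h1 h2
    rw [hΨ]
    simp only
    rw [h1, h2, Real.dist_eq]

/-- The residual is bounded by `M`, so the correlation is `M`-Lipschitz in the mean distance of
hypotheses and bounds pass from the countable subclass to its closure. -/
theorem corr_le_of_dense {C C' : Set (I → ℤˣ)} (hC : ∀ f ∈ C, Measurable f) (hC' : C' ⊆ C)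
    (hd : ∀ f ∈ C, ∀ η > 0, ∃ f' ∈ C', ∫ x, |lab (f x.1) - lab (f' x.1)| ∂J < η)
    {M : ℕ} {κ : I → ℝ} (hκ : Measurable κ) (h0 : ∀ p, 0 ≤ κ p ∧ κ p ≤ M) {B : ℝ}
    (hB : ∀ f ∈ C', corr J M κ (fun p => lab (f p)) ≤ B) :
    ∀ f ∈ C, corr J M κ (fun p => lab (f p)) ≤ B := by
  intro f hf
  refine le_of_forall_pos_le_add fun η hη => ?_
  obtain ⟨f', hf', hlt⟩ := hd f hf (η / (M + 1)) (by positivity)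
  have ml : ∀ g ∈ C, Measurable fun x : I × Bool => lab (g x.1) := fun g hg =>
    measurable_lab.comp ((hC g hg).comp measurable_fst)
  have mr := measurable_scaled_residual (M := M) hκ
  have ir : ∀ g ∈ C, Integrable (fun x : I × Bool => (M * outcome x.2 - κ x.1) * lab (g x.1)) J :=
    fun g hg => integrable_of_abs_le (B := M) (mr.mul (ml g hg)) fun x => by
      rw [abs_mul, abs_lab, mul_one]
      exact abs_residual_le (h0 x.1).1 (h0 x.1).2 x.2
  have id : Integrable (fun x : I × Bool => |lab (f x.1) - lab (f' x.1)|) J := by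
    refine integrable_of_abs_le (B := 2) ((ml f hf).sub (ml f' (hC' hf'))).abs fun x => ?_
    rw [abs_abs]
    have h1 := abs_lab (f x.1)
    have h2 := abs_lab (f' x.1)
    exact (abs_sub _ _).trans (by linarith)
  have h1 : corr J M κ (fun p => lab (f p)) - corr J M κ (fun p => lab (f' p)) ≤
      M * ∫ x, |lab (f x.1) - lab (f' x.1)| ∂J := by
    rw [corr, corr, ← integral_sub (ir f hf) (ir f' (hC' hf')), ← integral_const_mul]
    refine integral_mono ((ir f hf).sub (ir f' (hC' hf'))) (id.const_mul _) fun x => ?_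
    simp only
    rw [← mul_sub]
    refine (le_abs_self _).trans ?_
    rw [abs_mul]
    exact mul_le_mul_of_nonneg_right (abs_residual_le (h0 x.1).1 (h0 x.1).2 x.2) (abs_nonneg _)
  have h2 : (M : ℝ) * ∫ x, |lab (f x.1) - lab (f' x.1)| ∂J ≤ η := by
    have hM : (0 : ℝ) ≤ M := Nat.cast_nonneg M
    calc (M : ℝ) * ∫ x, |lab (f x.1) - lab (f' x.1)| ∂J ≤ M * (η / (M + 1)) := by gcongr
      _ ≤ (M + 1) * (η / (M + 1)) := by gcongr; linarith
      _ = η := by field_simp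
  linarith [hB f' hf']

end Learning

end Omniprediction

end

noncomputable section

namespace Omniprediction

set_option linter.unusedSectionVars false

/-! ### Values of the predictor and of the features -/

theorem rowsVal_feat_abs_le {M : ℕ} {w : ℕ → ℕ → ℝ} {h : ℕ → ℝ} (hh : ∀ q, |h q| ≤ 1) (r l : ℕ) :
    |(rowsVal M w h r).2 l| ≤ 1 := by
  induction r with
  | zero => simp [rowsVal]
  | succ r ih =>
    simp only [rowsVal, addFeatures]
    split_ifs
    · exact ih
    · simp
    · simp
    · exact hh r

theorem truncate_int {M : ℕ} (z : ℤ) : ∃ k : ℕ, k ≤ M ∧ truncate M z = k := by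
  unfold truncate
  split_ifs with h1 h2
  · exact ⟨0, Nat.zero_le _, by simp⟩
  · exact ⟨M, le_rfl, rfl⟩
  · lift z to ℕ using by exact_mod_cast not_lt.mp h1
    exact ⟨z, by exact_mod_cast not_lt.mp h2, by simp⟩

/-- Integer weights and features keep the scaled predictor on the grid, so its `M + 1` threshold
features describe all its level sets exactly. -/
theorem rowsVal_int {M : ℕ} {w : ℕ → ℕ → ℝ} {h : ℕ → ℝ} (hw : ∀ q l, ∃ z : ℤ, w q l = z)
    (hh : ∀ q, ∃ z : ℤ, h q = z) (r : ℕ) :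
    (∃ k : ℕ, k ≤ M ∧ (rowsVal M w h r).1 = k) ∧ ∀ l, ∃ z : ℤ, (rowsVal M w h r).2 l = z := by
  induction r with
  | zero => exact ⟨⟨0, Nat.zero_le _, by simp [rowsVal]⟩, fun l => ⟨0, by simp [rowsVal]⟩⟩
  | succ r ih =>
    obtain ⟨⟨k, -, hk⟩, hG⟩ := ih
    have hG' : ∀ l, ∃ z : ℤ, (rowsVal M w h (r + 1)).2 l = z := by
      intro l
      simp only [rowsVal, addFeatures]
      split_ifs
      · exact hG l
      · exact ⟨-1, by simp⟩
      · exact ⟨1, by simp⟩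
      · exact hh r
    refine ⟨?_, hG'⟩
    choose z hz using hG'
    choose zw hzw using hw
    have : (rowsVal M w h (r + 1)).1 =
        truncate M ((k + ∑ l ∈ Finset.range ((r + 1) * (M + 2)), zw r l * z l : ℤ) : ℝ) := by
      push_cast
      simp only [← hz, ← hzw, ← hk]
      rfl
    rw [this]
    exact truncate_int _

/-- Projection to an interval containing `y` brings `x` no farther from `y`; truncation therefore
never hurts the squared error. -/
theorem truncate_contract {M : ℕ} {x y : ℝ} (h0 : 0 ≤ y) (h1 : y ≤ M) :
    (y - truncate M x) ^ 2 ≤ (y - x) ^ 2 := by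
  unfold truncate
  split_ifs with h2 h3
  · nlinarith
  · nlinarith
  · exact le_rfl

/-- The feature comparing the predictor of row `q` with `v`. -/
theorem rowsVal_feat_sign {M : ℕ} {w : ℕ → ℕ → ℝ} {h : ℕ → ℝ} {q v r : ℕ} (hv : v ≤ M)
    (hq : q < r) : (rowsVal M w h r).2 (q * (M + 2) + v) =
      if (rowsVal M w h q).1 < v then -1 else 1 := by
  induction r with
  | zero => omega
  | succ r ih =>
    simp only [rowsVal, addFeatures]
    rcases Nat.lt_succ_iff_lt_or_eq.mp hq with hq | rfl
    · rw [if_pos, ih hq]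
      calc q * (M + 2) + v < (q + 1) * (M + 2) := by rw [Nat.succ_mul]; omega
        _ ≤ r * (M + 2) := Nat.mul_le_mul_right _ hq
    · rw [if_neg (by omega), if_pos (by omega), Nat.add_sub_cancel_left]

/-! ### The predictor from round to round. -/

section Rounds

variable (P : Params) {S : Type u} [MeasurableSpace S] (AL : Learner S)
  (ω : Tape AL.sampleSize S) (J : Measure (I × Bool)) [IsProbabilityMeasure J]

theorem select_cases (St : ℕ → ℝ) (τ : ℝ) (l : ℕ) :
    select St τ l = 0 ∨ select St τ l = 1 ∨ select St τ l = -1 := by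
  unfold select; split_ifs <;> simp

theorem hist_wt_cases (r q l : ℕ) : (hist P AL ω r).wt q l = 0 ∨ (hist P AL ω r).wt q l = 1 ∨
    (hist P AL ω r).wt q l = -1 := by
  rcases lt_or_ge q r with h | h
  · rw [hist_wt_stable P AL ω h]
    simp only [hist, nextHist, Function.update_self]
    exact select_cases _ _ _
  · rw [hist_wt_zero P AL ω h]; exact Or.inl rfl

theorem curPred_int (r : ℕ) (p : I) : ∃ k : ℕ, k ≤ P.M ∧ curPred P AL ω r p = k := by
  refine (rowsVal_int (fun q l => ?_) (fun q => ⟨_, rfl⟩) r).1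
  rcases hist_wt_cases P AL ω r q l with h | h | h <;> rw [h]
  · exact ⟨0, by simp⟩
  · exact ⟨1, by simp⟩
  · exact ⟨-1, by simp⟩

theorem curPred_mem (r : ℕ) (p : I) : 0 ≤ curPred P AL ω r p ∧ curPred P AL ω r p ≤ P.M :=
  rowsVal_mem _ _ _ _

/-- The features tested in round `r`. -/
def curFeat (r l : ℕ) (p : I) : ℝ := (addHyp P AL ω r (hist P AL ω r)).feat P.M (r + 1) l p

theorem abs_curFeat_le (r l : ℕ) (p : I) : |curFeat P AL ω r l p| ≤ 1 :=
  rowsVal_feat_abs_le (fun _ => (abs_lab _).le) _ _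

theorem pred_hist {r N : ℕ} (h : r ≤ N) : (hist P AL ω N).pred P.M r = curPred P AL ω r := by
  funext p
  rw [curPred, Hist.pred, Hist.pred, Hist.val, Hist.val]
  congr 1
  refine rowsVal_congr (fun q hq l _ => ?_) fun q hq => ?_
  · rw [hist_wt_stable P AL ω (show q < N by omega), hist_wt_stable P AL ω hq]
  · rw [hist_hyp P AL ω (show q < N by omega), hist_hyp P AL ω hq]

theorem curFeat_sign {r q v : ℕ} (hq : q ≤ r) (hv : v ≤ P.M) (p : I) :
    curFeat P AL ω r (q * (P.M + 2) + v) p = if curPred P AL ω q p < v then -1 else 1 := by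
  rw [curFeat, Hist.feat, Hist.val, rowsVal_feat_sign hv (by omega)]
  have : (rowsVal P.M (addHyp P AL ω r (hist P AL ω r)).wt
      (fun q => lab ((addHyp P AL ω r (hist P AL ω r)).hyp q p)) q).1 = curPred P AL ω q p := by
    rw [← pred_hist P AL ω hq, Hist.pred, Hist.val]
    congr 1
    refine rowsVal_congr (fun _ _ _ _ => rfl) fun q' hq' => ?_
    simp [addHyp, Hist.push, show q' ≠ r by omega]
  rw [this]

theorem curFeat_last (r : ℕ) (p : I) : curFeat P AL ω r ((r + 1) * (P.M + 2) - 1) p =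
    lab (fetchHyp P AL ω (curPred P AL ω r) (roundIdx P AL ω r) p) := by
  rw [curFeat, Hist.feat_last]
  simp [addHyp, Hist.push, roundIdx, curPred]

theorem curPred_succ (r : ℕ) (p : I) : curPred P AL ω (r + 1) p =
    truncate P.M (curPred P AL ω r p + ∑ l ∈ Finset.range ((r + 1) * (P.M + 2)),
      select (roundStat P AL ω r (hist P AL ω r)) (2 * P.n) l * curFeat P AL ω r l p) := by
  have e : ∀ H : Hist, H.pred P.M (r + 1) p = truncate P.M (H.pred P.M r p +
      ∑ l ∈ Finset.range ((r + 1) * (P.M + 2)), H.wt r l * H.feat P.M (r + 1) l p) :=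
    fun _ => rfl
  rw [curPred, e, ← pred_hist P AL ω (Nat.le_succ r)]
  congr 2
  refine Finset.sum_congr rfl fun l _ => ?_
  congr 1
  · simp [hist, nextHist]
  · rw [curFeat, Hist.feat, Hist.feat, Hist.val, Hist.val]
    have hq : ∀ q < r + 1, (hist P AL ω (r + 1)).hyp q =
        (addHyp P AL ω r (hist P AL ω r)).hyp q := fun q _ => rfl
    simp only [rowsVal]
    congr 1
    · congr 1
      refine rowsVal_congr (fun q hq l _ => ?_) fun q _ => rfl
      simp [hist, nextHist, addHyp, Hist.push, hq.ne]
    · congr 1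
      refine rowsVal_congr (fun q hq l _ => ?_) fun q _ => rfl
      simp [hist, nextHist, addHyp, Hist.push, hq.ne]

theorem select_eq_zero {St : ℕ → ℝ} {τ : ℝ} {l : ℕ} (h : |St l| ≤ τ) : select St τ l = 0 := by
  rw [abs_le] at h
  rw [select, if_neg (not_lt.mpr h.2), if_neg (not_lt.mpr h.1), ite_self]

theorem curPred_succ_of_quiet {r : ℕ} (h : Quiet P AL ω r) :
    curPred P AL ω (r + 1) = curPred P AL ω r := by
  funext p
  rw [curPred_succ, Finset.sum_eq_zero fun l hl => by
    rw [select_eq_zero (h l (Finset.mem_range.mp hl)), zero_mul], add_zero]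
  exact truncate_of_mem (curPred_mem P AL ω r p).1 (curPred_mem P AL ω r p).2

variable {P AL ω J}

/-- If round `r` is not quiet, the predictor is corrected by a single feature, in the direction of
its test statistic. -/
theorem curPred_succ_of_not_quiet {r : ℕ} (h : ¬ Quiet P AL ω r) :
    ∃ l < (r + 1) * (P.M + 2), ∃ s : ℝ, (s = 1 ∨ s = -1) ∧
      2 * P.n < s * roundStat P AL ω r (hist P AL ω r) l ∧
      ∀ p, curPred P AL ω (r + 1) p =
        truncate P.M (curPred P AL ω r p + s * curFeat P AL ω r l p) := by
  set St := roundStat P AL ω r (hist P AL ω r) with hSt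
  have hex : ∃ l, l < (r + 1) * (P.M + 2) ∧ 2 * P.n < |St l| := by
    by_contra hcon
    push Not at hcon
    exact h fun l hl => hcon l hl
  classical
  obtain ⟨hl, hlt⟩ := Nat.find_spec hex
  have hmin : ∀ l' < Nat.find hex, |St l'| ≤ 2 * P.n := fun l' hl' => by
    have := Nat.find_min hex hl'
    push Not at this
    exact this (hl'.trans hl)
  set l := Nat.find hex with hldef
  have hsel : select St (2 * P.n) l = if 2 * P.n < St l then 1 else
      if St l < -(2 * P.n) then -1 else 0 := by rw [select, if_pos hmin]
  have hs : (select St (2 * P.n) l = 1 ∨ select St (2 * P.n) l = -1) ∧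
      2 * P.n < select St (2 * P.n) l * St l := by
    rw [hsel]
    rcases lt_abs.mp hlt with h1 | h1
    · simp [h1]
    · have hn : (0 : ℝ) ≤ P.n := Nat.cast_nonneg _
      have h2 : ¬ 2 * (P.n : ℝ) < St l := by linarith
      have h3 : St l < -(2 * P.n) := by linarith
      simp only [h2, h3, if_true, if_false]
      refine ⟨Or.inr trivial, by linarith⟩
  refine ⟨l, hl, select St (2 * P.n) l, hs.1, hs.2, fun p => ?_⟩
  rw [curPred_succ, Finset.sum_eq_single_of_mem l (Finset.mem_range.mpr hl)]
  intro l' hl' hne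
  rcases lt_or_gt_of_ne hne with h1 | h1
  · rw [select_eq_zero (hmin l' h1), zero_mul]
  · rw [select, if_neg, zero_mul]
    exact fun hcon => absurd (hcon l h1) (not_le.mpr hlt)

/-! ### Good tapes -/

variable (P AL ω J)

/-- The test statistics of round `r` are close to their expectations. -/
def Accurate (r : ℕ) : Prop :=
  ∀ j < 2 * P.R + 1, ∀ l < (r + 1) * (P.M + 2),
    |testStat P AL ω r (curPred P AL ω r) (((hist P AL ω r).push r
        (fetchHyp P AL ω (curPred P AL ω r) (P.callStart r + j))).feat P.M (r + 1) l) -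
      P.n * corr J P.M (curPred P AL ω r) (((hist P AL ω r).push r
        (fetchHyp P AL ω (curPred P AL ω r) (P.callStart r + j))).feat P.M (r + 1) l)| ≤ P.n

/-- The hypothesis returned by call `q` for the residuals of `κ` is almost as good as all
elements of `C`. -/
def FetchOK (C : Set (I → ℤˣ)) (η : ℝ) (κ : I → ℝ) (q : ℕ) : Prop :=
  ∀ f ∈ C, corr J P.M κ (fun p => lab (f p)) ≤
    corr J P.M κ (fun p => lab (fetchHyp P AL ω κ q p)) + η

/-- Step `t` of round `r` gives the right answer. -/
def ReadOK (r : ℕ) (t : ℕ) : Prop :=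
  answer P AL ω r (curPred P AL ω r) t (walk P AL ω r (curPred P AL ω r) t).1 =
    testBit P AL ω r (curPred P AL ω r) (fetchHyp P AL ω (curPred P AL ω r)
      (walk P AL ω r (curPred P AL ω r) t).1)

/-- Step `t` of round `r` gives the right answer and a good hypothesis. -/
def StepOK (C : Set (I → ℤˣ)) (η : ℝ) (r t : ℕ) : Prop :=
  FetchOK P AL ω J C η (curPred P AL ω r) (P.callStart r + 2 + 2 * t) ∧ ReadOK P AL ω r t

open Classical in
/-- The number of wrong steps among the first `T` steps of round `r`. -/
def wrongCount (C : Set (I → ℤˣ)) (η : ℝ) (r T : ℕ) : ℕ :=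
  ∑ t ∈ Finset.range T, if StepOK P AL ω J C η r t then 0 else 1

variable {P AL ω J}

theorem roundIdx_eq (r : ℕ) : ∃ j < 2 * P.R + 1, roundIdx P AL ω r = P.callStart r + j := by
  have h := walk_fst_mem P AL ω r ((hist P AL ω r).pred P.M r) P.R
  exact ⟨roundIdx P AL ω r - P.callStart r, by unfold roundIdx; omega, by unfold roundIdx; omega⟩

/-- The hypothesis finally chosen depends on the test examples, but it is among the `2R + 1`
hypotheses for which accuracy is required simultaneously. -/
theorem Accurate.feat {r : ℕ} (h : Accurate P AL ω J r) {l : ℕ} (hl : l < (r + 1) * (P.M + 2)) :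
    |roundStat P AL ω r (hist P AL ω r) l -
      P.n * corr J P.M (curPred P AL ω r) (curFeat P AL ω r l)| ≤ P.n := by
  obtain ⟨j, hj, e⟩ := roundIdx_eq (P := P) (AL := AL) (ω := ω) r
  have := h j hj l hl
  rw [← e] at this
  exact this

theorem Accurate.hyp {r : ℕ} (h : Accurate P AL ω J r) {j : ℕ} (hj : j < 2 * P.R + 1) :
    |testStat P AL ω r (curPred P AL ω r) (fun p => lab (fetchHyp P AL ω (curPred P AL ω r)
        (P.callStart r + j) p)) - P.n * corr J P.M (curPred P AL ω r)
        (fun p => lab (fetchHyp P AL ω (curPred P AL ω r) (P.callStart r + j) p))| ≤ P.n := by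
  have hl : (r + 1) * (P.M + 2) - 1 < (r + 1) * (P.M + 2) := by
    have : 0 < (r + 1) * (P.M + 2) := by positivity
    omega
  have := h j hj _ hl
  have e : ((hist P AL ω r).push r (fetchHyp P AL ω (curPred P AL ω r)
      (P.callStart r + j))).feat P.M (r + 1) ((r + 1) * (P.M + 2) - 1) =
      fun p => lab (fetchHyp P AL ω (curPred P AL ω r) (P.callStart r + j) p) := by
    funext p
    rw [Hist.feat_last]
    simp [Hist.push]
  rw [e] at this
  exact this

/-- With few wrong steps, the search ends with a hypothesis that passes the test. -/
theorem testBit_of_few_wrong {C : Set (I → ℤˣ)} {η : ℝ} {r : ℕ} (hacc : Accurate P AL ω J r)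
    (hbad : ∃ f ∈ C, η + 5 < corr J P.M (curPred P AL ω r) (fun p => lab (f p)))
    (hw : 2 * wrongCount P AL ω J C η r P.R < P.R) :
    testBit P AL ω r (curPred P AL ω r)
      (fetchHyp P AL ω (curPred P AL ω r) (roundIdx P AL ω r)) = 1 := by
  classical
  set κ := curPred P AL ω r with hκ
  set bit : ℕ → ℤˣ := fun c => testBit P AL ω r κ (fetchHyp P AL ω κ c) with hbit
  set W := walk P AL ω r κ with hW
  -- The level counts the net votes for the candidate. This potential is positive exactly if the
  -- candidate passes; a right step raises it by at least 1, a wrong step lowers it by at most 1.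
  set pot : ℕ → ℤ := fun t => if bit (W t).1 = 1 then ((W t).2 : ℤ) + 1 else -((W t).2 : ℤ)
    with hpot
  have key : ∀ t ≤ P.R, (t : ℤ) - 2 * (wrongCount P AL ω J C η r t : ℤ) ≤ pot t := by
    intro t
    induction t with
    | zero =>
      intro _
      by_cases hb : bit (P.callStart r) = 1 <;> simp [hpot, wrongCount, hW, walk, hb]
    | succ t ih =>
      intro ht
      have ih := ih (by omega)
      have hstep : W (t + 1) = if answer P AL ω r κ t (W t).1 = 1 then ((W t).1, (W t).2 + 1)
          else if 0 < (W t).2 then ((W t).1, (W t).2 - 1)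
          else (P.callStart r + 2 + 2 * t, 0) := by rw [hW, walk]
      have hwc : (wrongCount P AL ω J C η r (t + 1) : ℤ) = wrongCount P AL ω J C η r t +
          if StepOK P AL ω J C η r t then 0 else 1 := by
        rw [wrongCount, Finset.sum_range_succ, ← wrongCount]; push_cast; rfl
      rw [hwc]
      by_cases hok : StepOK P AL ω J C η r t
      · rw [if_pos hok]
        obtain ⟨hf, hr⟩ := hok
        change answer P AL ω r κ t (W t).1 = bit (W t).1 at hr
        -- A well fetched hypothesis has correlation at least `(η + 5) - η = 5`. Accuracy costs `n`,
        -- which leaves the threshold `4n` of the test.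
        have hfetch : bit (P.callStart r + 2 + 2 * t) = 1 := by
          obtain ⟨f, hfC, hfb⟩ := hbad
          have h1 := hf f hfC
          have h2 := hacc.hyp (j := 2 + 2 * t) (by omega)
          rw [← add_assoc] at h2
          rw [abs_le] at h2
          have hn : (0 : ℝ) ≤ P.n := Nat.cast_nonneg _
          simp only [hbit, testBit, signPlus]
          rw [if_pos]
          have h3 : (5 : ℝ) ≤ corr J P.M κ
            (fun p => lab (fetchHyp P AL ω κ (P.callStart r + 2 + 2 * t) p)) := by linarith
          nlinarith [mul_le_mul_of_nonneg_left h3 hn]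
        by_cases hb : bit (W t).1 = 1
        · rw [hr, if_pos hb] at hstep
          simp only [hpot, hstep, hb, if_true] at ih ⊢
          push_cast
          linarith
        · rw [hr, if_neg hb] at hstep
          by_cases hl : 0 < (W t).2
          · rw [if_pos hl] at hstep
            simp only [hpot, hstep, hb, if_false] at ih ⊢
            push_cast [Nat.cast_sub (show 1 ≤ (W t).2 from hl)]
            linarith
          · rw [if_neg hl] at hstep
            simp only [hpot, hstep, hb, hfetch, if_true, if_false] at ih ⊢
            push_cast
            linarith [show (0 : ℤ) ≤ (W t).2 by positivity]
      · rw [if_neg hok]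
        -- Even a discarded good candidate costs only 1: it had level 0, hence potential 1, and any
        -- new candidate starts with potential at least 0.
        have : pot t - 1 ≤ pot (t + 1) := by
          simp only [hpot, hstep]
          by_cases ha : answer P AL ω r κ t (W t).1 = 1
          · rw [if_pos ha]
            split_ifs <;> push_cast <;> linarith
          · rw [if_neg ha]
            by_cases hl : 0 < (W t).2
            · rw [if_pos hl]
              split_ifs <;> push_cast [Nat.cast_sub (show 1 ≤ (W t).2 from hl)] <;> linarith
            · rw [if_neg hl]
              have h0 : (W t).2 = 0 := by omega
              rw [h0]
              split_ifs <;> simp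
        push_cast
        linarith
  have hfin := key P.R le_rfl
  have hpos : 0 < pot P.R := by omega
  by_contra hcon
  have hcon' : ¬ bit (W P.R).1 = 1 := hcon
  simp only [hpot, hcon', if_false] at hpos
  omega

/-! ### Decrease of the squared error and existence of a good round. -/

/-- The squared error of the scaled predictor. -/
def sqErr (J : Measure (I × Bool)) (M : ℕ) (κ : I → ℝ) : ℝ :=
  ∫ x, (M * outcome x.2 - κ x.1) ^ 2 ∂J

theorem sqErr_le {M : ℕ} {κ : I → ℝ} (hκ : Measurable κ) (h0 : ∀ p, 0 ≤ κ p ∧ κ p ≤ M) :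
    sqErr J M κ ≤ M ^ 2 := by
  have hb : ∀ x : I × Bool, |(M * outcome x.2 - κ x.1) ^ 2| ≤ (M : ℝ) ^ 2 := fun x => by
    rw [abs_pow]
    exact pow_le_pow_left₀ (abs_nonneg _) (abs_residual_le (h0 x.1).1 (h0 x.1).2 x.2) 2
  have hi := integrable_of_abs_le (μ := J) ((measurable_scaled_residual (M := M) hκ).pow_const 2) hb
  calc sqErr J M κ ≤ ∫ _, (M : ℝ) ^ 2 ∂J :=
        integral_mono hi (integrable_const _) fun x => (le_abs_self _).trans (hb x)
    _ = M ^ 2 := by simp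

/-- Before truncation the squared error changes by `-2 s corr + E g² ≤ -2 + 1`, and truncation only
helps because the target `M y` lies in `[0, M]`. -/
theorem sqErr_update {M : ℕ} {κ κ' g : I → ℝ} {s : ℝ} (hκ : Measurable κ) (hg : Measurable g)
    (hκ' : Measurable κ') (h0 : ∀ p, 0 ≤ κ p ∧ κ p ≤ M) (hg1 : ∀ p, |g p| ≤ 1)
    (hs : s = 1 ∨ s = -1) (he : ∀ p, κ' p = truncate M (κ p + s * g p))
    (hc : 1 ≤ s * corr J M κ g) : sqErr J M κ' ≤ sqErr J M κ - 1 := by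
  have mr := measurable_scaled_residual (M := M) hκ
  have mg : Measurable fun x : I × Bool => g x.1 := hg.comp measurable_fst
  have ic : Integrable (fun x : I × Bool => (M * outcome x.2 - κ x.1) * g x.1) J := by
    refine integrable_of_abs_le (B := M * 1) (mr.mul mg) fun x => ?_
    rw [abs_mul]
    exact mul_le_mul (abs_residual_le (h0 x.1).1 (h0 x.1).2 x.2) (hg1 _) (abs_nonneg _)
      (Nat.cast_nonneg _)
  have i2 : ∀ {k : I → ℝ}, Measurable k → (∀ p, 0 ≤ k p ∧ k p ≤ M) →
      Integrable (fun x : I × Bool => (M * outcome x.2 - k x.1) ^ 2) J := fun hk h => by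
    refine integrable_of_abs_le (B := (M : ℝ) ^ 2)
      ((measurable_scaled_residual hk).pow_const 2) fun x => ?_
    rw [abs_pow]
    exact pow_le_pow_left₀ (abs_nonneg _) (abs_residual_le (h _).1 (h _).2 x.2) 2
  have hκ'0 : ∀ p, 0 ≤ κ' p ∧ κ' p ≤ M := fun p => by rw [he]; exact truncate_mem _ _
  have hpt : ∀ x : I × Bool, (M * outcome x.2 - κ' x.1) ^ 2 ≤
      (M * outcome x.2 - κ x.1) ^ 2 - 2 * s * ((M * outcome x.2 - κ x.1) * g x.1) + 1 := by
    intro x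
    have hM : (0 : ℝ) ≤ M := Nat.cast_nonneg M
    have ho := outcome_mem x.2
    have h1 := truncate_contract (M := M) (x := κ x.1 + s * g x.1) (y := M * outcome x.2)
      (by nlinarith) (by nlinarith)
    rw [he]
    have h2 : (s * g x.1) ^ 2 ≤ 1 := by
      have h3 := hg1 x.1
      have hs2 : s ^ 2 = 1 := by rcases hs with rfl | rfl <;> norm_num
      rw [mul_pow, hs2, one_mul, ← sq_abs]
      exact pow_le_one₀ (abs_nonneg _) h3
    calc _ ≤ (M * outcome x.2 - (κ x.1 + s * g x.1)) ^ 2 := h1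
      _ = (M * outcome x.2 - κ x.1) ^ 2 - 2 * s * ((M * outcome x.2 - κ x.1) * g x.1) +
          (s * g x.1) ^ 2 := by ring
      _ ≤ _ := by linarith
  have isub : Integrable (fun x : I × Bool => (M * outcome x.2 - κ x.1) ^ 2 -
      2 * s * ((M * outcome x.2 - κ x.1) * g x.1)) J := (i2 hκ h0).sub (ic.const_mul _)
  have h1 : sqErr J M κ' ≤ ∫ x, ((M * outcome x.2 - κ x.1) ^ 2 -
      2 * s * ((M * outcome x.2 - κ x.1) * g x.1) + 1) ∂J :=
    integral_mono (i2 hκ' hκ'0) (isub.add (integrable_const 1)) hpt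
  rw [integral_add isub (integrable_const 1),
    integral_sub (i2 hκ h0) (ic.const_mul _), integral_const_mul] at h1
  simp only [integral_const, probReal_univ, smul_eq_mul, one_mul] at h1
  change sqErr J M κ' ≤ sqErr J M κ - 2 * s * corr J M κ g + 1 at h1
  linarith

open Classical in
/-- The number of rounds before round `r` that are not quiet. -/
def updateCount (P : Params) (AL : Learner S) (ω : Tape AL.sampleSize S) (r : ℕ) : ℕ :=
  ∑ q ∈ Finset.range r, if Quiet P AL ω q then 0 else 1

/-- A non-quiet round has a statistic above `2n`, hence a correlation of at least 1 by accuracy, and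
the squared error starts at no more than `M²`. -/
theorem updateCount_le {N : ℕ} (hn : 0 < P.n) (hacc : ∀ r < N, Accurate P AL ω J r)
    (mp : ∀ r, Measurable (curPred P AL ω r)) (mf : ∀ r l, Measurable (curFeat P AL ω r l)) :
    updateCount P AL ω N ≤ P.M ^ 2 := by
  have hn' : (0 : ℝ) < P.n := by exact_mod_cast hn
  have key : ∀ r ≤ N, sqErr J P.M (curPred P AL ω r) ≤
      (P.M : ℝ) ^ 2 - updateCount P AL ω r := by
    intro r
    induction r with
    | zero =>
      intro _
      simpa [updateCount] using sqErr_le (J := J) (mp 0) (curPred_mem P AL ω 0)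
    | succ r ih =>
      intro hr
      have ih := ih (by omega)
      rw [updateCount, Finset.sum_range_succ, ← updateCount]
      by_cases hq : Quiet P AL ω r
      · rw [curPred_succ_of_quiet P AL ω hq, if_pos hq]
        simpa using ih
      · obtain ⟨l, hl, s, hs, hst, he⟩ := curPred_succ_of_not_quiet hq
        have ha := (hacc r (by omega)).feat hl
        have hc : 1 ≤ s * corr J P.M (curPred P AL ω r) (curFeat P AL ω r l) := by
          rw [abs_le] at ha
          have : P.n * 1 ≤ P.n * (s * corr J P.M (curPred P AL ω r) (curFeat P AL ω r l)) := by
            rcases hs with rfl | rfl <;> linarith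
          exact le_of_mul_le_mul_left this hn'
        have := sqErr_update (J := J) (mp r) (mf r l) (mp (r + 1)) (curPred_mem P AL ω r)
          (abs_curFeat_le P AL ω r l) hs he hc
        rw [if_neg hq]
        push_cast
        linarith
  have h1 := key N le_rfl
  have h2 : 0 ≤ sqErr J P.M (curPred P AL ω N) := integral_nonneg fun x => sq_nonneg _
  have : (updateCount P AL ω N : ℝ) ≤ ((P.M ^ 2 : ℕ) : ℝ) := by push_cast; linarith
  exact_mod_cast this

/-- If there are few wrong steps, some round is quiet and ends with a predictor that has small
correlations with all elements of `C`. -/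
theorem exists_good_round {C : Set (I → ℤˣ)} {η : ℝ} (hn : 0 < P.n)
    (hacc : ∀ r < P.N, Accurate P AL ω J r)
    (mp : ∀ r, Measurable (curPred P AL ω r)) (mf : ∀ r l, Measurable (curFeat P AL ω r l))
    (hw : 2 * (∑ r ∈ Finset.range P.N, wrongCount P AL ω J C η r P.R) + P.M ^ 2 * P.R <
      P.N * P.R) :
    ∃ s < P.N, Quiet P AL ω s ∧
      ∀ f ∈ C, corr J P.M (curPred P AL ω s) (fun p => lab (f p)) ≤ η + 5 := by
  classical
  -- Otherwise every quiet round has at least `R/2` wrong steps, while at most `M²` rounds are not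
  -- quiet, against the assumed count.
  have hex : ∃ s < P.N, Quiet P AL ω s ∧ 2 * wrongCount P AL ω J C η s P.R < P.R := by
    by_contra hcon
    push Not at hcon
    have h1 : ∀ r ∈ Finset.range P.N, P.R ≤
        2 * wrongCount P AL ω J C η r P.R + P.R * (if Quiet P AL ω r then 0 else 1) := by
      intro r hr
      by_cases hq : Quiet P AL ω r
      · have := hcon r (Finset.mem_range.mp hr) hq
        simpa [hq] using this
      · simp [hq]
    have h2 := Finset.sum_le_sum h1
    rw [Finset.sum_add_distrib, ← Finset.mul_sum, ← Finset.mul_sum, Finset.sum_const,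
      Finset.card_range, smul_eq_mul] at h2
    have h3 : ∑ q ∈ Finset.range P.N, (if Quiet P AL ω q then 0 else 1) ≤ P.M ^ 2 := by
      have := updateCount_le hn hacc mp mf
      rw [updateCount] at this
      convert this
    have h4 := Nat.mul_le_mul_left P.R h3
    rw [mul_comm P.R (P.M ^ 2)] at h4
    omega
  obtain ⟨s, hs, hq, hfew⟩ := hex
  refine ⟨s, hs, hq, fun f hf => ?_⟩
  by_contra hcon
  have hbit := testBit_of_few_wrong (hacc s hs) ⟨f, hf, not_le.mp hcon⟩ hfew
  have hl : (s + 1) * (P.M + 2) - 1 < (s + 1) * (P.M + 2) := by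
    have : 0 < (s + 1) * (P.M + 2) := by positivity
    omega
  have h1 := hq _ hl
  have h2 : roundStat P AL ω s (hist P AL ω s) ((s + 1) * (P.M + 2) - 1) =
      testStat P AL ω s (curPred P AL ω s)
        (fun p => lab (fetchHyp P AL ω (curPred P AL ω s) (roundIdx P AL ω s) p)) := by
    rw [roundStat]
    congr 1
    funext p
    exact curFeat_last P AL ω s p
  rw [h2] at h1
  have hn' : (0 : ℝ) < P.n := by exact_mod_cast hn
  -- A hypothesis that passes has statistic at least `4n`, but it is the last feature of a quiet
  -- round, where statistics are at most `2n`.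
  rw [testBit, signPlus] at hbit
  split_ifs at hbit with h3
  · have := le_abs_self (testStat P AL ω s (curPred P AL ω s)
        (fun p => lab (fetchHyp P AL ω (curPred P AL ω s) (roundIdx P AL ω s) p)))
    linarith
  · exact absurd hbit (by decide)

end Rounds

end Omniprediction

end

/-! ### From a good quiet round to omniprediction. -/

noncomputable section

namespace Omniprediction

set_option linter.unusedSectionVars false

section Omni

variable {P : Params} {S : Type u} [MeasurableSpace S] {AL : Learner S}
  {ω : Tape AL.sampleSize S} {J : Measure (I × Bool)} [IsProbabilityMeasure J]

/-- The post-processing at the beginning of round `r`. -/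
def curPost (P : Params) (AL : Learner S) (ω : Tape AL.sampleSize S) (r : ℕ) (p : I) : I :=
  clip (curPred P AL ω r p / P.M)

theorem clip_div {M k : ℝ} (hM : 0 < M) (h0 : 0 ≤ k) (h1 : k ≤ M) :
    ((clip (k / M) : I) : ℝ) = k / M := by
  rw [clip, Set.coe_projIcc, min_eq_right ((div_le_one hM).mpr h1),
    max_eq_right (div_nonneg h0 hM.le)]

theorem curPost_coe (hM : 0 < P.M) (r : ℕ) (p : I) :
    (curPost P AL ω r p : ℝ) = curPred P AL ω r p / P.M :=
  clip_div (by exact_mod_cast hM) (curPred_mem P AL ω r p).1 (curPred_mem P AL ω r p).2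

theorem measurable_clip : Measurable clip :=
  (continuous_projIcc (h := zero_le_one (α := ℝ))).measurable

theorem le_best {N s : ℕ} (hs : s < N) (hq : Quiet P AL ω s) :
    s ≤ best P AL ω N ∧ Quiet P AL ω (best P AL ω N) := by
  induction N with
  | zero => omega
  | succ N ih =>
    rw [best]
    split_ifs with h
    · exact ⟨by omega, h⟩
    · refine ih (lt_of_le_of_ne (by omega) ?_)
      rintro rfl
      exact h hq

/-- Level sets of predictors are given by features. -/
theorem upSign_curPost (hM : 0 < P.M) {U : Set I} (hU : IsUpperSet U) {q b : ℕ} (hq : q ≤ b) :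
    ∃ l < (b + 1) * (P.M + 2), ∃ s : ℝ, |s| = 1 ∧
      ∀ p, upSign U (curPost P AL ω q p) = s * curFeat P AL ω b l p := by
  classical
  have hM' : (0 : ℝ) < P.M := by exact_mod_cast hM
  have hl : ∀ v ≤ P.M, q * (P.M + 2) + v < (b + 1) * (P.M + 2) := fun v hv => by
    calc q * (P.M + 2) + v < (q + 1) * (P.M + 2) := by rw [Nat.succ_mul]; omega
      _ ≤ _ := Nat.mul_le_mul_right _ (by omega)
  have hval : ∀ p, ∃ k : ℕ, k ≤ P.M ∧ curPred P AL ω q p = k ∧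
      curPost P AL ω q p = clip ((k : ℝ) / P.M) := fun p => by
    obtain ⟨k, hk, he⟩ := curPred_int P AL ω q p
    exact ⟨k, hk, he, by rw [curPost, he]⟩
  -- On the grid an upper set is determined by its least element `v`. If it misses the grid, its
  -- sign is constantly -1, which is minus the threshold feature for `v = 0`.
  by_cases hex : ∃ v : ℕ, v ≤ P.M ∧ clip ((v : ℝ) / P.M) ∈ U
  · obtain ⟨hv, hvU⟩ := Nat.find_spec hex
    have hmin : ∀ k < Nat.find hex, ¬ (k ≤ P.M ∧ clip ((k : ℝ) / P.M) ∈ U) :=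
      fun k hk => Nat.find_min hex hk
    set v := Nat.find hex
    refine ⟨_, hl v hv, 1, by simp, fun p => ?_⟩
    obtain ⟨k, hk, he, he'⟩ := hval p
    rw [curFeat_sign P AL ω hq hv, he', he, upSign, one_mul]
    by_cases hkv : k < v
    · rw [if_neg fun h => hmin k hkv ⟨hk, h⟩, if_pos (by exact_mod_cast hkv)]
    · have hvk : (v : ℝ) ≤ k := by exact_mod_cast not_lt.mp hkv
      rw [if_neg (not_lt.mpr hvk), if_pos]
      refine hU ?_ hvU
      exact Set.monotone_projIcc _ (div_le_div_of_nonneg_right hvk hM'.le)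
  · refine ⟨_, hl 0 (Nat.zero_le _), -1, by simp, fun p => ?_⟩
    obtain ⟨k, hk, he, he'⟩ := hval p
    rw [curFeat_sign P AL ω hq (Nat.zero_le _), he', he, upSign,
      if_neg fun h => hex ⟨k, hk, h⟩, if_neg (not_lt.mpr (by simp))]
    simp

/-- Quietness bounds the statistic by `2n`, and accuracy adds `n`. -/
theorem corr_feat_le (hn : 0 < P.n) {b : ℕ} (hacc : Accurate P AL ω J b) (hq : Quiet P AL ω b)
    {l : ℕ} (hl : l < (b + 1) * (P.M + 2)) :
    |corr J P.M (curPred P AL ω b) (curFeat P AL ω b l)| ≤ 3 := by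
  have hn' : (0 : ℝ) < P.n := by exact_mod_cast hn
  have h1 := hacc.feat hl
  have h2 := hq l hl
  rw [abs_le] at h1 h2 ⊢
  constructor
  · refine le_of_mul_le_mul_left (a := (P.n : ℝ)) ?_ hn'
    linarith
  · refine le_of_mul_le_mul_left (a := (P.n : ℝ)) ?_ hn'
    linarith

theorem integral_residual_eq (hM : 0 < P.M) (r : ℕ) (g : I → ℝ) :
    ∫ x, (outcome x.2 - (curPost P AL ω r x.1 : ℝ)) * g x.1 ∂J =
      corr J P.M (curPred P AL ω r) g / P.M := by
  have hM' : (P.M : ℝ) ≠ 0 := by exact_mod_cast hM.ne'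
  rw [corr, ← integral_div]
  congr 1
  funext x
  rw [curPost_coe hM]
  field_simp

/-- For `q = b` this is calibration. For `q < b` it is the reason for keeping the level sets of old
predictors as features: a quiet predictor can be compared with every earlier one. -/
theorem integral_upSign_curPost (hM : 0 < P.M) (hn : 0 < P.n) {b q : ℕ}
    (hacc : Accurate P AL ω J b) (hb : Quiet P AL ω b) (hq : q ≤ b) {U : Set I}
    (hU : IsUpperSet U) :
    |∫ x, (outcome x.2 - (curPost P AL ω b x.1 : ℝ)) * upSign U (curPost P AL ω q x.1) ∂J| ≤
      3 / P.M := by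
  have hM' : (0 : ℝ) < P.M := by exact_mod_cast hM
  obtain ⟨l, hl, s, hs, he⟩ := upSign_curPost (AL := AL) (ω := ω) hM hU hq
  have h1 := corr_feat_le hn hacc hb hl
  have h2 : ∫ x, (outcome x.2 - (curPost P AL ω b x.1 : ℝ)) *
      upSign U (curPost P AL ω q x.1) ∂J =
      s * ∫ x, (outcome x.2 - (curPost P AL ω b x.1 : ℝ)) * curFeat P AL ω b l x.1 ∂J := by
    rw [← integral_const_mul]
    congr 1
    funext x
    rw [he]
    ring
  rw [h2, abs_mul, hs, one_mul, integral_residual_eq hM, abs_div, abs_of_pos hM']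
  gcongr

/-- A quiet round with small correlations makes the output an omnipredictor. -/
theorem isOmnipredictor_output {K : Set (I → I)} (hK : IsValid K) (hm : ∀ κ ∈ K, Measurable κ)
    {ε : ℝ} (hε : 42 ≤ P.M * ε) (hM : 0 < P.M) (hn : 0 < P.n)
    (hacc : ∀ r < P.N, Accurate P AL ω J r) (mp : ∀ r, Measurable (curPred P AL ω r)) {s : ℕ}
    (hs : s < P.N) (hq : Quiet P AL ω s)
    (hc : ∀ f ∈ thr K, corr J P.M (curPred P AL ω s) (fun p => lab (f p)) ≤
      2 * P.M * (ε / 3) + 5) :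
    IsOmnipredictor J ε K (output P AL ω) := by
  have hM' : (0 : ℝ) < P.M := by exact_mod_cast hM
  obtain ⟨hsb, hb⟩ := le_best hs hq
  have hbN : best P AL ω P.N < P.N := best_lt P.N (by omega)
  set b := best P AL ω P.N with hbdef
  -- The output uses `b + 1` rows, and the correction of the quiet round `b` is zero.
  have hout : output P AL ω = curPost P AL ω b := by
    funext p
    rw [output, curPost, pred_hist P AL ω (show b + 1 ≤ P.N from hbN), curPred_succ_of_quiet P AL ω hb]
  have mpost : ∀ r, Measurable (curPost P AL ω r) := fun r =>
    measurable_clip.comp ((mp r).div_const _)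
  rw [hout]
  refine ⟨mpost b, fun l hl κ hκ => ?_⟩
  -- The last quiet predictor is compared with the unknown good one, and that one, in the next step,
  -- with `κ`.
  have h1 := integral_loss_le (J := J) hl (mpost b) (mpost s)
    (fun U hU => (abs_le.mp (integral_upSign_curPost hM hn (hacc b hbN) hb hsb hU)).2)
    (fun U hU => neg_le.mp
      (abs_le.mp (integral_upSign_curPost hM hn (hacc b hbN) hb le_rfl hU)).1)
  have h2 := integral_loss_le (J := J) hl (mpost s) (hm κ hκ)
    (fun U hU => integral_upSign_le hK hm (measurable_residual (mpost s))
      (fun x => abs_outcome_sub_le _ _) (fun f hf => by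
        rw [integral_residual_eq hM s fun p => lab (f p)]
        exact div_le_div_of_nonneg_right (hc f hf) hM'.le) hκ hU)
    (fun U hU => neg_le.mp
      (abs_le.mp (integral_upSign_curPost hM hn (hacc s hs) hq le_rfl hU)).1)
  -- The learner's error takes `2ε/3`; the remaining `14/M` fits into `ε/3` because `M ε ≥ 42`.
  have h3 : 3 / (P.M : ℝ) + 3 / P.M + ((2 * P.M * (ε / 3) + 5) / P.M + 3 / P.M) ≤ ε := by
    have e : 3 / (P.M : ℝ) + 3 / P.M + ((2 * P.M * (ε / 3) + 5) / P.M + 3 / P.M) =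
        2 * ε / 3 + 14 / P.M := by field_simp; ring
    have : 14 / (P.M : ℝ) ≤ ε / 3 := by rw [div_le_iff₀ hM']; linarith
    linarith
  linarith

end Omni

end Omniprediction

end

noncomputable section

namespace Omniprediction

set_option linter.unusedSectionVars false

/-! ### Measurability of the process -/

/-- Candidate numbers and bits depend on the tape but take countably many values, so quantities
indexed by them may be treated one index at a time. -/
theorem measurable_eval_countable {α ι β : Type*} [MeasurableSpace α] [MeasurableSpace ι]
    [Countable ι] [MeasurableSingletonClass ι] [MeasurableSpace β] {f : α → ι → β}
    (hf : ∀ i, Measurable fun x => f x i) {k : α → ι} (hk : Measurable k) :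
    Measurable fun x => f x (k x) := by
  have h : Measurable (Function.uncurry f) := measurable_from_prod_countable_left fun i => hf i
  exact h.comp (measurable_id.prodMk hk)

theorem measurable_truncate (M : ℕ) : Measurable (truncate M) :=
  Measurable.ite measurableSet_Iio measurable_const
    (Measurable.ite measurableSet_Ioi measurable_const measurable_id)

theorem measurable_rowsVal {α : Type*} [MeasurableSpace α] {M : ℕ} {w : α → ℕ → ℕ → ℝ}
    {h : α → ℕ → ℝ} (hw : ∀ q l, Measurable fun x => w x q l) (hh : ∀ q, Measurable fun x => h x q)
    (r : ℕ) : (Measurable fun x => (rowsVal M (w x) (h x) r).1) ∧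
      ∀ l, Measurable fun x => (rowsVal M (w x) (h x) r).2 l := by
  induction r with
  | zero => exact ⟨measurable_const, fun _ => measurable_const⟩
  | succ r ih =>
    have hG : ∀ l, Measurable fun x => (rowsVal M (w x) (h x) (r + 1)).2 l := by
      intro l
      simp only [rowsVal, addFeatures]
      split_ifs
      · exact ih.2 l
      · exact Measurable.ite (measurableSet_lt ih.1 measurable_const) measurable_const
          measurable_const
      · exact hh r
    refine ⟨?_, hG⟩
    exact (measurable_truncate M).comp (ih.1.add
      (Finset.measurable_sum _ fun l _ => (hw r l).mul (hG l)))

theorem measurable_select {α : Type*} [MeasurableSpace α] {St : α → ℕ → ℝ}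
    (h : ∀ l, Measurable fun x => St x l) (τ : ℝ) (l : ℕ) :
    Measurable fun x => select (St x) τ l := by
  unfold select
  refine Measurable.ite ?_ (Measurable.ite (measurableSet_lt measurable_const (h l))
    measurable_const (Measurable.ite (measurableSet_lt (h l) measurable_const) measurable_const
      measurable_const)) measurable_const
  have : {x | ∀ l' < l, |St x l'| ≤ τ} = ⋂ l', ⋂ (_ : l' < l), {x | |St x l'| ≤ τ} := by
    ext; simp
  rw [this]
  exact MeasurableSet.iInter fun l' => MeasurableSet.iInter fun _ =>
    measurableSet_le (h l').abs measurable_const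

section Rounds

variable {P : Params} {S : Type u} [MeasurableSpace S] {AL : Learner S}

theorem measurable_example {m : ℕ} (i : ℕ) : Measurable fun ω : Tape m S => ω.1 i :=
  (measurable_pi_apply i).comp measurable_fst

theorem measurable_call {m : ℕ} (q : ℕ) : Measurable fun ω : Tape m S => ω.2.2 q :=
  (measurable_pi_apply q).comp (measurable_snd.comp measurable_snd)

theorem measurable_relabelRun {α : Type*} [MeasurableSpace α] {z : α → I → Bool → I → ℤˣ}
    (hz : Measurable fun x : α × ((I × Bool) × I) => z x.1 x.2.1.1 x.2.1.2 x.2.2)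
    {c : α → (Fin AL.sampleSize → (I × Bool) × I) × S} (hc : Measurable c) {p : α → I}
    (hp : Measurable p) : Measurable fun x => relabelRun AL (z x) (c x) (p x) := by
  refine AL.measurable_run.comp (Measurable.prodMk (measurable_pi_lambda _ fun i => ?_)
    ((measurable_snd.comp hc).prodMk hp))
  have hi : Measurable fun x => (c x).1 i := (measurable_pi_apply i).comp (measurable_fst.comp hc)
  exact (measurable_fst.comp (measurable_fst.comp hi)).prodMk (hz.comp (measurable_id.prodMk hi))

theorem fetchHyp_eq (ω : Tape AL.sampleSize S) (κ : I → ℝ) (q : ℕ) :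
    fetchHyp P AL ω κ q = relabelRun AL (residualLabel P.M κ) (ω.2.2 q) := rfl

theorem readHyp_eq (ω : Tape AL.sampleSize S) (b : ℤˣ) (q : ℕ) :
    readHyp AL ω b q = relabelRun AL (fun _ _ _ => b) (ω.2.2 q) := rfl

theorem measurable_fetchHyp {κ : Tape AL.sampleSize S → I → ℝ}
    (hκ : Measurable fun x : Tape AL.sampleSize S × I => κ x.1 x.2) (q : ℕ) :
    Measurable fun x : Tape AL.sampleSize S × I => fetchHyp P AL x.1 (κ x.1) q x.2 := by
  simp only [fetchHyp_eq]
  refine measurable_relabelRun ?_ ((measurable_call q).comp measurable_fst) measurable_snd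
  exact measurable_residualLabel (κ := fun x : (Tape AL.sampleSize S × I) × ((I × Bool) × I) =>
    κ x.1.1) (hκ.comp ((measurable_fst.comp measurable_fst).prodMk
      (measurable_fst.comp (measurable_fst.comp measurable_snd))))
    (measurable_snd.comp (measurable_fst.comp measurable_snd))
    (measurable_snd.comp measurable_snd)

theorem measurable_readHyp (b : ℤˣ) (q : ℕ) :
    Measurable fun x : Tape AL.sampleSize S × I => readHyp AL x.1 b q x.2 := by
  simp only [readHyp_eq]
  exact measurable_relabelRun measurable_const ((measurable_call q).comp measurable_fst)
    measurable_snd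

theorem measurable_testStat {κ g : Tape AL.sampleSize S → I → ℝ}
    (hκ : Measurable fun x : Tape AL.sampleSize S × I => κ x.1 x.2)
    (hg : Measurable fun x : Tape AL.sampleSize S × I => g x.1 x.2) (r : ℕ) :
    Measurable fun ω => testStat P AL ω r (κ ω) (g ω) := by
  refine Finset.measurable_sum _ fun i _ => ?_
  have h1 := measurable_example (S := S) (m := AL.sampleSize) (P.exStart r + i)
  have h2 : Measurable fun ω : Tape AL.sampleSize S => (ω, (ω.1 (P.exStart r + i)).1) :=
    measurable_id.prodMk (measurable_fst.comp h1)
  exact (((measurable_outcome.comp (measurable_snd.comp h1)).const_mul _).sub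
    (hκ.comp h2)).mul (hg.comp h2)

theorem measurable_testBit {κ : Tape AL.sampleSize S → I → ℝ} {c : Tape AL.sampleSize S → I → ℤˣ}
    (hκ : Measurable fun x : Tape AL.sampleSize S × I => κ x.1 x.2)
    (hc : Measurable fun x : Tape AL.sampleSize S × I => c x.1 x.2) (r : ℕ) :
    Measurable fun ω => testBit P AL ω r (κ ω) (c ω) :=
  measurable_signPlus.comp ((measurable_testStat hκ (measurable_lab.comp hc) r).sub_const _)

theorem measurable_answer {κ : Tape AL.sampleSize S → I → ℝ}
    (hκ : Measurable fun x : Tape AL.sampleSize S × I => κ x.1 x.2) (r t c : ℕ) :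
    Measurable fun ω => answer P AL ω r (κ ω) t c := by
  have h1 := measurable_example (S := S) (m := AL.sampleSize) (P.exStart r + P.n + t)
  refine measurable_eval_countable (f := fun (ω : Tape AL.sampleSize S) b =>
    readHyp AL ω b (P.callStart r + 1 + 2 * t) (ω.1 (P.exStart r + P.n + t)).1) (fun b => ?_)
    (measurable_testBit hκ (measurable_fetchHyp hκ c) r)
  exact (measurable_readHyp b _).comp (measurable_id.prodMk (measurable_fst.comp h1))

theorem measurable_walk {κ : Tape AL.sampleSize S → I → ℝ}
    (hκ : Measurable fun x : Tape AL.sampleSize S × I => κ x.1 x.2) (r t : ℕ) :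
    Measurable fun ω => walk P AL ω r (κ ω) t := by
  induction t with
  | zero => exact measurable_const
  | succ t ih =>
    have ha : Measurable fun ω => answer P AL ω r (κ ω) t (walk P AL ω r (κ ω) t).1 :=
      measurable_eval_countable (measurable_answer hκ r t) (measurable_fst.comp ih)
    have h2 : Measurable fun ω => (walk P AL ω r (κ ω) t).2 := measurable_snd.comp ih
    simp only [walk]
    refine Measurable.ite (ha (measurableSet_singleton 1)) ?_ (Measurable.ite
      (measurableSet_lt measurable_const h2) ?_ measurable_const)
    · exact (measurable_of_countable fun x : ℕ × ℕ => (x.1, x.2 + 1)).comp ih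
    · exact (measurable_of_countable fun x : ℕ × ℕ => (x.1, x.2 - 1)).comp ih

/-- Histories that depend measurably on the tape. -/
def MeasHist {m : ℕ} (H : Tape m S → Hist) : Prop :=
  (∀ q, Measurable fun x : Tape m S × I => (H x.1).hyp q x.2) ∧
    ∀ q l, Measurable fun ω => (H ω).wt q l

theorem MeasHist.val {m : ℕ} {H : Tape m S → Hist} (h : MeasHist H) (M r : ℕ) :
    (Measurable fun x : Tape m S × I => (H x.1).pred M r x.2) ∧
      ∀ l, Measurable fun x : Tape m S × I => (H x.1).feat M r l x.2 :=
  measurable_rowsVal (w := fun x : Tape m S × I => (H x.1).wt)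
    (h := fun x q => lab ((H x.1).hyp q x.2)) (fun q l => (h.2 q l).comp measurable_fst)
    (fun q => measurable_lab.comp (h.1 q)) r

theorem MeasHist.push {m : ℕ} {H : Tape m S → Hist} (h : MeasHist H) (r : ℕ)
    {c : Tape m S → I → ℤˣ} (hc : Measurable fun x : Tape m S × I => c x.1 x.2) :
    MeasHist fun ω => (H ω).push r (c ω) := by
  refine ⟨fun q => ?_, h.2⟩
  by_cases hq : q = r
  · subst hq; simpa [Hist.push] using hc
  · simpa [Hist.push, hq] using h.1 q

theorem MeasHist.addHyp {r : ℕ} (h : MeasHist fun ω : Tape AL.sampleSize S => hist P AL ω r) :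
    MeasHist fun ω : Tape AL.sampleSize S => addHyp P AL ω r (hist P AL ω r) := by
  have hκ := (h.val P.M r).1
  have hw : Measurable fun ω : Tape AL.sampleSize S =>
      (walk P AL ω r ((hist P AL ω r).pred P.M r) P.R).1 :=
    measurable_fst.comp (measurable_walk
      (κ := fun ω : Tape AL.sampleSize S => (hist P AL ω r).pred P.M r) hκ r P.R)
  have hc : Measurable fun x : Tape AL.sampleSize S × I =>
      fetchHyp P AL x.1 ((hist P AL x.1 r).pred P.M r)
        (walk P AL x.1 r ((hist P AL x.1 r).pred P.M r) P.R).1 x.2 :=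
    measurable_eval_countable (f := fun (x : Tape AL.sampleSize S × I) q =>
      fetchHyp P AL x.1 ((hist P AL x.1 r).pred P.M r) q x.2)
      (fun q => measurable_fetchHyp
        (κ := fun ω : Tape AL.sampleSize S => (hist P AL ω r).pred P.M r) hκ q)
      (hw.comp measurable_fst)
  exact MeasHist.push (H := fun ω : Tape AL.sampleSize S => hist P AL ω r) h r
    (c := fun ω => fetchHyp P AL ω ((hist P AL ω r).pred P.M r)
      (walk P AL ω r ((hist P AL ω r).pred P.M r) P.R).1) hc

theorem measHist_hist (r : ℕ) : MeasHist fun ω : Tape AL.sampleSize S => hist P AL ω r := by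
  induction r with
  | zero => exact ⟨fun _ => measurable_const, fun _ _ => measurable_const⟩
  | succ r ih =>
    have hκ := (ih.val P.M r).1
    have hadd := ih.addHyp
    refine ⟨fun q => hadd.1 q, fun q l => ?_⟩
    by_cases hq : q = r
    · subst hq
      simp only [hist, nextHist, Function.update_self]
      exact measurable_select (fun l => measurable_testStat
        (κ := fun ω : Tape AL.sampleSize S => (hist P AL ω q).pred P.M q)
        (g := fun ω => (addHyp P AL ω q (hist P AL ω q)).feat P.M (q + 1) l)
        hκ ((hadd.val P.M (q + 1)).2 l) q) _ l
    · simpa [hist, nextHist, hq] using ih.2 q l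

theorem measurable_curPred (r : ℕ) :
    Measurable fun x : Tape AL.sampleSize S × I => curPred P AL x.1 r x.2 :=
  ((measHist_hist r).val P.M r).1

theorem measurable_curPred_apply (ω : Tape AL.sampleSize S) (r : ℕ) :
    Measurable (curPred P AL ω r) :=
  (measurable_curPred r).comp (measurable_prodMk_left (x := ω))

theorem measurable_fetchHyp_curPred (r q : ℕ) : Measurable fun x : Tape AL.sampleSize S × I =>
    fetchHyp P AL x.1 (curPred P AL x.1 r) q x.2 :=
  measurable_fetchHyp (κ := fun ω : Tape AL.sampleSize S => curPred P AL ω r)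
    (measurable_curPred r) q

theorem measurable_walk_curPred (r t : ℕ) : Measurable fun ω : Tape AL.sampleSize S =>
    (walk P AL ω r (curPred P AL ω r) t).1 :=
  measurable_fst.comp (measurable_walk (κ := fun ω : Tape AL.sampleSize S => curPred P AL ω r)
    (measurable_curPred r) r t)

/-- The test functions of round `r`. -/
def testFun (P : Params) (AL : Learner S) (r j l : ℕ) (ω : Tape AL.sampleSize S) : I → ℝ :=
  ((hist P AL ω r).push r
    (fetchHyp P AL ω (curPred P AL ω r) (P.callStart r + j))).feat P.M (r + 1) l

theorem measurable_testFun (r j l : ℕ) :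
    Measurable fun x : Tape AL.sampleSize S × I => testFun P AL r j l x.1 x.2 :=
  ((MeasHist.push (H := fun ω : Tape AL.sampleSize S => hist P AL ω r) (measHist_hist r) r
    (c := fun ω => fetchHyp P AL ω (curPred P AL ω r) (P.callStart r + j))
    (measurable_fetchHyp_curPred r _)).val P.M (r + 1)).2 l

theorem abs_testFun_le (r j l : ℕ) (ω : Tape AL.sampleSize S) (p : I) :
    |testFun P AL r j l ω p| ≤ 1 :=
  rowsVal_feat_abs_le (fun _ => (abs_lab _).le) _ _

theorem measurable_curFeat (r l : ℕ) : Measurable fun x : Tape AL.sampleSize S × I =>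
    (addHyp P AL x.1 r (hist P AL x.1 r)).feat P.M (r + 1) l x.2 :=
  ((measHist_hist r).addHyp.val P.M (r + 1)).2 l

theorem measurable_curFeat_apply (ω : Tape AL.sampleSize S) (r l : ℕ) :
    Measurable (curFeat P AL ω r l) := by
  have h : Measurable fun p : I => (addHyp P AL ω r (hist P AL ω r)).feat P.M (r + 1) l p := by
    have h' := (measurable_curFeat (P := P) (AL := AL) r l).comp (measurable_prodMk_left (x := ω))
    simpa only [Function.comp_def] using h'
  unfold curFeat
  exact h

theorem measurable_corr {J : Measure (I × Bool)} [IsProbabilityMeasure J] {M : ℕ} {m : ℕ}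
    {κ g : Tape m S → I → ℝ} (hκ : Measurable fun x : Tape m S × I => κ x.1 x.2)
    (hg : Measurable fun x : Tape m S × I => g x.1 x.2) :
    Measurable fun ω => corr J M (κ ω) (g ω) := by
  have h : Measurable fun x : Tape m S × (I × Bool) =>
      (M * outcome x.2.2 - κ x.1 x.2.1) * g x.1 x.2.1 := by
    have h2 : Measurable fun x : Tape m S × (I × Bool) => (x.1, x.2.1) :=
      measurable_fst.prodMk (measurable_fst.comp measurable_snd)
    exact (((measurable_outcome.comp (measurable_snd.comp measurable_snd)).const_mul _).sub
      (hκ.comp h2)).mul (hg.comp h2)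
  exact (StronglyMeasurable.integral_prod_right (f := fun (ω : Tape m S) (x : I × Bool) =>
    (M * outcome x.2 - κ ω x.1) * g ω x.1) h.stronglyMeasurable).measurable

variable {J : Measure (I × Bool)} [IsProbabilityMeasure J]

theorem measurableSet_fetchOK {C : Set (I → ℤˣ)} (hC : C.Countable) (hm : ∀ f ∈ C, Measurable f)
    (η : ℝ) (r q : ℕ) : MeasurableSet {ω | FetchOK P AL ω J C η (curPred P AL ω r) q} := by
  have : {ω | FetchOK P AL ω J C η (curPred P AL ω r) q} =
      ⋂ f ∈ C, {ω | corr J P.M (curPred P AL ω r) (fun p => lab (f p)) ≤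
        corr J P.M (curPred P AL ω r)
          (fun p => lab (fetchHyp P AL ω (curPred P AL ω r) q p)) + η} := by
    ext; simp [FetchOK]
  rw [this]
  refine MeasurableSet.biInter hC fun f hf => measurableSet_le ?_ (Measurable.add_const ?_ _)
  · exact measurable_corr (κ := fun ω : Tape AL.sampleSize S => curPred P AL ω r)
      (g := fun _ p => lab (f p)) (measurable_curPred r)
      (measurable_lab.comp ((hm f hf).comp measurable_snd))
  · exact measurable_corr (κ := fun ω : Tape AL.sampleSize S => curPred P AL ω r)
      (g := fun ω p => lab (fetchHyp P AL ω (curPred P AL ω r) q p)) (measurable_curPred r)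
      (measurable_lab.comp (measurable_fetchHyp_curPred r q))

/-- The bit asked for in step `t` of round `r`. -/
def stepBit (P : Params) (AL : Learner S) (ω : Tape AL.sampleSize S) (r t : ℕ) : ℤˣ :=
  testBit P AL ω r (curPred P AL ω r) (fetchHyp P AL ω (curPred P AL ω r)
    (walk P AL ω r (curPred P AL ω r) t).1)

theorem measurable_stepBit (r t : ℕ) :
    Measurable fun ω : Tape AL.sampleSize S => stepBit P AL ω r t :=
  measurable_eval_countable (f := fun (ω : Tape AL.sampleSize S) c =>
    testBit P AL ω r (curPred P AL ω r) (fetchHyp P AL ω (curPred P AL ω r) c))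
    (fun c => measurable_testBit (κ := fun ω : Tape AL.sampleSize S => curPred P AL ω r)
      (c := fun ω => fetchHyp P AL ω (curPred P AL ω r) c) (measurable_curPred r)
      (measurable_fetchHyp_curPred r c) r)
    (measurable_walk_curPred r t)

theorem readOK_iff (ω : Tape AL.sampleSize S) (r t : ℕ) : ReadOK P AL ω r t ↔
    readHyp AL ω (stepBit P AL ω r t) (P.callStart r + 1 + 2 * t)
      (ω.1 (P.exStart r + P.n + t)).1 = stepBit P AL ω r t := Iff.rfl

theorem measurableSet_readOK (r t : ℕ) :
    MeasurableSet {ω : Tape AL.sampleSize S | ReadOK P AL ω r t} := by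
  have h1 := measurable_example (S := S) (m := AL.sampleSize) (P.exStart r + P.n + t)
  refine measurableSet_eq_fun ?_ (measurable_stepBit r t)
  exact measurable_eval_countable (f := fun (ω : Tape AL.sampleSize S) c =>
    answer P AL ω r (curPred P AL ω r) t c)
    (measurable_answer (κ := fun ω : Tape AL.sampleSize S => curPred P AL ω r)
      (measurable_curPred r) r t) (measurable_walk_curPred r t)

/-- The hypothesis read in step `t` of round `r` has a small error. -/
def ReadGood (P : Params) (AL : Learner S) (ω : Tape AL.sampleSize S) (J : Measure (I × Bool))
    (r t : ℕ) : Prop :=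
  J.real {x | readHyp AL ω (stepBit P AL ω r t) (P.callStart r + 1 + 2 * t) x.1 ≠
    stepBit P AL ω r t} ≤ 1 / 3

theorem measurableSet_readGood (r t : ℕ) :
    MeasurableSet {ω : Tape AL.sampleSize S | ReadGood P AL ω J r t} := by
  refine measurableSet_le ?_ measurable_const
  have h : Measurable fun x : Tape AL.sampleSize S × (I × Bool) =>
      readHyp AL x.1 (stepBit P AL x.1 r t) (P.callStart r + 1 + 2 * t) x.2.1 := by
    refine measurable_eval_countable (f := fun (x : Tape AL.sampleSize S × (I × Bool)) b =>
      readHyp AL x.1 b (P.callStart r + 1 + 2 * t) x.2.1) (fun b => ?_)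
      ((measurable_stepBit r t).comp measurable_fst)
    exact (measurable_readHyp b _).comp
      (measurable_fst.prodMk (measurable_fst.comp measurable_snd))
  exact (measurable_measure_prodMk_left (measurableSet_eq_fun h
    ((measurable_stepBit r t).comp measurable_fst)).compl).ennreal_toReal

/-! ### Dependence of the process on the tape -/

/-- Two tapes agree on the first `e` examples and the first `c` calls. -/
def Agree {m : ℕ} (e c : ℕ) (ω ω' : Tape m S) : Prop :=
  (∀ i < e, ω.1 i = ω'.1 i) ∧ ∀ q < c, ω.2.2 q = ω'.2.2 q

theorem Agree.mono {m e c e' c' : ℕ} {ω ω' : Tape m S} (h : Agree e c ω ω') (he : e' ≤ e)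
    (hc : c' ≤ c) : Agree e' c' ω ω' :=
  ⟨fun i hi => h.1 i (hi.trans_le he), fun q hq => h.2 q (hq.trans_le hc)⟩

variable {ω ω' : Tape AL.sampleSize S}

theorem testStat_congr {r : ℕ} (h : ∀ i < P.n, ω.1 (P.exStart r + i) = ω'.1 (P.exStart r + i))
    (κ g : I → ℝ) : testStat P AL ω r κ g = testStat P AL ω' r κ g :=
  Finset.sum_congr rfl fun i hi => by rw [h i (Finset.mem_range.mp hi)]

theorem fetchHyp_congr {q : ℕ} (h : ω.2.2 q = ω'.2.2 q) (κ : I → ℝ) :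
    fetchHyp P AL ω κ q = fetchHyp P AL ω' κ q := by
  rw [fetchHyp_eq, fetchHyp_eq, h]

theorem readHyp_congr {q : ℕ} (h : ω.2.2 q = ω'.2.2 q) (b : ℤˣ) :
    readHyp AL ω b q = readHyp AL ω' b q := by
  rw [readHyp_eq, readHyp_eq, h]

theorem testBit_congr {r e c q : ℕ} (h : Agree e c ω ω') (he : P.exStart r + P.n ≤ e)
    (hq : q < c) (κ : I → ℝ) : testBit P AL ω r κ (fetchHyp P AL ω κ q) =
      testBit P AL ω' r κ (fetchHyp P AL ω' κ q) := by
  rw [testBit, testBit, fetchHyp_congr (h.2 q hq), testStat_congr fun i hi => h.1 _ (by omega)]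

theorem walk_congr {r e c t : ℕ} (h : Agree e c ω ω') (he : P.exStart r + P.n + t ≤ e)
    (hc : P.callStart r + 1 + 2 * t ≤ c) (κ : I → ℝ) :
    walk P AL ω r κ t = walk P AL ω' r κ t := by
  induction t with
  | zero => rfl
  | succ t ih =>
    have ih := ih (by omega) (by omega)
    have hlt := (walk_fst_mem P AL ω' r κ t).2
    rw [walk, walk, ih]
    have ha : answer P AL ω r κ t (walk P AL ω' r κ t).1 =
        answer P AL ω' r κ t (walk P AL ω' r κ t).1 := by
      rw [answer, answer, testBit_congr h (by omega) (by omega), h.1 _ (by omega),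
        readHyp_congr (h.2 _ (by omega))]
    rw [ha]

theorem hist_congr {r e c : ℕ} (h : Agree e c ω ω') (he : P.exStart r ≤ e)
    (hc : P.callStart r ≤ c) : hist P AL ω r = hist P AL ω' r := by
  induction r with
  | zero => rfl
  | succ r ih =>
    have e1 : P.exStart (r + 1) = P.exStart r + P.n + P.R := by
      rw [Params.exStart, Params.exStart]; ring
    have e2 := callStart_succ P r
    have ih := ih (by omega) (by omega)
    have hlt := (walk_fst_mem P AL ω' r ((hist P AL ω' r).pred P.M r) P.R).2
    have hadd : ∀ H : Hist, H = hist P AL ω' r → addHyp P AL ω r H = addHyp P AL ω' r H := by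
      rintro H rfl
      rw [addHyp, addHyp, walk_congr h (by omega) (by omega), fetchHyp_congr (h.2 _ (by omega))]
    rw [hist, hist, ih, nextHist, nextHist, hadd _ rfl]
    have hst : roundStat P AL ω r (hist P AL ω' r) = roundStat P AL ω' r (hist P AL ω' r) := by
      funext l
      rw [roundStat, roundStat, hadd _ rfl, testStat_congr fun i hi => h.1 _ (by omega)]
    rw [hst]

theorem curPred_congr {r e c : ℕ} (h : Agree e c ω ω') (he : P.exStart r ≤ e)
    (hc : P.callStart r ≤ c) : curPred P AL ω r = curPred P AL ω' r := by
  rw [curPred, curPred, hist_congr h he hc]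

theorem stepBit_congr {r e c t : ℕ} (h : Agree e c ω ω') (he : P.exStart r + P.n + t ≤ e)
    (hc : P.callStart r + 1 + 2 * t ≤ c) : stepBit P AL ω r t = stepBit P AL ω' r t := by
  have hlt := (walk_fst_mem P AL ω' r (curPred P AL ω' r) t).2
  rw [stepBit, stepBit, curPred_congr h (by omega) (by omega), walk_congr h he hc,
    testBit_congr h (by omega) (by omega)]

theorem fetchOK_congr {C : Set (I → ℤˣ)} {η : ℝ} {r e c q : ℕ} (h : Agree e c ω ω')
    (he : P.exStart r ≤ e) (hc : P.callStart r ≤ c) (hq : ω.2.2 q = ω'.2.2 q) :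
    FetchOK P AL ω J C η (curPred P AL ω r) q ↔ FetchOK P AL ω' J C η (curPred P AL ω' r) q := by
  rw [FetchOK, FetchOK, curPred_congr h he hc, fetchHyp_congr hq]

theorem stepOK_congr {C : Set (I → ℤˣ)} {η : ℝ} {r e c t : ℕ} (h : Agree e c ω ω')
    (he : P.exStart r + P.n + t + 1 ≤ e) (hc : P.callStart r + 3 + 2 * t ≤ c) :
    StepOK P AL ω J C η r t ↔ StepOK P AL ω' J C η r t := by
  rw [StepOK, StepOK, fetchOK_congr h (by omega) (by omega) (h.2 _ (by omega)), readOK_iff,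
    readOK_iff, stepBit_congr h (by omega) (by omega), readHyp_congr (h.2 _ (by omega)),
    h.1 _ (by omega)]

end Rounds

end Omniprediction

end

noncomputable section

namespace Omniprediction

set_option linter.unusedSectionVars false

/-! ### Resampling -/

section Splice

open Classical in
/-- The sequence `x` with the entries at the places in `A` replaced by those of `y`. -/
def splice {X : Type*} (A : Set ℕ) (x y : ℕ → X) (i : ℕ) : X := if i ∈ A then y i else x i

variable {X : Type*} [MeasurableSpace X] (A : Set ℕ)

theorem splice_of_mem {A : Set ℕ} {i : ℕ} (h : i ∈ A) (x y : ℕ → X) : splice A x y i = y i :=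
  if_pos h

theorem splice_of_notMem {A : Set ℕ} {i : ℕ} (h : i ∉ A) (x y : ℕ → X) : splice A x y i = x i :=
  if_neg h

theorem measurable_splice : Measurable fun z : (ℕ → X) × (ℕ → X) => splice A z.1 z.2 := by
  refine measurable_pi_lambda _ fun i => ?_
  by_cases h : i ∈ A
  · simp only [splice_of_mem h]
    exact (measurable_pi_apply i).comp measurable_snd
  · simp only [splice_of_notMem h]
    exact (measurable_pi_apply i).comp measurable_fst

/-- An i.i.d. sequence keeps its law when some entries are replaced by those of an independent copy.
This takes the place of conditioning. -/
theorem measurePreserving_splice (μ : Measure X) [IsProbabilityMeasure μ] :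
    MeasurePreserving (fun z : (ℕ → X) × (ℕ → X) => splice A z.1 z.2)
      ((Measure.infinitePi fun _ => μ).prod (Measure.infinitePi fun _ => μ))
      (Measure.infinitePi fun _ => μ) := by
  classical
  refine ⟨measurable_splice A, Measure.eq_infinitePi _ fun s t ht => ?_⟩
  rw [Measure.map_apply (measurable_splice A)
    (MeasurableSet.pi s.countable_toSet fun i _ => ht i)]
  have : (fun z : (ℕ → X) × (ℕ → X) => splice A z.1 z.2) ⁻¹' Set.pi s t =
      Set.pi (s.filter (· ∉ A) : Finset ℕ) t ×ˢ Set.pi (s.filter (· ∈ A) : Finset ℕ) t := by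
    ext z
    simp only [Set.mem_preimage, Set.mem_pi, Set.mem_prod, Finset.coe_filter,
      Set.mem_ofPred_eq, Finset.mem_coe]
    constructor
    · exact fun h => ⟨fun i hi => by simpa only [splice_of_notMem hi.2] using h i hi.1,
        fun i hi => by simpa only [splice_of_mem hi.2] using h i hi.1⟩
    · intro h i hi
      by_cases hA : i ∈ A
      · simpa only [splice_of_mem hA] using h.2 i ⟨hi, hA⟩
      · simpa only [splice_of_notMem hA] using h.1 i ⟨hi, hA⟩
  rw [this, Measure.prod_prod, Measure.infinitePi_pi _ fun i _ => ht i,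
    Measure.infinitePi_pi _ fun i _ => ht i, mul_comm]
  exact Finset.prod_filter_mul_prod_filter_not s (· ∈ A) fun i => μ (t i)

end Splice

section Resample

variable {Ω B : Type*} [MeasurableSpace Ω] [MeasurableSpace B] {μ : Measure Ω} {ρ : Measure B}
  [IsProbabilityMeasure μ] [IsProbabilityMeasure ρ] {T : Ω → B → Ω}

theorem lintegral_resample (hT : MeasurePreserving (fun z : Ω × B => T z.1 z.2) (μ.prod ρ) μ)
    {F : Ω → ENNReal} (hF : Measurable F) : ∫⁻ ω, F ω ∂μ = ∫⁻ ω, ∫⁻ b, F (T ω b) ∂ρ ∂μ := by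
  rw [← hT.lintegral_comp hF]
  exact lintegral_prod _ (hF.comp hT.measurable).aemeasurable

/-- A bound valid for every old tape and random redraw holds unconditionally. -/
theorem measure_le_of_resample
    (hT : MeasurePreserving (fun z : Ω × B => T z.1 z.2) (μ.prod ρ) μ) {E : Set Ω}
    (hE : MeasurableSet E) {p : ENNReal} (h : ∀ ω, ρ {b | T ω b ∈ E} ≤ p) : μ E ≤ p := by
  have mT : ∀ ω, Measurable (T ω) := fun ω => hT.measurable.comp measurable_prodMk_left
  rw [← lintegral_indicator_one hE, lintegral_resample hT (measurable_one.indicator hE)]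
  calc _ = ∫⁻ ω, ρ {b | T ω b ∈ E} ∂μ := lintegral_congr fun ω =>
        lintegral_indicator_one (μ := ρ) (mT ω hE)
    _ ≤ ∫⁻ _, p ∂μ := lintegral_mono h
    _ = p := by simp

/-- `G` does not see the redrawn part, so given the rest of the tape the event keeps at least a
fraction `p` of it. Success is needed only where `G ≠ 0`, so earlier successes can be built into `G`
as indicators. -/
theorem le_lintegral_indicator_of_resample
    (hT : MeasurePreserving (fun z : Ω × B => T z.1 z.2) (μ.prod ρ) μ) {E : Set Ω}
    (hE : MeasurableSet E) {G : Ω → ENNReal} (hG : Measurable G)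
    (hGT : ∀ ω b, G (T ω b) = G ω) {p : ENNReal}
    (h : ∀ ω, G ω ≠ 0 → p ≤ ρ {b | T ω b ∈ E}) : p * ∫⁻ ω, G ω ∂μ ≤ ∫⁻ ω, E.indicator G ω ∂μ := by
  have mT : ∀ ω, Measurable (T ω) := fun ω => hT.measurable.comp measurable_prodMk_left
  rw [lintegral_resample hT (hG.indicator hE), ← lintegral_const_mul _ hG]
  refine lintegral_mono fun ω => ?_
  have e : ∀ b, E.indicator G (T ω b) = {b | T ω b ∈ E}.indicator (fun _ => G ω) b := by
    intro b
    classical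
    rw [Set.indicator_apply, Set.indicator_apply, hGT]
    rfl
  simp only [e]
  have hs : MeasurableSet {b | T ω b ∈ E} := mT ω hE
  rw [lintegral_indicator_const hs, mul_comm]
  rcases eq_or_ne (G ω) 0 with h0 | h0
  · simp [h0]
  · gcongr
    exact h ω h0

end Resample

/-! ### Redrawing examples and calls on the tape. -/

section TapeResample

variable {J : Measure (I × Bool)} [IsProbabilityMeasure J] {S : Type u} [MeasurableSpace S]
  {ν : Measure S} [IsProbabilityMeasure ν] {m : ℕ}

instance : IsProbabilityMeasure (callLaw J ν m) := by
  unfold callLaw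
  infer_instance

instance : IsProbabilityMeasure (tapeLaw J ν m) := by
  unfold tapeLaw
  infer_instance

/-- The tape with the examples at the places in `A` replaced. -/
def newExamples (A : Set ℕ) (ω : Tape m S) (b : ℕ → I × Bool) : Tape m S :=
  (splice A ω.1 b, ω.2)

/-- The tape with the randomness of the calls in `A` replaced. -/
def newCalls (A : Set ℕ) (ω : Tape m S) (b : ℕ → (Fin m → (I × Bool) × I) × S) : Tape m S :=
  (ω.1, ω.2.1, splice A ω.2.2 b)

theorem measurePreserving_newExamples (A : Set ℕ) :
    MeasurePreserving (fun z : Tape m S × (ℕ → I × Bool) => newExamples A z.1 z.2)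
      ((tapeLaw J ν m).prod (Measure.infinitePi fun _ => J)) (tapeLaw J ν m) := by
  set μ := Measure.infinitePi fun _ : ℕ => J
  have h1 : MeasurePreserving (fun z : (ℕ → I × Bool) × (ℕ → I × Bool) => splice A z.2 z.1)
      (μ.prod μ) μ := (measurePreserving_splice A J).comp Measure.measurePreserving_swap
  exact (h1.prod (MeasurePreserving.id _)).comp
    ((measurePreserving_prodAssoc μ μ _).symm.comp Measure.measurePreserving_swap)

theorem measurePreserving_newCalls (A : Set ℕ) :
    MeasurePreserving
      (fun z : Tape m S × (ℕ → (Fin m → (I × Bool) × I) × S) => newCalls A z.1 z.2)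
      ((tapeLaw J ν m).prod (Measure.infinitePi fun _ => callLaw J ν m)) (tapeLaw J ν m) := by
  set μ := Measure.infinitePi fun _ : ℕ => J
  set υ := Measure.infinitePi fun _ : ℕ => (volume : Measure I)
  set ξ := Measure.infinitePi fun _ : ℕ => callLaw J ν m with hξ
  have h1 : MeasurePreserving (fun z => splice A z.1 z.2) (ξ.prod ξ) ξ :=
    measurePreserving_splice A (callLaw J ν m)
  have : SFinite (υ.prod ξ) := inferInstance
  have : SFinite ((υ.prod ξ).prod ξ) := Measure.prod.instSFinite
  have h2 := ((MeasurePreserving.id υ).prod h1).comp (measurePreserving_prodAssoc υ ξ ξ)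
  exact ((MeasurePreserving.id μ).prod h2).comp (measurePreserving_prodAssoc μ (υ.prod ξ) ξ)

theorem agree_newExamples {A : Set ℕ} {e : ℕ} (h : ∀ i ∈ A, e ≤ i) (c : ℕ) (ω : Tape m S)
    (b : ℕ → I × Bool) : Agree e c (newExamples A ω b) ω :=
  ⟨fun i hi => splice_of_notMem (fun hA => (h i hA).not_gt hi) _ _, fun _ _ => rfl⟩

theorem agree_newCalls {A : Set ℕ} {c : ℕ} (h : ∀ q ∈ A, c ≤ q) (e : ℕ) (ω : Tape m S)
    (b : ℕ → (Fin m → (I × Bool) × I) × S) : Agree e c (newCalls A ω b) ω :=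
  ⟨fun _ _ => rfl, fun q hq => splice_of_notMem (fun hA => (h q hA).not_gt hq) _ _⟩

end TapeResample

end Omniprediction

end

noncomputable section

namespace Omniprediction

set_option linter.unusedSectionVars false

/-! ### The number of wrong steps -/

section Wrong

variable {P : Params} {S : Type u} [MeasurableSpace S] {AL : Learner S}
  {J : Measure (I × Bool)} [IsProbabilityMeasure J] {ν : Measure S} [IsProbabilityMeasure ν]
  {C C' : Set (I → ℤˣ)} {ε η : ℝ}

theorem ofReal_le_of_le_real {α : Type*} [MeasurableSpace α] {μ : Measure α} {s : Set α} {a : ℝ}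
    (h : a ≤ μ.real s) : ENNReal.ofReal a ≤ μ s :=
  (ENNReal.ofReal_le_ofReal h).trans ENNReal.ofReal_toReal_le

theorem infinitePi_eval {X : Type*} [MeasurableSpace X] (ρ : Measure X) [IsProbabilityMeasure ρ]
    (q : ℕ) {s : Set X} (hs : MeasurableSet s) :
    (Measure.infinitePi fun _ : ℕ => ρ) {b | b q ∈ s} = ρ s :=
  (measurePreserving_eval_infinitePi (fun _ : ℕ => ρ) q).measure_preimage hs.nullMeasurableSet

theorem measurableSet_labelErr (hc : C'.Countable) {z : I → Bool → I → ℤˣ}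
    (hz : Measurable fun x : (I × Bool) × I => z x.1.1 x.1.2 x.2) :
    MeasurableSet {c | ∀ f ∈ C', labelErr J z (relabelRun AL z c) ≤ labelErr J z f + ε} := by
  have : {c | ∀ f ∈ C', labelErr J z (relabelRun AL z c) ≤ labelErr J z f + ε} =
      ⋂ f ∈ C', {c | labelErr J z (relabelRun AL z c) ≤ labelErr J z f + ε} := by
    ext; simp
  rw [this]
  refine MeasurableSet.biInter hc fun f _ => measurableSet_le ?_ measurable_const
  have h : Measurable fun x : ((Fin AL.sampleSize → (I × Bool) × I) × S) × ((I × Bool) × I) =>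
      relabelRun AL z x.1 x.2.1.1 :=
    measurable_relabelRun (z := fun _ => z) (hz.comp measurable_snd) measurable_fst
      (measurable_fst.comp (measurable_fst.comp measurable_snd))
  exact (measurable_measure_prodMk_left
    (measurableSet_eq_fun h (hz.comp measurable_snd)).compl).ennreal_toReal

theorem learner_call_success (hAL : IsAgnosticLearner ν AL ε C) (hC : C' ⊆ C)
    (hc : C'.Countable) {z : I → Bool → I → ℤˣ}
    (hz : Measurable fun x : (I × Bool) × I => z x.1.1 x.1.2 x.2) (hm : ∀ f ∈ C', Measurable f)
    (q : ℕ) : ENNReal.ofReal (9 / 10) ≤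
      (Measure.infinitePi fun _ : ℕ => callLaw J ν AL.sampleSize)
        {b | ∀ f ∈ C', labelErr J z (relabelRun AL z (b q)) ≤ labelErr J z f + ε} :=
  (ofReal_le_of_le_real (learner_success (J := J) hAL hC hc hz hm)).trans
    (infinitePi_eval _ q (measurableSet_labelErr (J := J) (AL := AL) hc hz)).ge

/-- The predictor of round `r` does not depend on the redrawn call, so for a fixed rest of the tape
the learner faces one fixed distribution of labels. The factor `2M` converts error into scaled
correlation. -/
theorem fetch_success (hM : 0 < P.M) (hAL : IsAgnosticLearner ν AL ε C) (hC : C' ⊆ C)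
    (hc : C'.Countable) (hm : ∀ f ∈ C', Measurable f) {r q : ℕ} (hq : P.callStart r ≤ q)
    (ω : Tape AL.sampleSize S) :
    ENNReal.ofReal (9 / 10) ≤ (Measure.infinitePi fun _ : ℕ => callLaw J ν AL.sampleSize)
      {b | newCalls {q} ω b ∈
        {ω | FetchOK P AL ω J C' (2 * P.M * ε) (curPred P AL ω r) q}} := by
  have mκ : Measurable (curPred P AL ω r) := measurable_curPred_apply ω r
  have hκ : ∀ p, 0 ≤ curPred P AL ω r p ∧ curPred P AL ω r p ≤ P.M := curPred_mem P AL ω r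
  have hz : Measurable fun x : (I × Bool) × I =>
      residualLabel P.M (curPred P AL ω r) x.1.1 x.1.2 x.2 :=
    measurable_residualLabel (mκ.comp (measurable_fst.comp measurable_fst))
      (measurable_snd.comp measurable_fst) measurable_snd
  refine (learner_call_success hAL hC hc hz hm q).trans (measure_mono fun b hb => ?_)
  have hcur : curPred P AL (newCalls {q} ω b) r = curPred P AL ω r :=
    curPred_congr (agree_newCalls (c := P.callStart r)
      (by rintro _ rfl; exact hq) (P.exStart r) ω b) le_rfl le_rfl
  have hcall : (newCalls {q} ω b).2.2 q = b q := splice_of_mem rfl _ _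
  change FetchOK _ _ _ _ _ _ _ _
  rw [hcur]
  intro f hf
  have h := hb f hf
  rw [fetchHyp_eq, hcall]
  have mh : Measurable (relabelRun AL (residualLabel P.M (curPred P AL ω r)) (b q)) :=
    measurable_relabelRun (α := I) (z := fun _ => residualLabel P.M (curPred P AL ω r))
      (c := fun _ => b q) (p := fun p => p) (hz.comp measurable_snd) measurable_const
      measurable_id
  rw [labelErr_residualLabel hM mκ hκ mh, labelErr_residualLabel hM mκ hκ (hm f hf)] at h
  have hM' : (0 : ℝ) < P.M := Nat.cast_pos.mpr hM
  set a := corr J P.M (curPred P AL ω r) fun p => lab (f p)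
  set a' := corr J P.M (curPred P AL ω r) fun p =>
    lab (relabelRun AL (residualLabel P.M (curPred P AL ω r)) (b q) p)
  have h2 : a / (2 * P.M) ≤ a' / (2 * P.M) + ε := by linarith
  have h3 : a / (2 * P.M) * (2 * P.M) = a := by field_simp
  have h4 : a' / (2 * P.M) * (2 * P.M) = a' := by field_simp
  nlinarith

/-- The bit to be transmitted is fixed before the call, and the constant hypothesis has error 0, so
the returned one errs on at most a third of the points. -/
theorem read_success (hAL : IsAgnosticLearner ν AL ε C) (hC : ∀ b : ℤˣ, (fun _ => b) ∈ C)
    (hε : ε ≤ 1 / 3) (r t : ℕ) (ω : Tape AL.sampleSize S) :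
    ENNReal.ofReal (9 / 10) ≤ (Measure.infinitePi fun _ : ℕ => callLaw J ν AL.sampleSize)
      {b | newCalls {P.callStart r + 1 + 2 * t} ω b ∈ {ω | ReadGood P AL ω J r t}} := by
  set q := P.callStart r + 1 + 2 * t with hq
  set b0 := stepBit P AL ω r t with hb0
  refine (learner_call_success hAL (Set.singleton_subset_iff.mpr (hC b0))
    (Set.countable_singleton _) (z := fun _ _ _ => b0) measurable_const
    (by rintro _ rfl; exact measurable_const) q).trans (measure_mono fun b hb => ?_)
  have hbit : stepBit P AL (newCalls {q} ω b) r t = b0 :=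
    stepBit_congr (agree_newCalls (c := q) (by rintro _ rfl; exact le_rfl)
      (P.exStart r + P.n + t) ω b) le_rfl le_rfl
  have hcall : (newCalls {q} ω b).2.2 q = b q := splice_of_mem rfl _ _
  change ReadGood _ _ _ _ _ _
  have h := hb _ rfl
  rw [labelErr_const, labelErr_const] at h
  rw [ReadGood, hbit, ← hq, readHyp_eq, hcall]
  simp only [ne_eq, not_true_eq_false, Set.ofPred_false, measureReal_empty, zero_add] at h
  exact h.trans hε

/-- The point at which the bit is read is a fresh example, used for nothing else. -/
theorem answer_success (r t : ℕ) {ω : Tape AL.sampleSize S} (h : ReadGood P AL ω J r t) :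
    ENNReal.ofReal (2 / 3) ≤ (Measure.infinitePi fun _ : ℕ => J)
      {b | newExamples {P.exStart r + P.n + t} ω b ∈ {ω | ReadOK P AL ω r t}} := by
  set i := P.exStart r + P.n + t with hi
  set h0 := readHyp AL ω (stepBit P AL ω r t) (P.callStart r + 1 + 2 * t) with hh0
  have mh : Measurable h0 := (measurable_readHyp _ _).comp (measurable_prodMk_left (x := ω))
  have ms : MeasurableSet {x : I × Bool | h0 x.1 ≠ stepBit P AL ω r t} :=
    (measurableSet_eq_fun (mh.comp measurable_fst) measurable_const).compl
  have h1 : 2 / 3 ≤ J.real {x | h0 x.1 ≠ stepBit P AL ω r t}ᶜ := by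
    rw [probReal_compl_eq_one_sub ms]
    have : J.real {x | h0 x.1 ≠ stepBit P AL ω r t} ≤ 1 / 3 := h
    linarith
  refine ((ofReal_le_of_le_real h1).trans (infinitePi_eval J i ms.compl).ge).trans
    (measure_mono fun b hb => ?_)
  have hbit : stepBit P AL (newExamples {i} ω b) r t = stepBit P AL ω r t :=
    stepBit_congr (agree_newExamples (e := i) (by rintro _ rfl; exact le_rfl)
      (P.callStart r + 1 + 2 * t) ω b) le_rfl le_rfl
  have hex : (newExamples {i} ω b).1 i = b i := splice_of_mem rfl _ _
  change ReadOK _ _ _ _ _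
  rw [readOK_iff, hbit, ← hi, hex]
  exact not_not.mp hb

/-- The number of wrong steps before step `T` of round `r`. -/
def wrongBefore (P : Params) (AL : Learner S) (J : Measure (I × Bool)) (C : Set (I → ℤˣ)) (η : ℝ)
    (r T : ℕ) (ω : Tape AL.sampleSize S) : ℕ :=
  ∑ q ∈ Finset.range r, wrongCount P AL ω J C η q P.R + wrongCount P AL ω J C η r T

theorem wrongBefore_round (r : ℕ) (ω : Tape AL.sampleSize S) :
    wrongBefore P AL J C η (r + 1) 0 ω = wrongBefore P AL J C η r P.R ω := by
  simp [wrongBefore, Finset.sum_range_succ, wrongCount]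

open Classical in
theorem wrongBefore_succ (r T : ℕ) (ω : Tape AL.sampleSize S) :
    wrongBefore P AL J C η r (T + 1) ω =
      wrongBefore P AL J C η r T ω + if StepOK P AL ω J C η r T then 0 else 1 := by
  rw [wrongBefore, wrongBefore, wrongCount, wrongCount, Finset.sum_range_succ, add_assoc]

theorem measurableSet_stepOK (hC : C.Countable) (hm : ∀ f ∈ C, Measurable f) (r t : ℕ) :
    MeasurableSet {ω : Tape AL.sampleSize S | StepOK P AL ω J C η r t} :=
  (measurableSet_fetchOK hC hm η r (P.callStart r + 2 + 2 * t)).inter (measurableSet_readOK r t)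

theorem measurable_wrongCount (hC : C.Countable) (hm : ∀ f ∈ C, Measurable f) (r T : ℕ) :
    Measurable fun ω : Tape AL.sampleSize S => wrongCount P AL ω J C η r T :=
  Finset.measurable_sum _ fun t _ =>
    Measurable.ite (measurableSet_stepOK hC hm r t) measurable_const measurable_const

theorem measurable_wrongBefore (hC : C.Countable) (hm : ∀ f ∈ C, Measurable f) (r T : ℕ) :
    Measurable (wrongBefore P AL J C η r T) :=
  (Finset.measurable_sum _ fun q _ => measurable_wrongCount hC hm q P.R).add
    (measurable_wrongCount hC hm r T)

theorem wrongCount_congr {ω ω' : Tape AL.sampleSize S} {r e c T : ℕ} (h : Agree e c ω ω')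
    (he : P.exStart r + P.n + T ≤ e) (hc : P.callStart r + 1 + 2 * T ≤ c) :
    wrongCount P AL ω J C η r T = wrongCount P AL ω' J C η r T := by
  classical
  refine Finset.sum_congr rfl fun t ht => ?_
  have := Finset.mem_range.mp ht
  exact if_congr (stepOK_congr h (by omega) (by omega)) rfl rfl

theorem exStart_succ (P : Params) (r : ℕ) : P.exStart (r + 1) = P.exStart r + P.n + P.R := by
  rw [Params.exStart, Params.exStart]; ring

theorem exStart_mono (P : Params) {q r : ℕ} (h : q ≤ r) : P.exStart q ≤ P.exStart r :=
  Nat.mul_le_mul_right _ h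

theorem wrongBefore_congr {ω ω' : Tape AL.sampleSize S} {r T : ℕ}
    (h : Agree (P.exStart r + P.n + T) (P.callStart r + 1 + 2 * T) ω ω') :
    wrongBefore P AL J C η r T ω = wrongBefore P AL J C η r T ω' := by
  rw [wrongBefore, wrongBefore, wrongCount_congr h le_rfl le_rfl]
  congr 1
  refine Finset.sum_congr rfl fun q hq => ?_
  have hq := Finset.mem_range.mp hq
  have h1 := exStart_mono P (show q + 1 ≤ r from hq)
  have h2 := callStart_mono P (show q + 1 ≤ r from hq)
  rw [exStart_succ] at h1
  rw [callStart_succ] at h2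
  exact wrongCount_congr h (by omega) (by omega)

theorem readGood_congr {ω ω' : Tape AL.sampleSize S} {r t : ℕ}
    (h : Agree (P.exStart r + P.n + t) (P.callStart r + 2 + 2 * t) ω ω') :
    ReadGood P AL ω J r t ↔ ReadGood P AL ω' J r t := by
  rw [ReadGood, ReadGood, stepBit_congr h le_rfl (by omega), readHyp_congr (h.2 _ (by omega))]

variable (P AL J) in
/-- The exponential weight of the wrong steps before step `T` of round `r`. -/
def weight (C : Set (I → ℤˣ)) (η : ℝ) (r T : ℕ) (ω : Tape AL.sampleSize S) : ENNReal :=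
  ENNReal.ofReal ((11 / 10) ^ wrongBefore P AL J C η r T ω)

theorem measurable_weight (hC : C.Countable) (hm : ∀ f ∈ C, Measurable f) (r T : ℕ) :
    Measurable (weight P AL J C η r T) :=
  (measurable_of_countable fun k : ℕ => ENNReal.ofReal ((11 / 10) ^ k)).comp
    (measurable_wrongBefore hC hm r T)

/-- A wrong step multiplies the weight by `11/10`, a right step by 1. The difference is written as a
summand to avoid subtraction of extended nonnegative reals. -/
theorem weight_succ (r T : ℕ) (ω : Tape AL.sampleSize S) :
    weight P AL J C η r (T + 1) ω + ENNReal.ofReal (1 / 10) *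
      {ω | StepOK P AL ω J C η r T}.indicator (weight P AL J C η r T) ω =
      ENNReal.ofReal (11 / 10) * weight P AL J C η r T ω := by
  classical
  rw [Set.indicator_apply, weight, weight, wrongBefore_succ, ← ENNReal.ofReal_mul (by norm_num)]
  by_cases h : StepOK P AL ω J C η r T
  · rw [if_pos h, if_pos (show ω ∈ {ω | StepOK P AL ω J C η r T} from h),
      ← ENNReal.ofReal_mul (by norm_num), ← ENNReal.ofReal_add (by positivity) (by positivity)]
    congr 1
    ring
  · rw [if_neg h, if_neg (show ω ∉ {ω | StepOK P AL ω J C η r T} from h), mul_zero, add_zero,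
      pow_succ, mul_comm]

/-- Given the past, a step is right with probability at least `9/10 · 9/10 · 2/3 = 0.54`, which
exceeds one half. -/
theorem lintegral_indicator_stepOK (hM : 0 < P.M) (hAL : IsAgnosticLearner ν AL ε C)
    (hk : ∀ b : ℤˣ, (fun _ => b) ∈ C) (hε : ε ≤ 1 / 3) (hC : C' ⊆ C) (hc : C'.Countable)
    (hm : ∀ f ∈ C', Measurable f) (r T : ℕ) :
    ENNReal.ofReal (54 / 100) *
        ∫⁻ ω, weight P AL J C' (2 * P.M * ε) r T ω ∂tapeLaw J ν AL.sampleSize ≤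
      ∫⁻ ω, {ω | StepOK P AL ω J C' (2 * P.M * ε) r T}.indicator
        (weight P AL J C' (2 * P.M * ε) r T) ω ∂tapeLaw J ν AL.sampleSize := by
  set G := weight P AL J C' (2 * P.M * ε) r T with hG
  set E1 := {ω : Tape AL.sampleSize S | ReadGood P AL ω J r T} with hE1
  set E2 := {ω : Tape AL.sampleSize S | FetchOK P AL ω J C' (2 * P.M * ε) (curPred P AL ω r)
    (P.callStart r + 2 + 2 * T)} with hE2
  set E3 := {ω : Tape AL.sampleSize S | ReadOK P AL ω r T} with hE3
  have mG : Measurable G := measurable_weight hc hm r T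
  have m1 : MeasurableSet E1 := measurableSet_readGood r T
  have m2 : MeasurableSet E2 := measurableSet_fetchOK hc hm _ r _
  have m3 : MeasurableSet E3 := measurableSet_readOK r T
  have cG : ∀ {ω ω' : Tape AL.sampleSize S},
      Agree (P.exStart r + P.n + T) (P.callStart r + 1 + 2 * T) ω ω' → G ω = G ω' :=
    fun h => by rw [hG, weight, weight, wrongBefore_congr h]
  have c1 : ∀ {ω ω' : Tape AL.sampleSize S},
      Agree (P.exStart r + P.n + T) (P.callStart r + 2 + 2 * T) ω ω' →
        E1.indicator G ω = E1.indicator G ω' := fun {ω ω'} h => by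
    classical
    rw [Set.indicator_apply, Set.indicator_apply, cG (h.mono le_rfl (by omega))]
    exact if_congr (readGood_congr h) rfl rfl
  have c2 : ∀ {ω ω' : Tape AL.sampleSize S},
      Agree (P.exStart r + P.n + T) (P.callStart r + 3 + 2 * T) ω ω' →
        E2.indicator (E1.indicator G) ω = E2.indicator (E1.indicator G) ω' := fun {ω ω'} h => by
    classical
    rw [Set.indicator_apply E2, Set.indicator_apply E2, c1 (h.mono le_rfl (by omega))]
    exact if_congr (fetchOK_congr h (by omega) (by omega) (h.2 _ (by omega))) rfl rfl
  -- The draws of a step are treated in the order reading call, fetching call, query point. Each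
  -- factor already collected is unaffected by the draws still to come.
  have s1 := le_lintegral_indicator_of_resample
    (measurePreserving_newCalls (J := J) (ν := ν) {P.callStart r + 1 + 2 * T}) m1 mG
    (fun ω b => cG (agree_newCalls (by rintro _ rfl; exact le_rfl) _ ω b))
    (fun ω _ => read_success hAL hk hε r T ω)
  have s2 := le_lintegral_indicator_of_resample
    (measurePreserving_newCalls (J := J) (ν := ν) {P.callStart r + 2 + 2 * T}) m2
    (mG.indicator m1) (fun ω b => c1 (agree_newCalls (by rintro _ rfl; exact le_rfl) _ ω b))
    (fun ω _ => fetch_success hM hAL hC hc hm (by omega) ω)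
  have s3 := le_lintegral_indicator_of_resample
    (measurePreserving_newExamples (J := J) (ν := ν) {P.exStart r + P.n + T}) m3
    ((mG.indicator m1).indicator m2)
    (fun ω b => c2 (agree_newExamples (by rintro _ rfl; exact le_rfl) _ ω b))
    (fun ω h0 => answer_success r T (by
      have h1 := Set.mem_of_indicator_ne_zero h0
      rw [Set.indicator_of_mem h1] at h0
      have h2 : ω ∈ E1 := Set.mem_of_indicator_ne_zero h0
      exact h2))
  calc _ = ENNReal.ofReal (2 / 3) * (ENNReal.ofReal (9 / 10) * (ENNReal.ofReal (9 / 10) *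
        ∫⁻ ω, G ω ∂tapeLaw J ν AL.sampleSize)) := by
        rw [← mul_assoc, ← mul_assoc, ← ENNReal.ofReal_mul (by norm_num),
          ← ENNReal.ofReal_mul (by norm_num),
          show (2 / 3 * (9 / 10) * (9 / 10) : ℝ) = 54 / 100 by norm_num]
    _ ≤ ENNReal.ofReal (2 / 3) * (ENNReal.ofReal (9 / 10) *
        ∫⁻ ω, E1.indicator G ω ∂tapeLaw J ν AL.sampleSize) := by gcongr
    _ ≤ ENNReal.ofReal (2 / 3) *
        ∫⁻ ω, E2.indicator (E1.indicator G) ω ∂tapeLaw J ν AL.sampleSize := by gcongr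
    _ ≤ ∫⁻ ω, E3.indicator (E2.indicator (E1.indicator G)) ω ∂tapeLaw J ν AL.sampleSize := s3
    _ ≤ _ := lintegral_mono fun ω => by
      classical
      by_cases h3 : ω ∈ E3
      · by_cases h2 : ω ∈ E2
        · rw [Set.indicator_of_mem h3, Set.indicator_of_mem h2,
            Set.indicator_of_mem (show ω ∈ {ω | StepOK P AL ω J C' (2 * P.M * ε) r T} from
              ⟨h2, h3⟩)]
          exact Set.indicator_le_self _ _ _
        · rw [Set.indicator_of_mem h3, Set.indicator_of_notMem h2]
          exact zero_le
      · rw [Set.indicator_of_notMem h3]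
        exact zero_le

/-- The growth factor is `1.1 - 0.1 · 0.54 = 1.046`. Finiteness of the integral is needed to cancel
a summand. -/
theorem lintegral_weight_succ (hM : 0 < P.M) (hAL : IsAgnosticLearner ν AL ε C)
    (hk : ∀ b : ℤˣ, (fun _ => b) ∈ C) (hε : ε ≤ 1 / 3) (hC : C' ⊆ C) (hc : C'.Countable)
    (hm : ∀ f ∈ C', Measurable f) {r T : ℕ}
    (hfin : ∫⁻ ω, weight P AL J C' (2 * P.M * ε) r T ω ∂tapeLaw J ν AL.sampleSize ≠ ⊤) :
    ∫⁻ ω, weight P AL J C' (2 * P.M * ε) r (T + 1) ω ∂tapeLaw J ν AL.sampleSize ≤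
      ENNReal.ofReal (1046 / 1000) *
        ∫⁻ ω, weight P AL J C' (2 * P.M * ε) r T ω ∂tapeLaw J ν AL.sampleSize := by
  have h := lintegral_indicator_stepOK (J := J) hM hAL hk hε hC hc hm r T
  have m := measurable_weight (P := P) (AL := AL) (J := J) (η := 2 * P.M * ε) hc hm r T
  have ms := measurableSet_stepOK (P := P) (AL := AL) (J := J) (η := 2 * P.M * ε) hc hm r T
  set a := ∫⁻ ω, weight P AL J C' (2 * P.M * ε) r T ω ∂tapeLaw J ν AL.sampleSize with ha
  have key : ∫⁻ ω, weight P AL J C' (2 * P.M * ε) r (T + 1) ω ∂tapeLaw J ν AL.sampleSize +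
      ENNReal.ofReal (1 / 10) * ∫⁻ ω, {ω | StepOK P AL ω J C' (2 * P.M * ε) r T}.indicator
        (weight P AL J C' (2 * P.M * ε) r T) ω ∂tapeLaw J ν AL.sampleSize =
      ENNReal.ofReal (11 / 10) * a := by
    rw [ha, ← lintegral_const_mul _ m, ← lintegral_const_mul _ (m.indicator ms),
      ← lintegral_add_left (measurable_weight hc hm r (T + 1))]
    exact lintegral_congr fun ω => weight_succ r T ω
  refine ENNReal.le_of_add_le_add_right (a := ENNReal.ofReal (54 / 1000) * a)
    (ENNReal.mul_ne_top ENNReal.ofReal_ne_top hfin) ?_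
  rw [← add_mul, ← ENNReal.ofReal_add (by norm_num) (by norm_num),
    show (1046 / 1000 + 54 / 1000 : ℝ) = 11 / 10 by norm_num, ← key,
    show (54 / 1000 : ℝ) = 1 / 10 * (54 / 100) by norm_num, ENNReal.ofReal_mul (by norm_num),
    mul_assoc (ENNReal.ofReal (1 / 10))]
  exact add_le_add le_rfl (mul_le_mul_right h _)

theorem lintegral_weight_le (hM : 0 < P.M) (hAL : IsAgnosticLearner ν AL ε C)
    (hk : ∀ b : ℤˣ, (fun _ => b) ∈ C) (hε : ε ≤ 1 / 3) (hC : C' ⊆ C) (hc : C'.Countable)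
    (hm : ∀ f ∈ C', Measurable f) (r T : ℕ) :
    ∫⁻ ω, weight P AL J C' (2 * P.M * ε) r T ω ∂tapeLaw J ν AL.sampleSize ≤
      ENNReal.ofReal (1046 / 1000) ^ (r * P.R + T) := by
  have step : ∀ r a, (∫⁻ ω, weight P AL J C' (2 * P.M * ε) r 0 ω ∂tapeLaw J ν AL.sampleSize ≤
      ENNReal.ofReal (1046 / 1000) ^ a) → ∀ T,
      ∫⁻ ω, weight P AL J C' (2 * P.M * ε) r T ω ∂tapeLaw J ν AL.sampleSize ≤
        ENNReal.ofReal (1046 / 1000) ^ (a + T) := by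
    intro r a h0 T
    induction T with
    | zero => exact h0
    | succ T ih =>
      refine (lintegral_weight_succ hM hAL hk hε hC hc hm (ne_top_of_le_ne_top
        (ENNReal.pow_ne_top ENNReal.ofReal_ne_top) ih)).trans ?_
      rw [← add_assoc, pow_succ']
      exact mul_le_mul_right ih _
  refine step r _ ?_ T
  induction r with
  | zero =>
    have h : ∀ ω, weight P AL J C' (2 * P.M * ε) 0 0 ω = 1 := fun ω => by
      simp [weight, wrongBefore, wrongCount]
    rw [lintegral_congr h, lintegral_const, measure_univ, one_mul, Nat.zero_mul]
    exact (pow_zero _).ge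
  | succ r ih =>
    have := step r _ ih P.R
    simp only [weight, wrongBefore_round] at this ⊢
    rwa [Nat.succ_mul]

/-- Markov's inequality for the weight after `500 k` steps. The allowed fraction of wrong steps,
0.49, lies between the expected bound 0.46 and the one half that the walk can bear; the gap pays for
the non-quiet rounds. -/
theorem measure_wrong_le (hM : 0 < P.M) (hAL : IsAgnosticLearner ν AL ε C)
    (hk : ∀ b : ℤˣ, (fun _ => b) ∈ C) (hε : ε ≤ 1 / 3) (hC : C' ⊆ C) (hc : C'.Countable)
    (hm : ∀ f ∈ C', Measurable f) {k : ℕ} (hN : P.N * P.R = 500 * k) :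
    tapeLaw J ν AL.sampleSize {ω | 245 * k ≤
      ∑ r ∈ Finset.range P.N, wrongCount P AL ω J C' (2 * P.M * ε) r P.R} ≤
      ENNReal.ofReal ((1 / 2) ^ k) := by
  have h := lintegral_weight_le (P := P) (J := J) hM hAL hk hε hC hc hm P.N 0
  rw [add_zero, hN] at h
  have hset : {ω : Tape AL.sampleSize S | 245 * k ≤
      ∑ r ∈ Finset.range P.N, wrongCount P AL ω J C' (2 * P.M * ε) r P.R} ⊆
      {ω | ENNReal.ofReal ((11 / 10) ^ (245 * k)) ≤ weight P AL J C' (2 * P.M * ε) P.N 0 ω} := by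
    intro ω hω
    have h1 : wrongBefore P AL J C' (2 * P.M * ε) P.N 0 ω =
        ∑ r ∈ Finset.range P.N, wrongCount P AL ω J C' (2 * P.M * ε) r P.R := by
      simp [wrongBefore, wrongCount]
    change _ ≤ ENNReal.ofReal _
    rw [h1]
    exact ENNReal.ofReal_le_ofReal (pow_le_pow_right₀ (by norm_num) hω)
  refine (measure_mono hset).trans ?_
  have hpos : 0 < ((11 / 10 : ℝ)) ^ (245 * k) := by positivity
  have mk := mul_meas_ge_le_lintegral₀ (μ := tapeLaw J ν AL.sampleSize)
    (measurable_weight (P := P) (AL := AL) (J := J) (η := 2 * P.M * ε) hc hm P.N 0).aemeasurable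
    (ENNReal.ofReal ((11 / 10) ^ (245 * k)))
  have h2 := mk.trans h
  rw [← ENNReal.ofReal_pow (by norm_num)] at h2
  have h3 : ((1046 / 1000 : ℝ)) ^ (500 * k) ≤ (11 / 10) ^ (245 * k) * (1 / 2) ^ k := by
    rw [pow_mul, pow_mul, ← mul_pow]
    refine pow_le_pow_left₀ (by positivity) ?_ k
    -- Checked for a fifth of the exponents, which keeps the numerals small; `0.85⁵ < 1/2`.
    have h5 : (1046 / 1000 : ℝ) ^ 100 ≤ (11 / 10) ^ 49 * (85 / 100) := by norm_num
    calc (1046 / 1000 : ℝ) ^ 500 = ((1046 / 1000) ^ 100) ^ 5 := by rw [← pow_mul]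
      _ ≤ ((11 / 10) ^ 49 * (85 / 100)) ^ 5 := pow_le_pow_left₀ (by positivity) h5 5
      _ = (11 / 10) ^ 245 * (85 / 100) ^ 5 := by rw [mul_pow, ← pow_mul]
      _ ≤ (11 / 10) ^ 245 * (1 / 2) :=
        mul_le_mul_of_nonneg_left (by norm_num) (by positivity)
  have h4 := h2.trans (ENNReal.ofReal_le_ofReal h3)
  rw [ENNReal.ofReal_mul hpos.le] at h4
  exact (ENNReal.mul_le_mul_iff_right (ENNReal.ofReal_pos.mpr hpos).ne'
    ENNReal.ofReal_ne_top).mp h4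

end Wrong

end Omniprediction

end

noncomputable section

namespace Omniprediction

set_option linter.unusedSectionVars false

/-! ### The accuracy of the tests -/

section Concentration

variable {J : Measure (I × Bool)} [IsProbabilityMeasure J]

open ProbabilityTheory in
-- Hoeffding's inequality: a variable with values in `[-M, M]` is sub-Gaussian with parameter `M²`
-- after centering.
theorem one_sided_tail {X : Type*} [MeasurableSpace X] (ρ : Measure X) [IsProbabilityMeasure ρ]
    {φ : X → ℝ} (hφ : Measurable φ) {M : ℝ} (hM : 0 ≤ M) (hb : ∀ x, |φ x| ≤ M) (e n : ℕ) :
    (Measure.infinitePi fun _ : ℕ => ρ).real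
      {b | (n : ℝ) ≤ ∑ i ∈ Finset.range n, (φ (b (e + i)) - ∫ x, φ x ∂ρ)} ≤
      Real.exp (-(n : ℝ) ^ 2 / (2 * n * M ^ 2)) := by
  set μ := Measure.infinitePi fun _ : ℕ => ρ with hμ
  have mY : ∀ i, Measurable fun b : ℕ → X => φ (b i) := fun i => hφ.comp (measurable_pi_apply i)
  have hint : ∀ i, ∫ b, φ (b i) ∂μ = ∫ x, φ x ∂ρ := fun i => by
    rw [← (measurePreserving_eval_infinitePi (fun _ : ℕ => ρ) i).map_eq,
      integral_map (measurable_pi_apply i).aemeasurable hφ.aestronglyMeasurable]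
  have hind : iIndepFun (fun (i : ℕ) (b : ℕ → X) => φ (b (e + i)) - ∫ x, φ x ∂ρ) μ := by
    have h1 : iIndepFun (fun (i : ℕ) (b : ℕ → X) => φ (b i) - ∫ x, φ x ∂ρ) μ :=
      iIndepFun_infinitePi (P := fun _ : ℕ => ρ) (X := fun _ x => φ x - ∫ x, φ x ∂ρ)
        fun _ => hφ.sub_const _
    exact h1.precomp (g := fun i => e + i) fun i j h => Nat.add_left_cancel h
  have hsub : ∀ i < n, HasSubgaussianMGF (fun b : ℕ → X => φ (b (e + i)) - ∫ x, φ x ∂ρ)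
      (⟨M, hM⟩ ^ 2) μ := fun i _ => by
    have h := hasSubgaussianMGF_of_mem_Icc (μ := μ) (mY (e + i)).aemeasurable (a := -M) (b := M)
      (Filter.Eventually.of_forall fun b => abs_le.mp (hb _))
    rw [hint] at h
    convert h using 2
    ext
    push_cast
    rw [Real.norm_of_nonneg (by linarith)]
    change M ^ 2 = _
    ring
  have h := HasSubgaussianMGF.measure_sum_range_ge_le_of_iIndepFun hind hsub (Nat.cast_nonneg n)
  exact h

theorem two_sided_tail {X : Type*} [MeasurableSpace X] (ρ : Measure X) [IsProbabilityMeasure ρ]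
    {φ : X → ℝ} (hφ : Measurable φ) {M : ℝ} (hM : 0 ≤ M) (hb : ∀ x, |φ x| ≤ M) (e n : ℕ) :
    (Measure.infinitePi fun _ : ℕ => ρ)
      {b | (n : ℝ) ≤ |∑ i ∈ Finset.range n, φ (b (e + i)) - n * ∫ x, φ x ∂ρ|} ≤
      ENNReal.ofReal (2 * Real.exp (-(n : ℝ) ^ 2 / (2 * n * M ^ 2))) := by
  have h1 := one_sided_tail ρ hφ hM hb e n
  have h2 := one_sided_tail ρ hφ.neg hM (fun x => by rw [Pi.neg_apply, abs_neg]; exact hb x) e n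
  refine ENNReal.le_ofReal_iff_toReal_le (measure_ne_top _ _) (by positivity) |>.mpr ?_
  have hset : {b : ℕ → X | (n : ℝ) ≤ |∑ i ∈ Finset.range n, φ (b (e + i)) - n * ∫ x, φ x ∂ρ|} ⊆
      {b | (n : ℝ) ≤ ∑ i ∈ Finset.range n, (φ (b (e + i)) - ∫ x, φ x ∂ρ)} ∪
      {b | (n : ℝ) ≤ ∑ i ∈ Finset.range n, ((-φ) (b (e + i)) - ∫ x, (-φ) x ∂ρ)} := by
    intro b hb
    rcases le_abs.mp (show (n : ℝ) ≤ |_| from hb) with h | h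
    · left
      simpa [Finset.sum_sub_distrib] using h
    · right
      simp only [Set.mem_ofPred_eq, Pi.neg_apply, integral_neg, Finset.sum_sub_distrib,
        Finset.sum_neg_distrib, Finset.sum_const, Finset.card_range, nsmul_eq_mul] at h ⊢
      linarith
  refine (measureReal_mono hset).trans ((measureReal_union_le _ _).trans ?_)
  linarith

variable {P : Params} {S : Type u} [MeasurableSpace S] {AL : Learner S} {ν : Measure S}
  [IsProbabilityMeasure ν]

theorem testFun_congr {ω ω' : Tape AL.sampleSize S} {r j l : ℕ}
    (h : Agree (P.exStart r) (P.callStart r + j + 1) ω ω') :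
    testFun P AL r j l ω = testFun P AL r j l ω' := by
  rw [testFun, testFun, hist_congr h le_rfl (by omega), curPred_congr h le_rfl (by omega),
    fetchHyp_congr (h.2 _ (by omega))]

/-- The tapes on which test `l` with the hypothesis of call `j` of round `r` is inaccurate. -/
def badTest (P : Params) (AL : Learner S) (J : Measure (I × Bool)) (r j l : ℕ) :
    Set (Tape AL.sampleSize S) :=
  {ω | (P.n : ℝ) ≤ |testStat P AL ω r (curPred P AL ω r) (testFun P AL r j l ω) -
    P.n * corr J P.M (curPred P AL ω r) (testFun P AL r j l ω)|}

theorem measurableSet_badTest (r j l : ℕ) : MeasurableSet (badTest P AL J r j l) := by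
  have h1 := measurable_testStat (P := P) (κ := fun ω : Tape AL.sampleSize S => curPred P AL ω r)
    (g := fun ω => testFun P AL r j l ω) (measurable_curPred r) (measurable_testFun r j l) r
  have h2 := measurable_corr (J := J) (M := P.M)
    (κ := fun ω : Tape AL.sampleSize S => curPred P AL ω r)
    (g := fun ω => testFun P AL r j l ω) (measurable_curPred r) (measurable_testFun r j l)
  exact measurableSet_le measurable_const (h1.sub (h2.const_mul _)).abs

/-- All examples from the start of round `r` on are redrawn. The predictor and the test function
with a fixed call do not depend on them, so the statistic becomes a sum of i.i.d. terms. -/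
theorem measure_badTest_le (r j l : ℕ) : tapeLaw J ν AL.sampleSize (badTest P AL J r j l) ≤
    ENNReal.ofReal (2 * Real.exp (-(P.n : ℝ) ^ 2 / (2 * P.n * (P.M : ℝ) ^ 2))) := by
  refine measure_le_of_resample
    (measurePreserving_newExamples (J := J) (ν := ν) {i | P.exStart r ≤ i})
    (measurableSet_badTest r j l) fun ω => ?_
  have mκ : Measurable (curPred P AL ω r) := measurable_curPred_apply ω r
  have mg : Measurable (testFun P AL r j l ω) := by
    have h := (measurable_testFun (P := P) (AL := AL) r j l).comp
      (measurable_prodMk_left (x := ω))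
    simpa only [Function.comp_def] using h
  have hκ : ∀ p, 0 ≤ curPred P AL ω r p ∧ curPred P AL ω r p ≤ P.M := curPred_mem P AL ω r
  set φ : I × Bool → ℝ := fun x =>
    (P.M * outcome x.2 - curPred P AL ω r x.1) * testFun P AL r j l ω x.1 with hφ
  have mφ : Measurable φ := (measurable_scaled_residual mκ).mul (mg.comp measurable_fst)
  have hb : ∀ x, |φ x| ≤ P.M := fun x => by
    rw [hφ, abs_mul]
    exact (mul_le_of_le_one_right (abs_nonneg _) (abs_testFun_le r j l ω x.1)).trans
      (abs_residual_le (hκ x.1).1 (hκ x.1).2 x.2)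
  refine (measure_mono fun b hb => ?_).trans
    (two_sided_tail J mφ (Nat.cast_nonneg P.M) hb (P.exStart r) P.n)
  have ha : ∀ c, Agree (P.exStart r) c (newExamples {i | P.exStart r ≤ i} ω b) ω := fun c =>
    agree_newExamples (fun _ h => h) c ω b
  have hs : testStat P AL (newExamples {i | P.exStart r ≤ i} ω b) r (curPred P AL ω r)
      (testFun P AL r j l ω) = ∑ i ∈ Finset.range P.n, φ (b (P.exStart r + i)) :=
    Finset.sum_congr rfl fun i _ => by
      rw [show (newExamples {i | P.exStart r ≤ i} ω b).1 (P.exStart r + i) =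
        b (P.exStart r + i) from splice_of_mem (Nat.le_add_right _ _) _ _]
  have hb' : (P.n : ℝ) ≤ |testStat P AL (newExamples {i | P.exStart r ≤ i} ω b) r
      (curPred P AL (newExamples {i | P.exStart r ≤ i} ω b) r)
      (testFun P AL r j l (newExamples {i | P.exStart r ≤ i} ω b)) -
    P.n * corr J P.M (curPred P AL (newExamples {i | P.exStart r ≤ i} ω b) r)
      (testFun P AL r j l (newExamples {i | P.exStart r ≤ i} ω b))| := hb
  rw [curPred_congr (ha _) le_rfl le_rfl, testFun_congr (ha _), hs] at hb'
  exact hb'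

theorem not_accurate_subset : {ω : Tape AL.sampleSize S | ¬ ∀ r < P.N, Accurate P AL ω J r} ⊆
    ⋃ r ∈ Finset.range P.N, ⋃ j ∈ Finset.range (2 * P.R + 1),
      ⋃ l ∈ Finset.range (P.N * (P.M + 2)), badTest P AL J r j l := by
  intro ω hω
  have h : ¬ ∀ r < P.N, Accurate P AL ω J r := hω
  simp only [Accurate, not_forall, not_le] at h
  obtain ⟨r, hr, j, hj, l, hl, h⟩ := h
  simp only [Set.mem_iUnion, Finset.mem_range, exists_prop]
  exact ⟨r, hr, j, hj, l, hl.trans_le (Nat.mul_le_mul_right _ hr), h.le⟩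

/-- With `X = N R`, the choice of `n` makes Hoeffding's exponent `n/(2M²) = 25 X`, which beats the
at most `2^(5X)` tests in the union bound. -/
theorem measure_not_accurate_le (hM : 0 < P.M) (hMN : P.M + 2 ≤ P.N) (hR : 0 < P.R)
    (hn : P.n = 50 * (P.M * P.M) * (P.N * P.R)) :
    tapeLaw J ν AL.sampleSize {ω | ¬ ∀ r < P.N, Accurate P AL ω J r} ≤
      ENNReal.ofReal ((1 / 2) ^ P.R) := by
  set X := P.N * P.R with hX
  have hX0 : 0 < X := Nat.mul_pos (by omega) hR
  have hexp : 2 * Real.exp (-(P.n : ℝ) ^ 2 / (2 * P.n * (P.M : ℝ) ^ 2)) ≤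
      2 * (1 / 2) ^ (25 * X) := by
    have h1 : -(P.n : ℝ) ^ 2 / (2 * P.n * (P.M : ℝ) ^ 2) = ((25 * X : ℕ) : ℝ) * (-1) := by
      have hM' : (P.M : ℝ) ≠ 0 := by positivity
      have hX' : (X : ℝ) ≠ 0 := by positivity
      rw [hn]
      push_cast
      field_simp
      norm_num
    rw [h1, Real.exp_nat_mul]
    have h2 : Real.exp (-1) ≤ 1 / 2 := by
      rw [Real.exp_neg, one_div]
      exact inv_anti₀ (by norm_num) (by linarith [Real.add_one_le_exp 1])
    gcongr
  have hle : ∀ r j l, tapeLaw J ν AL.sampleSize (badTest P AL J r j l) ≤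
      ENNReal.ofReal (2 * (1 / 2) ^ (25 * X)) := fun r j l =>
    (measure_badTest_le r j l).trans (ENNReal.ofReal_le_ofReal hexp)
  have hsum : tapeLaw J ν AL.sampleSize {ω | ¬ ∀ r < P.N, Accurate P AL ω J r} ≤
      ∑ _r ∈ Finset.range P.N, ∑ _j ∈ Finset.range (2 * P.R + 1),
        ∑ _l ∈ Finset.range (P.N * (P.M + 2)), ENNReal.ofReal (2 * (1 / 2) ^ (25 * X)) := by
    refine (measure_mono not_accurate_subset).trans ((measure_biUnion_finset_le _ _).trans
      (Finset.sum_le_sum fun r _ => (measure_biUnion_finset_le _ _).trans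
        (Finset.sum_le_sum fun j _ => (measure_biUnion_finset_le _ _).trans
          (Finset.sum_le_sum fun l _ => hle r j l))))
  refine hsum.trans ?_
  simp only [Finset.sum_const, Finset.card_range, smul_smul]
  rw [nsmul_eq_mul, ← ENNReal.ofReal_natCast, ← ENNReal.ofReal_mul (Nat.cast_nonneg _)]
  refine ENNReal.ofReal_le_ofReal ?_
  have hcount : P.N * ((2 * P.R + 1) * (P.N * (P.M + 2))) ≤ 2 ^ (5 * X) := by
    have h2 : X < 2 ^ X := Nat.lt_two_pow_self
    have h3 : P.N ≤ X := Nat.le_mul_of_pos_right _ hR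
    calc P.N * ((2 * P.R + 1) * (P.N * (P.M + 2))) ≤ P.N * ((3 * P.R) * (P.N * P.N)) := by
          gcongr
          omega
      _ = 3 * (X * P.N * P.N) := by rw [hX]; ring
      _ ≤ 4 * (2 ^ X * 2 ^ X * 2 ^ X) := by gcongr <;> omega
      _ = 2 ^ (2 + (X + X + X)) := by rw [pow_add, pow_add 2 (X + X), pow_add]; rfl
      _ ≤ 2 ^ (5 * X) := Nat.pow_le_pow_right (by norm_num) (by omega)
  have hcount' : ((P.N * ((2 * P.R + 1) * (P.N * (P.M + 2))) : ℕ) : ℝ) ≤ 2 ^ (5 * X) := by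
    exact_mod_cast hcount
  have hRX : P.R ≤ X := Nat.le_mul_of_pos_left _ (by omega)
  calc _ ≤ (2 : ℝ) ^ (5 * X) * (2 * (1 / 2) ^ (25 * X)) := by gcongr
    _ = 2 * (1 / 2) ^ (20 * X) := by
      rw [show 25 * X = 5 * X + 20 * X by ring, pow_add, ← mul_assoc, ← mul_assoc,
        mul_right_comm (2 ^ (5 * X)), ← mul_pow]
      norm_num
    _ ≤ 2 * (1 / 2) ^ (P.R + 1) := by
      gcongr ?_ * ?_
      exact pow_le_pow_of_le_one (by norm_num) (by norm_num) (by omega)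
    _ = (1 / 2) ^ P.R := by rw [pow_succ]; ring

end Concentration

end Omniprediction

end

noncomputable section

namespace Omniprediction

/-! ### The guarantee -/

theorem measure_not_isOmnipredictor_le {ε δ : ℝ} (hε : 0 < ε) (hε1 : ε < 1) (hδ : 0 < δ)
    {K : Set (I → I)} (hK : IsValid K) (hm : ∀ κ ∈ K, Measurable κ) {S : Type u}
    [MeasurableSpace S] {ν : Measure S} [IsProbabilityMeasure ν] {AL : Learner S}
    (hAL : IsAgnosticLearner ν AL (ε / 3) (thr K)) (J : Measure (I × Bool))
    [IsProbabilityMeasure J] :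
    tapeLaw J ν AL.sampleSize {ω | ¬ IsOmnipredictor J ε K (output (params ε δ) AL ω)} ≤
      ENNReal.ofReal δ := by
  set L := halvings δ + 1 with hL
  set P := params ε δ with hP
  set k := P.M * P.M * L with hk
  have hgrid : 42 ≤ P.M * ε := le_gridSize_mul hε
  have hM : 0 < P.M := by
    rcases Nat.eq_zero_or_pos P.M with h | h
    · rw [h] at hgrid
      norm_num at hgrid
    · exact h
  have hN : P.N = 50 * (P.M * P.M) := rfl
  have hR : P.R = 10 * L := rfl
  have hn : P.n = 50 * (P.M * P.M) * (P.N * P.R) := by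
    rw [← mul_assoc]; rfl
  have hL0 : 0 < L := Nat.succ_pos _
  have hMM : P.M ≤ P.M * P.M := Nat.le_mul_of_pos_left _ hM
  have hR0 : 0 < P.R := by omega
  have hN0 : 0 < P.N := by omega
  have hn0 : 0 < P.n := by rw [hn]; positivity
  have hNR : P.N * P.R = 500 * k := by rw [hN, hR, hk]; ring
  have hMR : P.M ^ 2 * P.R = 10 * k := by rw [hR, hk]; ring
  have hmt : ∀ f ∈ thr K, Measurable f := fun f hf => measurable_of_mem_thr hm hf
  obtain ⟨C, hC, hc, hd⟩ := exists_countable_dense (J := J) (thr K) hmt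
  have hmC : ∀ f ∈ C, Measurable f := fun f hf => hmt f (hC hf)
  have hsub : {ω | ¬ IsOmnipredictor J ε K (output P AL ω)} ⊆
      {ω | ¬ ∀ r < P.N, Accurate P AL ω J r} ∪ {ω | 245 * k ≤
        ∑ r ∈ Finset.range P.N, wrongCount P AL ω J C (2 * P.M * (ε / 3)) r P.R} := by
    intro ω hω
    by_contra hcon
    rw [Set.mem_union, not_or] at hcon
    have hacc : ∀ r < P.N, Accurate P AL ω J r := not_not.mp hcon.1
    have hw : ∑ r ∈ Finset.range P.N, wrongCount P AL ω J C (2 * P.M * (ε / 3)) r P.R < 245 * k :=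
      not_le.mp hcon.2
    -- The count works because `2 · 245 k + 10 k = 500 k`, where `10 k = M² R` stands for the
    -- non-quiet rounds and fewer than `245 k` steps are wrong.
    obtain ⟨s, hs, hq, hs'⟩ := exists_good_round (C := C)
      (η := 2 * P.M * (ε / 3)) hn0 hacc (measurable_curPred_apply ω)
      (measurable_curFeat_apply ω) (by rw [hNR, hMR]; omega)
    exact hω (isOmnipredictor_output hK hm hgrid hM hn0 hacc (measurable_curPred_apply ω) hs hq
      (corr_le_of_dense hmt hC hd (measurable_curPred_apply ω s) (curPred_mem P AL ω s) hs'))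
  have hLk : L ≤ k := Nat.le_mul_of_pos_left _ (Nat.mul_pos hM hM)
  -- The extra halving in `L` splits `δ` between inaccurate tests and too many wrong steps.
  have hhalf : ∀ a, L ≤ a → ((1 : ℝ) / 2) ^ a ≤ δ / 2 := fun a ha => by
    refine (pow_le_pow_of_le_one (by norm_num) (by norm_num) ha).trans ?_
    rw [hL, pow_succ]
    linarith [halvings_spec hδ]
  calc _ ≤ _ := (measure_mono hsub).trans (measure_union_le _ _)
    _ ≤ ENNReal.ofReal (δ / 2) + ENNReal.ofReal (δ / 2) := by
      refine add_le_add ?_ ?_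
      · exact (measure_not_accurate_le hM (by omega) hR0 hn).trans
          (ENNReal.ofReal_le_ofReal (hhalf _ (by omega)))
      · exact (measure_wrong_le hM hAL (const_mem_thr hK) (by linarith) hC hc hmC hNR).trans
          (ENNReal.ofReal_le_ofReal (hhalf _ hLk))
    _ = ENNReal.ofReal δ := by
      rw [← ENNReal.ofReal_add (by positivity) (by positivity), add_halves]

/-- The constant is far from sharp here: the same one has to serve for the running time. -/
theorem callStart_le {ε δ : ℝ} (hε : 0 < ε) (hε1 : ε < 1) (hδ : 0 < δ) (hδ1 : δ < 1) :
    (((params ε δ).callStart (params ε δ).N : ℕ) : ℝ) ≤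
      (3 * 10 ^ 14 * 43 ^ 14) * Real.log (2 / δ) / ε ^ 2 := by
  have h1 : (((params ε δ).callStart (params ε δ).N : ℕ) : ℝ) ≤
      1050 * ((gridSize ε : ℝ) ^ 2 * ((halvings δ + 1 : ℕ) : ℝ)) := by
    exact_mod_cast calls_le (M := gridSize ε) (L := halvings δ + 1) (Nat.succ_pos _)
  have h2 := gridSize_le hε hε1
  have h3 := halvings_le hδ hδ1
  have h0 : 0 ≤ Real.log (2 / δ) :=
    Real.log_nonneg (by rw [le_div_iff₀ hδ]; linarith)
  calc _ ≤ 1050 * ((43 * (1 / ε)) ^ 2 * (3 * Real.log (2 / δ))) := h1.trans (by gcongr)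
    _ = 1050 * 43 ^ 2 * 3 * (Real.log (2 / δ) / ε ^ 2) := by field_simp
    _ ≤ 3 * 10 ^ 14 * 43 ^ 14 * (Real.log (2 / δ) / ε ^ 2) :=
      mul_le_mul_of_nonneg_right (by norm_num) (by positivity)
    _ = _ := (mul_div_assoc _ _ _).symm

theorem totalTime_params_le {ε δ : ℝ} (hε : 0 < ε) (hε1 : ε < 1) (hδ : 0 < δ) (hδ1 : δ < 1) :
    ((totalTime (params ε δ) (halvings δ) : ℕ) : ℝ) ≤
      (3 * 10 ^ 14 * 43 ^ 14) * (1 / ε) ^ 14 * Real.log (2 / δ) := by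
  have hM : 1 ≤ gridSize ε := Nat.ceil_pos.mpr (by positivity)
  have hmono : totalTime (params ε δ) (halvings δ) ≤ totalTime (params ε δ) (halvings δ + 1) := by
    unfold totalTime setupTime
    omega
  have h1 : ((totalTime (params ε δ) (halvings δ) : ℕ) : ℝ) ≤
      10 ^ 14 * ((gridSize ε : ℝ) ^ 14 * ((halvings δ + 1 : ℕ) : ℝ)) := by
    exact_mod_cast hmono.trans (totalTime_le hM (Nat.succ_pos _))
  have h2 := gridSize_le hε hε1
  have h3 := halvings_le hδ hδ1
  calc _ ≤ 10 ^ 14 * ((43 * (1 / ε)) ^ 14 * (3 * Real.log (2 / δ))) := h1.trans (by gcongr)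
    _ = _ := by rw [mul_pow]; ring

end Omniprediction

end

theorem mainTheorem4 :
    ∃ (A : Omniprediction.Algorithm) (C : ℝ) (k : ℕ),
      ∀ (ε δ : ℝ), 0 < ε → ε < 1 → 0 < δ → δ < 1 →
      ∀ (K : Set (I → I)), Omniprediction.IsValid K → (∀ κ ∈ K, Measurable κ) →
      ∀ (S : Type u) [MeasurableSpace S] (ν : Measure S) [IsProbabilityMeasure ν]
        (AL : Omniprediction.Learner S),
        Omniprediction.IsAgnosticLearner ν AL (ε / 3) (Omniprediction.thr K) →
      ∀ (J : Measure (I × Bool)) [IsProbabilityMeasure J],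
        ∃ out : Omniprediction.Tape AL.sampleSize S → I → I,
          (∀ ω, A.Outputs AL (C * Real.log (2 / δ) / ε ^ 2)
            (C * (1 / ε) ^ k * Real.log (2 / δ)) ε δ ω (out ω)) ∧
          Omniprediction.tapeLaw J ν AL.sampleSize
            {ω | ¬ Omniprediction.IsOmnipredictor J ε K (out ω)} ≤ ENNReal.ofReal δ := by
  refine ⟨Omniprediction.omnipredict, 3 * 10 ^ 14 * 43 ^ 14, 14, ?_⟩
  intro ε δ hε hε1 hδ hδ1 K hK hm S _ ν _ AL hAL J _
  exact ⟨Omniprediction.output (Omniprediction.params ε δ) AL,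
    fun ω => Omniprediction.omnipredict_outputs hε hδ rfl
      (Omniprediction.totalTime_params_le hε hε1 hδ hδ1)
      (Omniprediction.callStart_le hε hε1 hδ hδ1),
    Omniprediction.measure_not_isOmnipredictor_le hε hε1 hδ hK hm hAL J⟩
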